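/- **Definitions.** Let $\mathcal I=\{0,1\}^\infty\times\mathbb R^\infty$, where $\{0,1\}^\infty=\bigsqcup_{i\ge 0}\{0,1\}^i$ and $\mathbb R^\infty=\bigsqcup_{i\ge 0}\mathbb R^i$. A *decision problem* is a pair $(S,\mu)$ with $S\subseteq\mathcal I$ and $\mu:\mathcal I\to[1,\infty]$. For $(u,x)\in\{0,1\}^s\times\mathbb R^n$ let $\mathrm{length}(u,x)=s+n$ and $\mathrm{size}(u,x)=\mathrm{length}(u,x)+\lceil\log_2\mu(u,x)\rceil$, which is $\infty$ if $\mu(u,x)=\infty$ (then $(u,x)$ is *ill-posed*; otherwise it is *well-posed*). A *finite-precision BSS machine* is a Blum–Shub–Smale machine over $\mathbb R$ (with operations $+,-,\times,/$, built-in real constants, tests $z\ge 0$ and copying; no division by zero is carried out). For $u_{\rm mach}\in(0,1)$, in a $u_{\rm mach}$-*computation* every built-in constant, every input value and every result of an arithmetic operation $z$ is replaced by some $z(1+\delta)$ with $|\delta|<u_{\rm mach}$, where $\delta$ may be different each time; everything else is exact. The machine has access to $u_{\rm mach}$ and to the binary expansion of the precision $k_{\rm mach}=\lceil\log_2(1/u_{\rm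 mach})\rceil$. The arithmetic cost of a computation is its number of steps. A function $T$ with values in $\mathbb N$ is *time constructible* if a Turing machine computes $T$ from its argument(s), in binary, in time $O(T)$. $(S,\mu)$ is *solved with cost* $(\mathrm{Arith},\mathrm{Prec})$, where $\mathrm{Arith}:\mathbb N\times\mathbb N\to\mathbb N$ and $\mathrm{Prec}:\mathbb N\to\{1,2,\dots\}$ are time constructible, if there is a finite-precision BSS machine such that, for every well-posed $(u,x)\in\mathcal I$ and every $u_{\rm mach}\in(0,1)$, all $u_{\rm mach}$-computations with input $(u,x)$ halt with arithmetic cost at most $\mathrm{Arith}(\mathrm{length}(u,x),k_{\rm mach})$, and, if $k_{\rm mach}\ge\mathrm{Prec}(\mathrm{size}(u,x))$, all of them correctly decide whether $(u,x)\in S$. * $(S,\mu)\in\mathrm P_{\rm ro}$ if it is solved with some cost $(\mathrm{Arith},\mathrm{Prec})$ such that $\mathrm{Prec}$ is bounded by a polynomial and $\mathrm{Arith}(\mathrm{length}(u,x),\mathrm{Prec}(\mathrm{size}(u,x)))$ is bounded by a polynomial in $\mathrm{size}(u,x)$, for all well-posed $(u,x)$. * $(S,\mu)\in\mathrm{EXP}_{\rm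 ro}^{[\mathsf P]}$ if it is solved with some cost $(\mathrm{Arith},\mathrm{Prec})$ such that $\mathrm{Prec}$ is bounded by a polynomial and, for some $C,a,d\in\mathbb N$ with $a>1$ and $d>0$, $\mathrm{Arith}(\mathrm{length}(u,x),\mathrm{Prec}(\mathrm{size}(u,x)))\le C\,a^{\mathrm{size}(u,x)^d}$ for all well-posed $(u,x)$. For $k\ge 1$ let $F_k$ be the floating-point system with base $2$, precision $k+1$ and exponents from $-2^k+1$ to $2^{k+1}-1$; its range is $\{0\}\cup\{x\in\mathbb R: 2^{-2^k}\le|x|\le 2^{2^{k+1}-1}(1-2^{-k-1})\}$. The *magnitude* of $x\in\mathbb R$ is $\mathrm{mgt}(x)=\min\{k\ge 1: x\in\mathrm{Range}(F_k)\}$, and $\mathrm{mgt}(y)=\max_i\mathrm{mgt}(y_i)$ for $y\in\mathbb R^m$. * $(W,\mu_W)\in\mathrm{NP}^{\mathsf B}_{\rm ro}$ if there are a decision problem $(B,\mu_B)\in\mathrm P_{\rm ro}$ and polynomials $p,q,Q$ (with $p$ and $q$ having coefficients in $\mathbb N$) such that for all $(u,x)\in\mathcal I$, with $m=p(\mathrm{length}(u,x))$: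 (i) if $(u,x)\in W$, there is $y^*\in\mathbb R^m$ with $(u,x,y^*)\in B$, $\log_2\mu_B(u,x,y^*)\le Q(\log_2\mu_W(u,x))$ and $\mathrm{mgt}(y^*)\le q(\mathrm{size}_W(u,x))$; (ii) if $(u,x)\notin W$, then for all $y\in\mathbb R^m$, $(u,x,y)\notin B$ and $\log_2\mu_B(u,x,y)\le Q(\log_2\mu_W(u,x))$. If $\mu_W(u,x)=\infty$, the bounds on $\log_2\mu_B$ and on $\mathrm{mgt}$ are void. **Corollary.** $\mathrm{NP}^{\mathsf B}_{\rm ro}\subset\mathrm{EXP}_{\rm ro}^{[\mathsf P]}$, and the inclusion is strict: every decision problem in $\mathrm{NP}^{\mathsf B}_{\rm ro}$ belongs to $\mathrm{EXP}_{\rm ro}^{[\mathsf P]}$, and some decision problem in $\mathrm{EXP}_{\rm ro}^{[\mathsf P]}$ does not belong to $\mathrm{NP}^{\mathsf B}_{\rm ro}$. -/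

import Mathlib

open scoped ENNReal Polynomial

namespace RoundoffComplexity

/-! ### Time constructible functions -/

/-- The Turing machine `M` (in Mathlib's multi-stack model), started on the word `w`, halts within
`t` steps with the word `v` on its output stack. -/
def TMReturnsWithin {A B : Type} (M : Turing.TM2ComputableAux A B) (w : List A) (v : List B)
    (t : ℕ) : Prop :=
  ∃ c : M.tm.Cfg,
    Nonempty (StateTransition.EvalsToInTime M.tm.step
      (Turing.initList M.tm (w.map M.inputAlphabet.symm)) (some c) t) ∧
    c.l = none ∧ (c.stk M.tm.k₁).map M.outputAlphabet = v

/-- `T : ℕ → ℕ` is time constructible: some Turing machine computes `T n` from `n` (both in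
binary) in time `O(T n)`, that is, in at most `C * (T n + 1)` steps. -/
def TimeConstructible (T : ℕ → ℕ) : Prop :=
  ∃ (M : Turing.TM2ComputableAux Bool Bool) (C : ℕ),
    ∀ n, TMReturnsWithin M n.bits (T n).bits (C * (T n + 1))

/-- A pair of numbers as a word: the two binary expansions, separated by `none`. -/
def encodePair (m n : ℕ) : List (Option Bool) :=
  m.bits.map some ++ none :: n.bits.map some

/-- Time constructibility for functions of two arguments. -/
def TimeConstructible₂ (T : ℕ → ℕ → ℕ) : Prop :=
  ∃ (M : Turing.TM2ComputableAux (Option Bool) Bool) (C : ℕ),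
    ∀ m n, TMReturnsWithin M (encodePair m n) (T m n).bits (C * (T m n + 1))

/-! ### Decision problems -/

/-- The set `{0,1}^∞ × ℝ^∞` of inputs. -/
abbrev Input : Type := List Bool × List ℝ

/-- The length of an input: the number of its bits plus the number of its reals. -/
def Input.len (z : Input) : ℕ := z.1.length + z.2.length

/-- A decision problem: a set of inputs with a condition number in `[1,∞]`. -/
structure DecisionProblem where
  carrier : Set Input
  μ : Input → ℝ≥0∞
  one_le_μ : ∀ z, 1 ≤ μ z

/-- Well-posed inputs: the condition number is finite. -/
def DecisionProblem.WellPosed (S : DecisionProblem) (z : Input) : Prop := S.μ z ≠ ∞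

/-- `log₂ μ`, for well-posed inputs (only used for these). -/
noncomputable def DecisionProblem.logCond (S : DecisionProblem) (z : Input) : ℝ :=
  Real.logb 2 (S.μ z).toReal

/-- `size = length + ⌈log₂ μ⌉`, for well-posed inputs (only used for these; the size of an
ill-posed input is infinite). -/
noncomputable def DecisionProblem.size (S : DecisionProblem) (z : Input) : ℕ :=
  z.len + ⌈S.logCond z⌉₊

/-! ### Finite-precision BSS machines -/

/-- The four arithmetic operations. -/
inductive ArithOp
  | add | sub | mul | div

/-- The exact value of an operation. Machines are supposed to test a divisor before they divide
by it; this test is built into the operation here, which yields `0` if the divisor is `0`. -/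
noncomputable def ArithOp.eval : ArithOp → ℝ → ℝ → ℝ
  | .add, a, b => a + b
  | .sub, a, b => a - b
  | .mul, a, b => a * b
  | .div, a, b => a / b

/-- The nodes of a BSS machine with `τ` tapes and nodes numbered by `Fin N`. On each tape the head
is at cell `0`; the shift nodes move the tape under it. Each node names its successor(s). -/
inductive Node (τ N : ℕ)
  /-- write the built-in constant `c` on tape `d` -/
  | const (c : ℝ) (d : Fin τ) (next : Fin N)
  /-- write on tape `d` the result of an operation on the scanned cells of tapes `a` and `b` -/
  | arith (op : ArithOp) (a b d : Fin τ) (next : Fin N)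
  /-- copy the scanned cell of tape `a` to the scanned cell of tape `d` -/
  | copy (a d : Fin τ) (next : Fin N)
  /-- copy the read-only register holding the unit roundoff to tape `d` -/
  | readUnit (d : Fin τ) (next : Fin N)
  | shiftLeft (d : Fin τ) (next : Fin N)
  | shiftRight (d : Fin τ) (next : Fin N)
  /-- go to `yes` if the scanned cell of tape `a` is `≥ 0`, and to `no` otherwise -/
  | branch (a : Fin τ) (yes no : Fin N)
  /-- halt and output `Yes` (`true`) or `No` (`false`) -/
  | halt (answer : Bool)

/-- A BSS machine over `ℝ`: finitely many two-way infinite tapes with real entries, and a finite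
program. Three tapes are reserved for the bits of the input, the reals of the input, and the
precision. -/
structure Machine where
  extraTapes : ℕ
  extraNodes : ℕ
  prog : Fin (extraNodes + 1) → Node (extraTapes + 3) (extraNodes + 1)

/-- A configuration: the current node and the contents of the tapes. -/
structure Machine.Config (M : Machine) where
  node : Fin (M.extraNodes + 1)
  tape : Fin (M.extraTapes + 3) → ℤ → ℝ

/-- The tapes, after `v` has been written to the scanned cell of tape `d`. -/
def writeTape {τ : ℕ} (t : Fin τ → ℤ → ℝ) (d : Fin τ) (v : ℝ) : Fin τ → ℤ → ℝ :=
  Function.update t d (Function.update (t d) 0 v)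

/-- `w` is a possible value of `fl(z)` for the unit roundoff `u`. -/
def Rounds (u z w : ℝ) : Prop := ∃ δ : ℝ, |δ| < u ∧ w = z * (1 + δ)

/-- One step with unit roundoff `u`: constants and results of arithmetic operations are rounded,
all else is exact. A halted machine stays where it is. -/
def Machine.Step (M : Machine) (u : ℝ) (c c' : M.Config) : Prop :=
  match M.prog c.node with
  | .const r d next => ∃ w, Rounds u r w ∧ c' = ⟨next, writeTape c.tape d w⟩
  | .arith op a b d next =>
      ∃ w, Rounds u (op.eval (c.tape a 0) (c.tape b 0)) w ∧ c' = ⟨next, writeTape c.tape d w⟩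
  | .copy a d next => c' = ⟨next, writeTape c.tape d (c.tape a 0)⟩
  | .readUnit d next => c' = ⟨next, writeTape c.tape d u⟩
  | .shiftLeft d next => c' = ⟨next, Function.update c.tape d (fun i => c.tape d (i + 1))⟩
  | .shiftRight d next => c' = ⟨next, Function.update c.tape d (fun i => c.tape d (i - 1))⟩
  | .branch a yes no =>
      (0 ≤ c.tape a 0 → c' = ⟨yes, c.tape⟩) ∧ (c.tape a 0 < 0 → c' = ⟨no, c.tape⟩)
  | .halt _ => c' = c

/-- The precision `⌈log₂ (1/u)⌉` belonging to the unit roundoff `u`. -/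
noncomputable def precision (u : ℝ) : ℕ := ⌈Real.logb 2 (1 / u)⌉₊

/-- The tape holding a list: its entries in the cells `0, 1, 2, …`, its length in unary in the
cells `-1, -2, …`, and zeros elsewhere. -/
def tapeOfList (l : List ℝ) (i : ℤ) : ℝ :=
  if 0 ≤ i then l.getD i.toNat 0 else if -i ≤ l.length then 1 else 0

/-- Bits as real numbers. -/
def realBits (w : List Bool) : List ℝ := w.map fun b => if b then 1 else 0

/-- The possible initial configurations: the (rounded) bits of the input on the first tape, its
(rounded) reals on the second, the binary expansion of the precision on the third. -/
def Machine.IsInitial (M : Machine) (u : ℝ) (z : Input) (c : M.Config) : Prop :=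
  ∃ v x : List ℝ, List.Forall₂ (Rounds u) (realBits z.1) v ∧ List.Forall₂ (Rounds u) z.2 x ∧
    c = ⟨0, fun d =>
      if d.val = 0 then tapeOfList v
      else if d.val = 1 then tapeOfList x
      else if d.val = 2 then tapeOfList (realBits (precision u).bits)
      else fun _ => 0⟩

/-- `c` is a `u`-computation of `M` with input `z`. -/
def Machine.IsComputation (M : Machine) (u : ℝ) (z : Input) (c : ℕ → M.Config) : Prop :=
  M.IsInitial u z (c 0) ∧ ∀ t, M.Step u (c t) (c (t + 1))

/-- The computation `c` halts within `t` steps. -/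
def Machine.HaltsWithin (M : Machine) (c : ℕ → M.Config) (t : ℕ) : Prop :=
  ∃ s ≤ t, ∃ b, M.prog (c s).node = .halt b

/-- The computation `c` halts with output `b`. -/
def Machine.Outputs (M : Machine) (c : ℕ → M.Config) (b : Bool) : Prop :=
  ∃ s, M.prog (c s).node = .halt b

/-- The machine `M` solves `S` with cost `(Arith, Prec)`. -/
def Machine.SolvesWithCost (M : Machine) (S : DecisionProblem)
    (Arith : ℕ → ℕ → ℕ) (Prec : ℕ → ℕ) : Prop :=
  ∀ z, S.WellPosed z → ∀ u : ℝ, 0 < u → u < 1 → ∀ c, M.IsComputation u z c →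
    M.HaltsWithin c (Arith z.len (precision u)) ∧
    (Prec (S.size z) ≤ precision u →
      (z ∈ S.carrier → M.Outputs c true) ∧ (z ∉ S.carrier → M.Outputs c false))

/-- `S` is solved with cost `(Arith, Prec)`, these functions being time constructible. As every
precision is at least `1`, so are the values of `Prec`. -/
def SolvedWithCost (S : DecisionProblem) (Arith : ℕ → ℕ → ℕ) (Prec : ℕ → ℕ) : Prop :=
  TimeConstructible₂ Arith ∧ TimeConstructible Prec ∧ (∀ n, 1 ≤ Prec n) ∧
    ∃ M : Machine, M.SolvesWithCost S Arith Prec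

/-! ### Complexity classes -/

/-- `Prec` is bounded by a polynomial. -/
def PolyBounded (Prec : ℕ → ℕ) : Prop := ∃ P : ℕ[X], ∀ n, Prec n ≤ P.eval n

/-- Roundoff polynomial cost. -/
def Pro : Set DecisionProblem :=
  {S | ∃ Arith Prec, SolvedWithCost S Arith Prec ∧ PolyBounded Prec ∧
    ∃ P : ℕ[X], ∀ z, S.WellPosed z → Arith z.len (Prec (S.size z)) ≤ P.eval (S.size z)}

/-- Roundoff exponential cost with polynomial precision. (The constant `C` matters for size `0`
only, where `a ^ n ^ d` is `1`.) -/
def EXProPolyPrec : Set DecisionProblem :=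
  {S | ∃ Arith Prec, SolvedWithCost S Arith Prec ∧ PolyBounded Prec ∧
    ∃ C a d : ℕ, 1 < a ∧ 0 < d ∧
      ∀ z, S.WellPosed z → Arith z.len (Prec (S.size z)) ≤ C * a ^ (S.size z) ^ d}

/-- The range of the floating-point system with base `β`, precision `t` and exponents from `emin`
to `emax`. -/
def floatRange (β t : ℕ) (emin emax : ℤ) : Set ℝ :=
  {x | x = 0 ∨ ((β : ℝ) ^ (emin - 1) ≤ |x| ∧ |x| ≤ (β : ℝ) ^ emax * (1 - (β : ℝ) ^ (-(t : ℤ))))}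

/-- The range of the system `F_k`: base `2`, precision `k + 1`, exponents from `-2^k + 1` to
`2^(k+1) - 1`. -/
def rangeF (k : ℕ) : Set ℝ := floatRange 2 (k + 1) (-2 ^ k + 1) (2 ^ (k + 1) - 1)

/-- The magnitude of a real number. -/
noncomputable def mgt (x : ℝ) : ℕ := sInf {k : ℕ | 1 ≤ k ∧ x ∈ rangeF k}

/-- Bounded non-deterministic roundoff polynomial cost. The bounds in terms of the condition of
`(u, x)` are void if `(u, x)` is ill-posed. -/
def NPBro : Set DecisionProblem :=
  {W | ∃ B ∈ Pro, ∃ (p q : ℕ[X]) (Q : ℝ[X]), ∀ (u : List Bool) (x : List ℝ),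
    ((u, x) ∈ W.carrier → ∃ y : List ℝ, y.length = p.eval (Input.len (u, x)) ∧
      (u, x ++ y) ∈ B.carrier ∧
      (W.WellPosed (u, x) →
        B.WellPosed (u, x ++ y) ∧ B.logCond (u, x ++ y) ≤ Q.eval (W.logCond (u, x)) ∧
        ∀ a ∈ y, mgt a ≤ q.eval (W.size (u, x)))) ∧
    ((u, x) ∉ W.carrier → ∀ y : List ℝ, y.length = p.eval (Input.len (u, x)) →
      (u, x ++ y) ∉ B.carrier ∧
      (W.WellPosed (u, x) →
        B.WellPosed (u, x ++ y) ∧ B.logCond (u, x ++ y) ≤ Q.eval (W.logCond (u, x))))}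

end RoundoffComplexity

/-! Inclusion. Let `M` solve the verifying problem `B`. A deterministic program sees the input and
the unit roundoff `u`, but not the condition number, so it does not know which precision and how
much time `M` needs. It therefore derives from `u` a budget `ρ`, proportional to the precision up to
constants and with `u ≤ 2 ^ (-9 ρ)`, and uses it for everything: for each code `n < 2 ^ (ρ ^ 2)` it
generates a vector `y`, and runs `M` on `(x, y)` for `ρ` steps at each of the simulated precisions
`1, …, ρ`. The last run that halts gives the verdict on `y`; the program accepts if some verdict is
Yes.

Three observations make this work. A rounding with `u` is also a rounding with every `v ≥ u`, so
carrying out the instructions of `M` directly is a `v`-computation once the unit roundoff and the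
precision are replaced by simulated ones (`Ends.node_cmd`). At the precision `K` required by the
instance, `M` halts within the budget and is right; at larger precisions it is either right or cut
off, and a run that is cut off leaves the verdict alone, so `K` need not be known (`Ends.next`).
Finally, a vector within relative distance `2 ^ (-ρ)` of a witness is a legitimate rounding of it,
and a number of bounded magnitude is close to `0` or to `± γ ^ (± e)`, for a fixed `γ` slightly
larger than `1` and an exponent `e` with few bits; such a power is generated by repeated squaring,
so codes of `ρ ^ 2` bits suffice (`exists_genRun_push`, `exists_code_of_mgt_le`). If there is no
witness, condition (ii) says that `B` rejects every vector and is well conditioned there, so no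
generated vector can mislead the program. The running time is `2` to a polynomial in length and
precision; it is replaced by a time constructible bound that is a power of two
(`mem_EXProPolyPrec`).

Strictness. The problem `towerParity` asks for the parity of `j`, given `64 ^ 2 ^ j` with `j < 2 ^
n` and `n` padding bits; all admissible inputs have condition `1`. Squaring repeatedly until the
input is passed solves it in exponentially many steps at constant precision (`towerParity_mem`). It
is not in the nondeterministic class: take `j` close to `2 ^ n`, even, with a witness `y`. The same
`y` must be rejected for `j + 1`. Round every value to a signed power of a base `b ≤ 1 + u`. In the
runs on `j` and on `j + 1` all values are then `± b ^ (d N + c)` and `± b ^ (d N' + c)` with the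
same `d`, `c` and sign, where the two inputs are `b ^ N` and `b ^ N'`. During polynomially many
steps `|c|` stays far below `N`, because `y` has small magnitude, so in a sum of terms of different
degrees `d` the smaller one is rounded away, and terms of equal degree combine independently of `N`
(`Coupled.add`). Both runs take the same branches and give the same answer, a contradiction
(`towerParity_notMem`). -/

namespace RoundoffComplexity

/-! ### A structured language for finite-precision machines -/

/-- The contents of the tapes, indexed by `T`. -/
abbrev State (T : Type) : Type := T → ℤ → ℝ

/-- The elementary instructions. -/
inductive Basic (T : Type)
  | const (r : ℝ) (d : T)
  | arith (op : ArithOp) (a b d : T)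
  | copy (a d : T)
  | unit (d : T)
  | shl (d : T)
  | shr (d : T)

/-- Structured programs; `loop a c` repeats `c` while the scanned cell of tape `a` is negative. -/
inductive Cmd (T : Type)
  | basic (b : Basic T)
  | skip
  | seq (c₁ c₂ : Cmd T)
  | ite (a : T) (c₁ c₂ : Cmd T)
  | loop (a : T) (c : Cmd T)

section Semantics

variable {T : Type} [DecidableEq T]

/-- Write `v` to the scanned cell of tape `d`. -/
def put (s : State T) (d : T) (v : ℝ) : State T :=
  Function.update s d (Function.update (s d) 0 v)

/-- The tape, seen from the cell at distance `n` from its head. -/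
def sl (f : ℤ → ℝ) (n : ℤ) : ℤ → ℝ := fun i => f (i + n)

@[simp] theorem sl_apply (f : ℤ → ℝ) (n i : ℤ) : sl f n i = f (i + n) := rfl

@[simp] theorem sl_zero (f : ℤ → ℝ) : sl f 0 = f := by ext; simp

@[simp] theorem sl_sl (f : ℤ → ℝ) (m n : ℤ) : sl (sl f m) n = sl f (n + m) := by
  ext; simp [add_assoc]

/-- The possible effects of an instruction. -/
def Basic.Res (u : ℝ) : Basic T → State T → State T → Prop
  | .const r d, s, s' => ∃ w, Rounds u r w ∧ s' = put s d w
  | .arith op a b d, s, s' => ∃ w, Rounds u (op.eval (s a 0) (s b 0)) w ∧ s' = put s d w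
  | .copy a d, s, s' => s' = put s d (s a 0)
  | .unit d, s, s' => s' = put s d u
  | .shl d, s, s' => s' = Function.update s d (sl (s d) 1)
  | .shr d, s, s' => s' = Function.update s d (sl (s d) (-1))

/-- `Tri u c t s Q`: with unit roundoff `u`, all executions of `c` from `s` end within `t` steps,
in a state that satisfies `Q`. -/
inductive Tri (u : ℝ) : Cmd T → ℕ → State T → (State T → Prop) → Prop
  | basic {b s Q} : (∀ s', b.Res u s s' → Q s') → Tri u (.basic b) 1 s Q
  | skip {s Q} : Q s → Tri u .skip 1 s Q
  | seq {c₁ c₂ t₁ t₂ s Q} (R : State T → Prop) : Tri u c₁ t₁ s R →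
      (∀ s', R s' → Tri u c₂ t₂ s' Q) → Tri u (.seq c₁ c₂) (t₁ + t₂ + 1) s Q
  | ite_nonneg {a c₁ c₂ t s Q} : 0 ≤ s a 0 → Tri u c₁ t s Q → Tri u (.ite a c₁ c₂) (t + 1) s Q
  | ite_neg {a c₁ c₂ t s Q} : s a 0 < 0 → Tri u c₂ t s Q → Tri u (.ite a c₁ c₂) (t + 1) s Q
  | loop_done {a c s Q} : 0 ≤ s a 0 → Q s → Tri u (.loop a c) 1 s Q
  | loop_step {a c t₁ t₂ s Q} (R : State T → Prop) : s a 0 < 0 → Tri u c t₁ s R →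
      (∀ s', R s' → Tri u (.loop a c) t₂ s' Q) → Tri u (.loop a c) (t₁ + t₂ + 1) s Q
  | mono {c t t' s Q Q'} : Tri u c t s Q → t ≤ t' → (∀ s', Q s' → Q' s') → Tri u c t' s Q'

variable {u : ℝ} {c c₁ c₂ : Cmd T} {t t₁ t₂ : ℕ} {s : State T} {Q R : State T → Prop}

theorem Tri.le (h : Tri u c t₁ s Q) (ht : t₁ ≤ t₂) : Tri u c t₂ s Q := h.mono ht fun _ => id

theorem Tri.imp (h : Tri u c t s Q) (hQ : ∀ s', Q s' → R s') : Tri u c t s R := h.mono le_rfl hQ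

/-- Sequential composition of a list of programs. -/
def Cmd.block : List (Cmd T) → Cmd T
  | [] => .skip
  | c :: l => .seq c (block l)

theorem Tri.nil (h : Q s) : Tri u (.block []) 1 s Q := .skip h

theorem Tri.cons {l : List (Cmd T)} (R : State T → Prop) (h₁ : Tri u c t₁ s R)
    (h₂ : ∀ s', R s' → Tri u (.block l) t₂ s' Q) : Tri u (.block (c :: l)) (t₁ + t₂ + 1) s Q :=
  .seq R h₁ h₂

theorem Tri.consB {l : List (Cmd T)} {b : Basic T}
    (h : ∀ s', b.Res u s s' → Tri u (.block l) t s' Q) :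
    Tri u (.block (.basic b :: l)) (1 + t + 1) s Q :=
  .seq (fun s' => b.Res u s s') (.basic fun _ => id) h

end Semantics

/-! ### Compilation -/

section Compile

variable {T : Type} [DecidableEq T]

/-- Small steps: the program is a stack of commands that remain to be executed. -/
def LStep (u : ℝ) : List (Cmd T) × State T → List (Cmd T) × State T → Prop
  | ([], s), y => y = ([], s)
  | (.basic b :: K, s), y => y.1 = K ∧ b.Res u s y.2
  | (.skip :: K, s), y => y = (K, s)
  | (.seq a b :: K, s), y => y = (a :: b :: K, s)
  | (.ite a c₁ c₂ :: K, s), y =>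
      (0 ≤ s a 0 → y = (c₁ :: K, s)) ∧ (s a 0 < 0 → y = (c₂ :: K, s))
  | (.loop a c :: K, s), y =>
      (0 ≤ s a 0 → y = (K, s)) ∧ (s a 0 < 0 → y = (c :: .loop a c :: K, s))

/-- Adequacy of `Tri` for the small-step semantics, by induction on the derivation; the stack `K`
below `c` stays untouched and is arbitrary, as the inductive cases for composed programs require.
Steps are constrained only while the stack is nonempty, because a machine goes on afterwards to its
halting nodes. -/
theorem Tri.run {u : ℝ} {c : Cmd T} {t : ℕ} {s : State T} {Q : State T → Prop}
    (h : Tri u c t s Q) {f : ℕ → List (Cmd T) × State T}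
    (hf : ∀ i, (f i).1 ≠ [] → LStep u (f i) (f (i + 1))) (K : List (Cmd T)) (i : ℕ)
    (hi : f i = (c :: K, s)) : ∃ j ≤ t, ∃ s', f (i + j) = (K, s') ∧ Q s' := by
  induction h generalizing K i with
  | basic h =>
    have := hf i (by simp [hi])
    rw [hi] at this
    exact ⟨1, le_rfl, (f (i + 1)).2, Prod.ext this.1 rfl, h _ this.2⟩
  | skip h =>
    have := hf i (by simp [hi])
    rw [hi] at this
    exact ⟨1, le_rfl, _, this, h⟩
  | seq R h₁ h₂ ih₁ ih₂ =>
    have := hf i (by simp [hi])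
    rw [hi] at this
    obtain ⟨j₁, hj₁, s₁, e₁, r₁⟩ := ih₁ _ _ this
    obtain ⟨j₂, hj₂, s₂, e₂, r₂⟩ := ih₂ _ r₁ _ _ e₁
    exact ⟨1 + j₁ + j₂, by omega, s₂, by rw [← e₂]; congr 1; omega, r₂⟩
  | ite_nonneg h₀ h ih =>
    have := hf i (by simp [hi])
    rw [hi] at this
    obtain ⟨j, hj, s', e, r⟩ := ih _ _ (this.1 h₀)
    exact ⟨1 + j, by omega, s', by rw [← e]; congr 1; omega, r⟩
  | ite_neg h₀ h ih =>
    have := hf i (by simp [hi])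
    rw [hi] at this
    obtain ⟨j, hj, s', e, r⟩ := ih _ _ (this.2 h₀)
    exact ⟨1 + j, by omega, s', by rw [← e]; congr 1; omega, r⟩
  | loop_done h₀ h =>
    have := hf i (by simp [hi])
    rw [hi] at this
    exact ⟨1, le_rfl, _, this.1 h₀, h⟩
  | loop_step R h₀ h₁ h₂ ih₁ ih₂ =>
    have := hf i (by simp [hi])
    rw [hi] at this
    obtain ⟨j₁, hj₁, s₁, e₁, r₁⟩ := ih₁ _ _ (this.2 h₀)
    obtain ⟨j₂, hj₂, s₂, e₂, r₂⟩ := ih₂ _ r₁ _ _ e₁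
    exact ⟨1 + j₁ + j₂, by omega, s₂, by rw [← e₂]; congr 1; omega, r₂⟩
  | mono h ht hQ ih =>
    obtain ⟨j, hj, s', e, r⟩ := ih _ _ hi
    exact ⟨j, hj.trans ht, s', e, hQ _ r⟩

/-- The stacks that occur while `c` is executed on top of the stack `K`. -/
def Cmd.conts : Cmd T → List (Cmd T) → Set (List (Cmd T))
  | .basic b, K => {.basic b :: K}
  | .skip, K => {.skip :: K}
  | .seq a b, K => {.seq a b :: K} ∪ (a.conts (b :: K) ∪ b.conts K)
  | .ite a c₁ c₂, K => {.ite a c₁ c₂ :: K} ∪ (c₁.conts K ∪ c₂.conts K)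
  | .loop a c, K => {.loop a c :: K} ∪ c.conts (.loop a c :: K)

theorem Cmd.conts_finite (c : Cmd T) (K : List (Cmd T)) : (c.conts K).Finite := by
  induction c generalizing K with
  | basic b => simp [conts]
  | skip => simp [conts]
  | seq a b iha ihb => exact (Set.finite_singleton _).union ((iha _).union (ihb _))
  | ite a b c iha ihb => exact (Set.finite_singleton _).union ((iha _).union (ihb _))
  | loop a b ih => exact (Set.finite_singleton _).union (ih _)

theorem Cmd.mem_conts (c : Cmd T) (K : List (Cmd T)) : c :: K ∈ c.conts K := by
  cases c <;> simp [conts]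

/-- The stacks that may come next. -/
def nextConts : List (Cmd T) → Set (List (Cmd T))
  | [] => {}
  | .basic _ :: K => {K}
  | .skip :: K => {K}
  | .seq a b :: K => {a :: b :: K}
  | .ite _ c₁ c₂ :: K => {c₁ :: K, c₂ :: K}
  | .loop a c :: K => {K, c :: .loop a c :: K}

/-- Together with `Cmd.conts_finite`, this closure property allows a machine with one node per
stack: a loop puts itself back under its body, so stacks do not grow with the number of rounds. -/
theorem Cmd.nextConts_subset (c : Cmd T) (K : List (Cmd T)) {L : List (Cmd T)}
    (hL : L ∈ c.conts K) : nextConts L ⊆ c.conts K ∪ {K} := by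
  induction c generalizing K with
  | basic b => simp only [conts, Set.mem_singleton_iff] at hL; subst hL; simp [nextConts]
  | skip => simp only [conts, Set.mem_singleton_iff] at hL; subst hL; simp [nextConts]
  | seq a b iha ihb =>
    rcases hL with hL | hL | hL
    · rw [Set.mem_singleton_iff] at hL
      subst hL
      have := a.mem_conts (b :: K)
      simp [nextConts, conts, this]
    · intro x hx
      rcases iha _ hL hx with h | h
      · simp [conts, h]
      · have := b.mem_conts K
        rw [Set.mem_singleton_iff] at h
        simp [conts, h, this]
    · intro x hx
      rcases ihb _ hL hx with h | h
      · simp [conts, h]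
      · simp_all
  | ite a b c iha ihb =>
    rcases hL with hL | hL | hL
    · rw [Set.mem_singleton_iff] at hL
      subst hL
      have h₁ := b.mem_conts K
      have h₂ := c.mem_conts K
      intro x hx
      rcases hx with rfl | rfl <;> simp [conts, h₁, h₂]
    · intro x hx
      rcases iha _ hL hx with h | h
      · simp [conts, h]
      · simp_all
    · intro x hx
      rcases ihb _ hL hx with h | h
      · simp [conts, h]
      · simp_all
  | loop a b ih =>
    rcases hL with hL | hL
    · rw [Set.mem_singleton_iff] at hL
      subst hL
      have h₁ := b.mem_conts (.loop a b :: K)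
      intro x hx
      rcases hx with rfl | rfl <;> simp [conts, h₁]
    · intro x hx
      rcases ih _ hL hx with h | h
      · simp [conts, h]
      · simp_all [conts]

end Compile

/-! ### Translation of programs into machines. -/

section ToMachine

/-- The node of a machine that executes the next step of a stack of commands; `e` gives the
numbers of the tapes and `g` those of the stacks. -/
def nodeOf {T : Type} {τ N : ℕ} (e : T → Fin τ) (t₀ ans : T) (g : List (Cmd T) → Fin N)
    (yes no : Fin N) : List (Cmd T) → Node τ N
  | [] => .branch (e ans) no yes
  | .basic (.const r d) :: K => .const r (e d) (g K)
  | .basic (.arith op a b d) :: K => .arith op (e a) (e b) (e d) (g K)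
  | .basic (.copy a d) :: K => .copy (e a) (e d) (g K)
  | .basic (.unit d) :: K => .readUnit (e d) (g K)
  | .basic (.shl d) :: K => .shiftLeft (e d) (g K)
  | .basic (.shr d) :: K => .shiftRight (e d) (g K)
  -- Machines have no idle node; copying a cell onto itself takes its place.
  | .skip :: K => .copy (e t₀) (e t₀) (g K)
  | .seq a b :: K => .copy (e t₀) (e t₀) (g (a :: b :: K))
  | .ite a c₁ c₂ :: K => .branch (e a) (g (c₁ :: K)) (g (c₂ :: K))
  | .loop a c :: K => .branch (e a) (g K) (g (c :: .loop a c :: K))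

/-- Used to see that a halting node is entered only from the empty stack or from a halting node. -/
theorem Machine.Step.exists_next {M : Machine} {T : Type} {e : T → Fin (M.extraTapes + 3)}
    {t₀ ans : T} {g : List (Cmd T) → Fin (M.extraNodes + 1)} {yes no : Fin (M.extraNodes + 1)}
    {L : List (Cmd T)} {u : ℝ} {c c' : M.Config}
    (h : M.prog c.node = nodeOf e t₀ ans g yes no L) (hL : L ≠ []) (hs : M.Step u c c') :
    ∃ L' ∈ nextConts L, c'.node = g L' := by
  simp only [Machine.Step, h] at hs
  match L, hL with
  | .basic (.const r d) :: K, _ => obtain ⟨w, -, rfl⟩ := hs; exact ⟨K, rfl, rfl⟩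
  | .basic (.arith op a b d) :: K, _ => obtain ⟨w, -, rfl⟩ := hs; exact ⟨K, rfl, rfl⟩
  | .basic (.copy a d) :: K, _ => exact ⟨K, rfl, congrArg Machine.Config.node hs⟩
  | .basic (.unit d) :: K, _ => exact ⟨K, rfl, congrArg Machine.Config.node hs⟩
  | .basic (.shl d) :: K, _ => exact ⟨K, rfl, congrArg Machine.Config.node hs⟩
  | .basic (.shr d) :: K, _ => exact ⟨K, rfl, congrArg Machine.Config.node hs⟩
  | .skip :: K, _ => exact ⟨K, rfl, congrArg Machine.Config.node hs⟩
  | .seq a b :: K, _ => exact ⟨_, rfl, congrArg Machine.Config.node hs⟩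
  | .ite a c₁ c₂ :: K, _ =>
    rcases le_or_gt 0 (c.tape (e a) 0) with h₀ | h₀
    · exact ⟨c₁ :: K, Or.inl rfl, congrArg Machine.Config.node (hs.1 h₀)⟩
    · exact ⟨c₂ :: K, Or.inr rfl, congrArg Machine.Config.node (hs.2 h₀)⟩
  | .loop a c₁ :: K, _ =>
    rcases le_or_gt 0 (c.tape (e a) 0) with h₀ | h₀
    · exact ⟨K, Or.inl rfl, congrArg Machine.Config.node (hs.1 h₀)⟩
    · exact ⟨_, Or.inr rfl, congrArg Machine.Config.node (hs.2 h₀)⟩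

/-- The initial states of a program: three tapes hold the input, the others are empty. -/
def InitialState {T' : Type} (u : ℝ) (z : Input) (s : State (Fin 3 ⊕ T')) : Prop :=
  ∃ v x : List ℝ, List.Forall₂ (Rounds u) (realBits z.1) v ∧ List.Forall₂ (Rounds u) z.2 x ∧
    s (.inl 0) = tapeOfList v ∧ s (.inl 1) = tapeOfList x ∧
    s (.inl 2) = tapeOfList (realBits (precision u).bits) ∧ ∀ d, s (.inr d) = fun _ => 0

theorem writeTape_comp {T : Type} [DecidableEq T] {τ : ℕ} (e : T ≃ Fin τ) (t : Fin τ → ℤ → ℝ)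
    (d : T) (v : ℝ) : (fun a => writeTape t (e d) v (e a)) = put (fun a => t (e a)) d v := by
  funext a
  by_cases h : a = d
  · subst h; simp [writeTape, put]
  · simp [writeTape, put, h]

theorem update_comp {T : Type} [DecidableEq T] {τ : ℕ} (e : T ≃ Fin τ) (t : Fin τ → ℤ → ℝ)
    (d : T) (f : ℤ → ℝ) :
    (fun a => Function.update t (e d) f (e a)) = Function.update (fun a => t (e a)) d f := by
  funext a
  by_cases h : a = d
  · subst h; simp
  · simp [h]

/-- The numbers of the tapes; the reserved tapes come first. -/
noncomputable def tapeEquiv (T' : Type) [Fintype T'] : Fin 3 ⊕ T' ≃ Fin (Fintype.card T' + 3) :=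
  ((Equiv.refl (Fin 3)).sumCongr (Fintype.equivFin T')).trans
    (finSumFinEquiv.trans (finCongr (add_comm _ _)))

theorem tapeEquiv_inl {T' : Type} [Fintype T'] (i : Fin 3) :
    ((tapeEquiv T' (.inl i)) : ℕ) = i := by
  simp only [tapeEquiv, Equiv.trans_apply, Equiv.sumCongr_apply, Sum.map_inl]
  simp

theorem tapeEquiv_inr {T' : Type} [Fintype T'] (d : T') :
    3 ≤ ((tapeEquiv T' (.inr d)) : ℕ) := by
  simp only [tapeEquiv, Equiv.trans_apply, Equiv.sumCongr_apply, Sum.map_inr]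
  simp

/-- Every program is executed by some machine, which answers by the sign of the scanned cell of
the tape `ans`. -/
theorem exists_machine {T' : Type} [Fintype T'] [DecidableEq T'] (c : Cmd (Fin 3 ⊕ T'))
    (ans : Fin 3 ⊕ T') : ∃ M : Machine, ∀ (u : ℝ) (z : Input) (t : ℕ) (Q : State (Fin 3 ⊕ T') → Prop),
      (∀ s, InitialState u z s → Tri u c t s Q) →
      ∀ f, M.IsComputation u z f → M.HaltsWithin f (t + 1) ∧
        ∃ s, Q s ∧ (s ans 0 < 0 → M.Outputs f true) ∧ (0 ≤ s ans 0 → M.Outputs f false) := by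
  classical
  let T := Fin 3 ⊕ T'
  let S : Set (List (Cmd T)) := c.conts [] ∪ {[]}
  have hS : S.Finite := (c.conts_finite []).union (Set.finite_singleton _)
  have hSnext : ∀ L ∈ S, nextConts L ⊆ S := by
    rintro L (hL | hL)
    · exact c.nextConts_subset [] hL
    · rw [Set.mem_singleton_iff] at hL; subst hL; simp [nextConts]
  have hcS : [c] ∈ S := Or.inl (c.mem_conts [])
  have hnS : [] ∈ S := Or.inr rfl
  let N := Bool ⊕ S
  have : Finite S := hS
  have : Fintype N := Fintype.ofFinite N
  obtain ⟨n, hn⟩ : ∃ n, Fintype.card N = n + 1 :=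
    ⟨Fintype.card N - 1, by
      have : 0 < Fintype.card N := Fintype.card_pos_iff.2 ⟨(Sum.inl true : N)⟩
      omega⟩
  let e₀ : N ≃ Fin (n + 1) := Fintype.equivFinOfCardEq hn
  -- Machines start at node `0`, so this number is given to the stack `[c]` by a transposition.
  let e : N ≃ Fin (n + 1) := e₀.trans (Equiv.swap (e₀ (.inr ⟨[c], hcS⟩)) 0)
  have he : e (.inr ⟨[c], hcS⟩) = 0 := by simp [e]
  let τ : T ≃ Fin (Fintype.card T' + 3) := tapeEquiv T'
  have hτl : ∀ i : Fin 3, ((τ (.inl i)) : ℕ) = i := tapeEquiv_inl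
  have hτr : ∀ d : T', 3 ≤ ((τ (.inr d)) : ℕ) := tapeEquiv_inr
  -- Stacks outside `S` never occur; their image is a default value.
  let g : List (Cmd T) → Fin (n + 1) := fun L =>
    if h : L ∈ S then e (.inr ⟨L, h⟩) else e (.inl false)
  let lab : N → List (Cmd T) := Sum.elim (fun _ => []) Subtype.val
  let prog : Fin (n + 1) → Node (Fintype.card T' + 3) (n + 1) := fun i =>
    match e.symm i with
    | .inl b => .halt b
    | .inr L => nodeOf τ (.inl 0) ans g (e (.inl true)) (e (.inl false)) L.1
  let M : Machine := ⟨Fintype.card T', n, prog⟩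
  refine ⟨M, fun u z t Q hQ f hf => ?_⟩
  have hlabg : ∀ L ∈ S, lab (e.symm (g L)) = L := fun L hL => by simp [g, hL, lab]
  let F : ℕ → List (Cmd T) × State T := fun i =>
    (lab (e.symm (f i).node), fun d => (f i).tape (τ d))
  have hF : ∀ i, (F i).1 ≠ [] → LStep u (F i) (F (i + 1)) := by
    intro i hi
    have hstep := hf.2 i
    cases hL : e.symm (f i).node with
    | inl b => simp [F, hL, lab] at hi
    | inr L =>
      obtain ⟨L, hLS⟩ := L
      have hp : M.prog (f i).node
          = nodeOf τ (.inl 0) ans g (e (.inl true)) (e (.inl false)) L := by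
        show prog _ = _
        simp only [prog, hL]
      have hFi : F i = (L, fun d => (f i).tape (τ d)) := by simp [F, hL, lab]
      have hnext := hSnext L hLS
      simp only [Machine.Step, hp] at hstep
      rw [hFi]
      rw [hFi] at hi
      match L, hi with
      | .basic (.const r d) :: K, _ =>
        obtain ⟨w, hw, h⟩ := hstep
        have hK : K ∈ S := hnext (by simp [nextConts])
        refine ⟨by simp [F, h, hlabg K hK], w, hw, ?_⟩
        simp only [F, h]
        exact writeTape_comp τ _ _ _
      | .basic (.arith op a b d) :: K, _ =>
        obtain ⟨w, hw, h⟩ := hstep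
        have hK : K ∈ S := hnext (by simp [nextConts])
        refine ⟨by simp [F, h, hlabg K hK], w, hw, ?_⟩
        simp only [F, h]
        exact writeTape_comp τ _ _ _
      | .basic (.copy a d) :: K, _ =>
        have h : f (i + 1) = ⟨g K, writeTape (f i).tape (τ d) ((f i).tape (τ a) 0)⟩ := hstep
        have hK : K ∈ S := hnext (by simp [nextConts])
        refine ⟨by simp [F, h, hlabg K hK], ?_⟩
        simp only [F, h]
        exact writeTape_comp τ _ _ _
      | .basic (.unit d) :: K, _ =>
        have h : f (i + 1) = ⟨g K, writeTape (f i).tape (τ d) u⟩ := hstep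
        have hK : K ∈ S := hnext (by simp [nextConts])
        refine ⟨by simp [F, h, hlabg K hK], ?_⟩
        simp only [F, h]
        exact writeTape_comp τ _ _ _
      | .basic (.shl d) :: K, _ =>
        have h : f (i + 1) = ⟨g K, Function.update (f i).tape (τ d) (fun j => (f i).tape (τ d) (j + 1))⟩ := hstep
        have hK : K ∈ S := hnext (by simp [nextConts])
        refine ⟨by simp [F, h, hlabg K hK], ?_⟩
        simp only [F, h]
        exact update_comp τ _ _ _
      | .basic (.shr d) :: K, _ =>
        have h : f (i + 1) = ⟨g K, Function.update (f i).tape (τ d) (fun j => (f i).tape (τ d) (j - 1))⟩ := hstep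
        have hK : K ∈ S := hnext (by simp [nextConts])
        refine ⟨by simp [F, h, hlabg K hK], ?_⟩
        simp only [F, h]
        exact update_comp τ _ _ _
      | .skip :: K, _ =>
        have h : f (i + 1) = ⟨g K, writeTape (f i).tape (τ (.inl 0)) ((f i).tape (τ (.inl 0)) 0)⟩ := hstep
        have hK : K ∈ S := hnext (by simp [nextConts])
        refine Prod.ext (by simp [F, h, hlabg K hK]) ?_
        simp only [F, h]
        refine (writeTape_comp τ _ _ _).trans ?_
        simp [put]
      | .seq a b :: K, _ =>
        have h : f (i + 1) = ⟨g (a :: b :: K), writeTape (f i).tape (τ (.inl 0)) ((f i).tape (τ (.inl 0)) 0)⟩ := hstep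
        have hK : a :: b :: K ∈ S := hnext (by simp [nextConts])
        refine Prod.ext (by simp [F, h, hlabg _ hK]) ?_
        simp only [F, h]
        refine (writeTape_comp τ _ _ _).trans ?_
        simp [put]
      | .ite a c₁ c₂ :: K, _ =>
        have h : (0 ≤ (f i).tape (τ a) 0 → f (i + 1) = ⟨g (c₁ :: K), (f i).tape⟩) ∧
            ((f i).tape (τ a) 0 < 0 → f (i + 1) = ⟨g (c₂ :: K), (f i).tape⟩) := hstep
        have h₁ : c₁ :: K ∈ S := hnext (by simp [nextConts])
        have h₂ : c₂ :: K ∈ S := hnext (by simp [nextConts])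
        exact ⟨fun h₀ => by simp [F, h.1 h₀, hlabg _ h₁], fun h₀ => by simp [F, h.2 h₀, hlabg _ h₂]⟩
      | .loop a c₁ :: K, _ =>
        have h : (0 ≤ (f i).tape (τ a) 0 → f (i + 1) = ⟨g K, (f i).tape⟩) ∧
            ((f i).tape (τ a) 0 < 0 → f (i + 1) = ⟨g (c₁ :: .loop a c₁ :: K), (f i).tape⟩) := hstep
        have h₁ : K ∈ S := hnext (by simp [nextConts])
        have h₂ : c₁ :: .loop a c₁ :: K ∈ S := hnext (by simp [nextConts])
        exact ⟨fun h₀ => by simp [F, h.1 h₀, hlabg _ h₁], fun h₀ => by simp [F, h.2 h₀, hlabg _ h₂]⟩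
  obtain ⟨v, x, hv, hx, h0⟩ := hf.1
  have hF0 : F 0 = ([c], fun d => (f 0).tape (τ d)) := by
    refine Prod.ext ?_ rfl
    simp only [F, h0, lab]
    have : e.symm 0 = .inr ⟨[c], hcS⟩ := by rw [← he, Equiv.symm_apply_apply]
    have h1 : (0 : Fin (M.extraNodes + 1)) = (0 : Fin (n + 1)) := rfl
    rw [h1, this]
    rfl
  have hinit : InitialState u z (fun d : T => (f 0).tape (τ d)) := by
    refine ⟨v, x, hv, hx, ?_, ?_, ?_, fun d => ?_⟩
    · simp only [h0, hτl]; rfl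
    · simp only [h0, hτl]; rfl
    · simp only [h0, hτl]; rfl
    · have := hτr d
      simp only [h0]
      rw [if_neg (by omega), if_neg (by omega), if_neg (by omega)]
  obtain ⟨j, hj, s, hs, hQs⟩ := (hQ _ hinit).run hF [] 0 hF0
  rw [zero_add] at hs
  have hprog : ∀ i L, e.symm (f i).node = .inr L → M.prog (f i).node
      = nodeOf τ (.inl 0) ans g (e (.inl true)) (e (.inl false)) L.1 := by
    intro i L h
    show prog _ = _
    simp only [prog, h]
  have hhalt : ∀ i b, e.symm (f i).node = .inl b → M.prog (f i).node = .halt b := by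
    intro i b h
    show prog _ = _
    simp only [prog, h]
  have hbranch : ∀ i h, e.symm (f i).node = .inr ⟨[], h⟩ →
      (0 ≤ (f i).tape (τ ans) 0 → f (i + 1) = ⟨e (.inl false), (f i).tape⟩) ∧
      ((f i).tape (τ ans) 0 < 0 → f (i + 1) = ⟨e (.inl true), (f i).tape⟩) := by
    intro i h hi
    have hstep := hf.2 i
    simp only [Machine.Step, hprog _ _ hi, nodeOf] at hstep
    exact hstep
  -- The map `lab` sends both the halting nodes and the final branch to `[]`, so an empty stack at
  -- time `j` does not exclude that the machine has halted earlier. In that case too the answer fits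
  -- the sign of `ans`, since the tapes do not change after the branch.
  have hsign : ∀ i b, e.symm (f i).node = .inl b →
      ((f i).tape (τ ans) 0 < 0 → b = true) ∧ (0 ≤ (f i).tape (τ ans) 0 → b = false) := by
    intro i
    induction i with
    | zero =>
      intro b hb
      have h1 : e.symm (f 0).node = .inr ⟨[c], hcS⟩ := by
        rw [h0, Equiv.symm_apply_eq, he]
      rw [h1] at hb
      simp at hb
    | succ i ih =>
      intro b hb
      cases hL : e.symm (f i).node with
      | inl b' =>
        have hstep := hf.2 i
        simp only [Machine.Step, hhalt _ _ hL] at hstep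
        rw [hstep] at hb ⊢
        exact ih b hb
      | inr L =>
        obtain ⟨L, hLS⟩ := L
        by_cases hL0 : L = []
        · subst hL0
          rcases lt_or_ge ((f i).tape (τ ans) 0) 0 with h | h
          · rw [(hbranch i hLS hL).2 h] at hb ⊢
            have hb := Sum.inl_injective ((Equiv.symm_apply_apply _ _).symm.trans hb)
            exact ⟨fun _ => hb.symm, fun h' => absurd h (not_lt.2 h')⟩
          · rw [(hbranch i hLS hL).1 h] at hb ⊢
            have hb := Sum.inl_injective ((Equiv.symm_apply_apply _ _).symm.trans hb)
            exact ⟨fun h' => absurd h (not_le.2 h'), fun _ => hb.symm⟩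
        · obtain ⟨L', hL', hn'⟩ := (hf.2 i).exists_next (hprog _ _ hL) hL0
          have : L' ∈ S := hSnext L hLS hL'
          rw [hn'] at hb
          simp [g, this] at hb
  have hans : (f j).tape (τ ans) 0 = s ans 0 :=
    congrFun (congrFun (congrArg Prod.snd hs) ans) 0
  cases hL : e.symm (f j).node with
  | inl b =>
    have hb := hsign j b hL
    rw [hans] at hb
    refine ⟨⟨j, by omega, b, hhalt _ _ hL⟩, s, hQs, fun h => ⟨j, ?_⟩, fun h => ⟨j, ?_⟩⟩
    · rw [hhalt _ _ hL, hb.1 h]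
    · rw [hhalt _ _ hL, hb.2 h]
  | inr L =>
    obtain ⟨L, hLS⟩ := L
    have hL' : L = [] := by
      have := congrArg Prod.fst hs
      simpa [F, hL, lab] using this
    subst hL'
    have hb := hbranch j hLS hL
    rw [hans] at hb
    have h₁ : s ans 0 < 0 → M.prog (f (j + 1)).node = .halt true := fun h =>
      hhalt _ _ (by rw [hb.2 h, Equiv.symm_apply_apply])
    have h₂ : 0 ≤ s ans 0 → M.prog (f (j + 1)).node = .halt false := fun h =>
      hhalt _ _ (by rw [hb.1 h, Equiv.symm_apply_apply])
    refine ⟨⟨j + 1, by omega, ?_⟩, s, hQs, fun h => ⟨_, h₁ h⟩, fun h => ⟨_, h₂ h⟩⟩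
    rcases lt_or_ge (s ans 0) 0 with h | h
    exacts [⟨_, h₁ h⟩, ⟨_, h₂ h⟩]

end ToMachine

/-! ### Two families of time constructible functions -/

namespace StackMachine

/-- The stacks of the machines below: the input, the output, and a scratch stack. -/
inductive Stk
  | inp | out | tmp
  deriving DecidableEq

instance : Fintype Stk := ⟨{.inp, .out, .tmp}, by intro x; cases x <;> simp⟩

/-- The stack alphabets. -/
abbrev Alph (A : Type) : Stk → Type
  | .inp => A
  | .out => Bool
  | .tmp => Bool

/-- The labels of the machines below. -/
inductive Lab
  | init | main | move | unload
  deriving DecidableEq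

instance : Fintype Lab := ⟨{.init, .main, .move, .unload}, by intro x; cases x <;> simp⟩

/-- The contents of the three stacks. -/
def stks {A : Type} (a : List A) (b c : List Bool) : ∀ k, List (Alph A k)
  | .inp => a
  | .out => b
  | .tmp => c

variable {A : Type}

theorem update_inp (a a' : List A) (b c : List Bool) :
    Function.update (stks a b c) .inp a' = stks a' b c := by
  funext k; cases k <;> simp [stks]

theorem update_out (a : List A) (b b' c : List Bool) :
    Function.update (stks a b c) .out b' = stks a b' c := by
  funext k; cases k <;> simp [stks]

theorem update_tmp (a : List A) (b c c' : List Bool) :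
    Function.update (stks a b c) .tmp c' = stks a b c' := by
  funext k; cases k <;> simp [stks]

/-- Push `n` zeros to the output. -/
def pushZeros : ℕ → Turing.TM2.Stmt (Alph A) Lab Bool → Turing.TM2.Stmt (Alph A) Lab Bool
  | 0, q => q
  | n + 1, q => .push .out (fun _ => false) (pushZeros n q)

theorem stepAux_pushZeros (n : ℕ) (q : Turing.TM2.Stmt (Alph A) Lab Bool) (v : Bool) (a : List A)
    (b c : List Bool) : Turing.TM2.stepAux (pushZeros n q) v (stks a b c) =
      Turing.TM2.stepAux q v (stks a (List.replicate n false ++ b) c) := by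
  induction n generalizing b with
  | zero => rfl
  | succ n ih =>
    rw [pushZeros, Turing.TM2.stepAux, update_out]
    show Turing.TM2.stepAux (pushZeros n q) v (stks a (false :: b) c) = _
    rw [ih, List.replicate_succ', List.append_assoc]
    rfl

/-- For each letter of the input, push `d` zeros. -/
def linearProg (c d : ℕ) : Lab → Turing.TM2.Stmt (Alph A) Lab Bool
  | .init => .push .out (fun _ => true) (pushZeros c (.goto fun _ => .main))
  | .main => .pop .inp (fun _ o => o.isSome)
      (.branch id (pushZeros d (.goto fun _ => .main)) .halt)
  | _ => .halt

/-- For each letter of the input, multiply the number of zeros by `E`. -/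
def geomProg (E : ℕ) : Lab → Turing.TM2.Stmt (Alph A) Lab Bool
  | .init => .push .out (fun _ => true) (pushZeros 1 (.goto fun _ => .main))
  | .main => .pop .inp (fun _ o => o.isSome) (.branch id (.goto fun _ => .move) .halt)
  | .move => .pop .out (fun _ o => o == some false)
      (.branch id (.push .tmp (fun _ => false) (.goto fun _ => .move))
        (.push .out (fun _ => true) (.goto fun _ => .unload)))
  | .unload => .pop .tmp (fun _ o => o.isSome)
      (.branch id (pushZeros E (.goto fun _ => .unload)) (.goto fun _ => .main))

/-- A stack machine with the given program. -/
def machine (A : Type) [Fintype A] (m : Lab → Turing.TM2.Stmt (Alph A) Lab Bool) :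
    Turing.TM2ComputableAux A Bool where
  tm :=
    { K := Stk
      k₀ := .inp
      k₁ := .out
      Γ := Alph A
      Λ := Lab
      main := .init
      σ := Bool
      initialState := false
      Γk₀Fin := inferInstanceAs (Fintype A)
      m := m }
  inputAlphabet := Equiv.refl A
  outputAlphabet := Equiv.refl Bool

/-- Reachability within `t` steps. -/
def Within (m : Lab → Turing.TM2.Stmt (Alph A) Lab Bool) (a b : Turing.TM2.Cfg (Alph A) Lab Bool)
    (t : ℕ) : Prop :=
  Nonempty (StateTransition.EvalsToInTime (Turing.TM2.step m) a (some b) t)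

theorem Within.trans {m : Lab → Turing.TM2.Stmt (Alph A) Lab Bool}
    {a b c : Turing.TM2.Cfg (Alph A) Lab Bool} {t₁ t₂ : ℕ} (h₁ : Within m a b t₁)
    (h₂ : Within m b c t₂) : Within m a c (t₁ + t₂) := by
  obtain ⟨h₁⟩ := h₁
  obtain ⟨h₂⟩ := h₂
  rw [add_comm]
  exact ⟨h₁.trans _ _ _ _ _ _ h₂⟩

theorem Within.le {m : Lab → Turing.TM2.Stmt (Alph A) Lab Bool}
    {a b : Turing.TM2.Cfg (Alph A) Lab Bool} {t₁ t₂ : ℕ} (h₁ : Within m a b t₁) (h : t₁ ≤ t₂) :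
    Within m a b t₂ := by
  obtain ⟨h₁⟩ := h₁
  exact ⟨⟨h₁.toEvalsTo, h₁.steps_le_m.trans h⟩⟩

theorem Within.step {m : Lab → Turing.TM2.Stmt (Alph A) Lab Bool}
    {a b : Turing.TM2.Cfg (Alph A) Lab Bool} (h : Turing.TM2.step m a = some b) :
    Within m a b 1 :=
  ⟨⟨⟨1, h⟩, le_rfl⟩⟩

theorem returns_of_within [Fintype A] {m : Lab → Turing.TM2.Stmt (Alph A) Lab Bool} {w : List A}
    {v : List Bool} {t : ℕ} {b : Bool} {s : List A} {r : List Bool}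
    (h : Within m ⟨some .init, false, stks w [] []⟩ ⟨none, b, stks s v r⟩ t) :
    TMReturnsWithin (machine A m) w v t := by
  obtain ⟨h⟩ := h
  refine ⟨⟨none, b, stks s v r⟩, ⟨?_⟩, rfl, ?_⟩
  · have hi : Turing.initList (machine A m).tm (w.map (machine A m).inputAlphabet.symm) =
        (⟨some .init, false, stks w [] []⟩ : Turing.TM2.Cfg (Alph A) Lab Bool) := by
      refine congrArg (Turing.TM2.Cfg.mk (some Lab.init) false) (funext fun k => ?_)
      cases k with
      | inp => exact List.map_id _
      | out => rfl
      | tmp => rfl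
    rw [hi]
    exact h
  · exact List.map_id _

theorem replicate_append_tail (m n : ℕ) (b : List Bool) :
    List.replicate m false ++ (List.replicate n false ++ b) = List.replicate (m + n) false ++ b := by
  rw [← List.append_assoc, List.replicate_append_replicate]

/-- One step executes the whole statement of a label, including all `d` pushes; this is why the time
does not depend on `d`. -/
theorem within_linear (c d : ℕ) (w : List A) (v : Bool) (n : ℕ) :
    ∃ v', Within (linearProg c d) ⟨some .main, v, stks w (List.replicate n false ++ [true]) []⟩
      ⟨none, v', stks [] (List.replicate (n + d * w.length) false ++ [true]) []⟩
      (w.length + 1) := by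
  induction w generalizing v n with
  | nil =>
    refine ⟨false, .step ?_⟩
    simp only [Turing.TM2.step, linearProg, Turing.TM2.stepAux, update_inp]
    simp [stks]
  | cons x w ih =>
    obtain ⟨v', h⟩ := ih true (d + n)
    refine ⟨v', ?_⟩
    have h₁ : Within (linearProg c d)
        ⟨some .main, v, stks (x :: w) (List.replicate n false ++ [true]) []⟩
        ⟨some .main, true, stks w (List.replicate (d + n) false ++ [true]) []⟩ 1 := by
      refine .step ?_
      simp only [Turing.TM2.step, linearProg, Turing.TM2.stepAux, update_inp]
      simp only [stks, List.head?_cons, Option.isSome_some, id, cond_true, List.tail_cons]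
      rw [stepAux_pushZeros, replicate_append_tail]
      rfl
    have h₂ := (h₁.trans h).le (t₂ := (x :: w).length + 1) (by rw [List.length_cons]; omega)
    rwa [show d + n + d * w.length = n + d * (x :: w).length by
      rw [List.length_cons]; ring] at h₂

theorem within_move (E : ℕ) (w : List A) (v : Bool) (n k : ℕ) :
    Within (geomProg E)
      ⟨some .move, v, stks w (List.replicate n false ++ [true]) (List.replicate k false)⟩
      ⟨some .unload, false, stks w [true] (List.replicate (n + k) false)⟩ (n + 1) := by
  induction n generalizing v k with
  | zero =>
    refine .step ?_
    simp only [Turing.TM2.step, geomProg, Turing.TM2.stepAux, update_out]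
    simp [stks]
  | succ n ih =>
    have h₁ : Within (geomProg E)
        ⟨some .move, v, stks w (List.replicate (n + 1) false ++ [true]) (List.replicate k false)⟩
        ⟨some .move, true, stks w (List.replicate n false ++ [true])
          (List.replicate (k + 1) false)⟩ 1 := by
      refine .step ?_
      simp only [Turing.TM2.step, geomProg, Turing.TM2.stepAux, update_out]
      simp only [stks, List.replicate_succ, List.cons_append, List.head?_cons, List.tail_cons,
        beq_self_eq_true, id, cond_true]
      exact congrArg (fun S => some (Turing.TM2.Cfg.mk (some Lab.move) true S)) (update_tmp _ _ _ _)
    have h₂ := (h₁.trans (ih true (k + 1))).le (t₂ := n + 1 + 1) (by omega)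
    rwa [show n + (k + 1) = n + 1 + k by omega] at h₂

theorem within_unload (E : ℕ) (w : List A) (v : Bool) (n k : ℕ) :
    Within (geomProg E)
      ⟨some .unload, v, stks w (List.replicate n false ++ [true]) (List.replicate k false)⟩
      ⟨some .main, false, stks w (List.replicate (n + E * k) false ++ [true]) []⟩ (k + 1) := by
  induction k generalizing v n with
  | zero =>
    refine .step ?_
    simp only [Turing.TM2.step, geomProg, Turing.TM2.stepAux, update_tmp]
    simp [stks]
  | succ k ih =>
    have h₁ : Within (geomProg E)
        ⟨some .unload, v, stks w (List.replicate n false ++ [true])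
          (List.replicate (k + 1) false)⟩
        ⟨some .unload, true, stks w (List.replicate (E + n) false ++ [true])
          (List.replicate k false)⟩ 1 := by
      refine .step ?_
      simp only [Turing.TM2.step, geomProg, Turing.TM2.stepAux, update_tmp]
      simp only [stks, List.replicate_succ, List.head?_cons, List.tail_cons,
        Option.isSome_some, id, cond_true]
      rw [stepAux_pushZeros, replicate_append_tail]
      rfl
    have h₂ := (h₁.trans (ih true (E + n))).le (t₂ := k + 1 + 1) (by omega)
    rwa [show E + n + E * k = n + E * (k + 1) by ring] at h₂

/-- A round that turns `n` zeros into `E n` takes `2 n + 3 ≤ 5 n` steps, and `E n ≥ 2 n`. So five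
times the number of zeros is a potential that pays for all rounds. -/
theorem within_geom (E : ℕ) (hE : 2 ≤ E) (w : List A) (v : Bool) (n : ℕ) (hn : 1 ≤ n) :
    ∃ v' t, Within (geomProg E) ⟨some .main, v, stks w (List.replicate n false ++ [true]) []⟩
      ⟨none, v', stks [] (List.replicate (n * E ^ w.length) false ++ [true]) []⟩ t ∧
      t + 5 * n ≤ 5 * (n * E ^ w.length) + 1 := by
  induction w generalizing v n with
  | nil =>
    refine ⟨false, 1, .step ?_, by simp; omega⟩
    simp only [Turing.TM2.step, geomProg, Turing.TM2.stepAux, update_inp]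
    simp [stks]
  | cons x w ih =>
    obtain ⟨v', t, h, ht⟩ := ih false (E * n) (by nlinarith)
    have h₁ : Within (geomProg E)
        ⟨some .main, v, stks (x :: w) (List.replicate n false ++ [true]) []⟩
        ⟨some .move, true, stks w (List.replicate n false ++ [true]) []⟩ 1 := by
      refine .step ?_
      simp only [Turing.TM2.step, geomProg, Turing.TM2.stepAux, update_inp]
      rfl
    have h₂ := within_move E w true n 0
    have h₃ := within_unload E w false 0 n
    have h₄ := ((h₁.trans h₂).trans h₃)
    rw [zero_add] at h₄
    refine ⟨v', 1 + (n + 1) + (n + 1) + t, ?_, ?_⟩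
    · have h₅ := h₄.trans h
      rwa [show E * n * E ^ w.length = n * E ^ (x :: w).length by
        rw [List.length_cons]; ring] at h₅
    · rw [List.length_cons, pow_succ, show n * (E ^ w.length * E) = E * n * E ^ w.length by ring]
      nlinarith

end StackMachine

theorem bits_two_pow (k : ℕ) : (2 ^ k).bits = List.replicate k false ++ [true] := by
  induction k with
  | zero => simp
  | succ k ih =>
    rw [pow_succ, mul_comm, Nat.bit0_bits _ (by positivity), ih, List.replicate_succ,
      List.cons_append]

-- In binary, least significant bit first, a power of two is a block of zeros before a single one,
-- so only the zeros have to be counted out: `c` at the start and `d` for each input bit. With `d ≥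
-- 1` the value exceeds the number of input bits, which pays for reading them. Such functions are
-- polynomially bounded and dominate all polynomials.
open StackMachine in
theorem timeConstructible_pow (c d : ℕ) (hd : 1 ≤ d) :
    TimeConstructible fun n => 2 ^ (c + d * n.size) := by
  refine ⟨machine Bool (linearProg c d), 3, fun n => ?_⟩
  rw [bits_two_pow]
  obtain ⟨v', h⟩ := within_linear c d n.bits false c
  beta_reduce
  have h₁ : Within (linearProg c d) ⟨some .init, false, stks n.bits [] []⟩
      ⟨some .main, false, stks n.bits (List.replicate c false ++ [true]) []⟩ 1 := by
    refine .step ?_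
    simp only [Turing.TM2.step, linearProg, Turing.TM2.stepAux, update_out]
    rw [stepAux_pushZeros]
    rfl
  rw [Nat.size_eq_bits_len] at h
  refine returns_of_within ((h₁.trans h).le ?_)
  have : n.size < 2 ^ (c + d * n.size) :=
    Nat.lt_two_pow_self.trans_le (Nat.pow_le_pow_right (by norm_num) (by nlinarith))
  omega

-- Here the number of zeros is itself exponential in the number of letters; it is reached by
-- multiplying by `E` for each letter, in time linear in the number of zeros and thus below the
-- value of the function.
open StackMachine in
theorem timeConstructible₂_pow (E : ℕ) (hE : 2 ≤ E) :
    TimeConstructible₂ fun m n => 2 ^ (E ^ (m.size + n.size + 1)) := by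
  refine ⟨machine (Option Bool) (geomProg E), 6, fun m n => ?_⟩
  rw [bits_two_pow]
  have hl : (encodePair m n).length = m.size + n.size + 1 := by
    simp [encodePair, Nat.size_eq_bits_len]; omega
  obtain ⟨v', t, h, ht⟩ := within_geom E hE (encodePair m n) false 1 le_rfl
  beta_reduce
  have h₁ : Within (geomProg E) ⟨some .init, false, stks (encodePair m n) [] []⟩
      ⟨some .main, false, stks (encodePair m n) (List.replicate 1 false ++ [true]) []⟩ 1 := by
    refine .step ?_
    simp only [Turing.TM2.step, geomProg, Turing.TM2.stepAux, update_out]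
    rw [stepAux_pushZeros]
    rfl
  rw [one_mul, hl] at h ht
  refine returns_of_within ((h₁.trans h).le ?_)
  have : E ^ (m.size + n.size + 1) < 2 ^ E ^ (m.size + n.size + 1) := Nat.lt_two_pow_self
  omega

/-! ### Membership in the exponential class -/

theorem two_pow_size_le (n : ℕ) : 2 ^ n.size ≤ 2 * n + 1 := by
  rcases Nat.eq_zero_or_pos n with rfl | hn
  · simp
  · obtain ⟨k, hk⟩ : ∃ k, n.size = k + 1 :=
      ⟨n.size - 1, by have := Nat.size_pos.2 hn; omega⟩
    have : 2 ^ k ≤ n := Nat.lt_size.1 (by omega)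
    rw [hk, pow_succ]
    omega

theorem polyBounded_pow (c d : ℕ) : PolyBounded fun n => 2 ^ (c + d * n.size) := by
  refine ⟨Polynomial.C (2 ^ c) * (2 * Polynomial.X + 1) ^ d, fun n => ?_⟩
  have := Nat.pow_le_pow_left (two_pow_size_le n) d
  beta_reduce
  rw [pow_add, mul_comm d, pow_mul]
  simpa using Nat.mul_le_mul_left (2 ^ c) this

/-- A polynomial is dominated by a function `2 ^ (c + d * size n)`. -/
theorem exists_eval_le_pow (P : ℕ[X]) : ∃ c d : ℕ, ∀ n, P.eval n ≤ 2 ^ (c + d * n.size) := by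
  induction P using Polynomial.induction_on' with
  | add p q hp hq =>
    obtain ⟨c, d, h⟩ := hp
    obtain ⟨c', d', h'⟩ := hq
    refine ⟨c + c' + 1, d + d', fun n => ?_⟩
    rw [Polynomial.eval_add]
    have h₁ : 2 ^ (c + d * n.size) ≤ 2 ^ (c + c' + (d + d') * n.size) :=
      Nat.pow_le_pow_right (by norm_num) (by nlinarith)
    have h₂ : 2 ^ (c' + d' * n.size) ≤ 2 ^ (c + c' + (d + d') * n.size) :=
      Nat.pow_le_pow_right (by norm_num) (by nlinarith)
    calc _ ≤ 2 ^ (c + c' + (d + d') * n.size) * 2 := by have := h n; have := h' n; omega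
      _ = _ := by rw [← pow_succ]; ring_nf
  | monomial k a =>
    refine ⟨a, k, fun n => ?_⟩
    rw [Polynomial.eval_monomial, pow_add, mul_comm k, pow_mul]
    exact Nat.mul_le_mul Nat.lt_two_pow_self.le
      (Nat.pow_le_pow_left (Nat.lt_size_self n).le _)

/-- Since `(m + 1) * (n + 1) ≤ 2 ^ (m.size + n.size)`, a polynomial exponent is absorbed by a power
of a fixed base. The summand `1` pays for the final branch of the machine in `exists_machine`. -/
theorem arith_bound (A D m n : ℕ) :
    2 ^ (A * ((m + 1) * (n + 1)) ^ D) + 1 ≤ 2 ^ ((2 ^ (D + A + 1)) ^ (m.size + n.size + 1)) := by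
  have h₁ : (m + 1) * (n + 1) ≤ 2 ^ (m.size + n.size) := by
    rw [pow_add]
    exact Nat.mul_le_mul (Nat.lt_size_self m) (Nat.lt_size_self n)
  have h₂ := Nat.pow_le_pow_left h₁ D
  set X := ((m + 1) * (n + 1)) ^ D
  have hX : 1 ≤ X := Nat.one_le_pow _ _ (by positivity)
  have h₃ : A * X + 1 ≤ (2 ^ (D + A + 1)) ^ (m.size + n.size + 1) := by
    have h₄ : A + 1 ≤ 2 ^ A := Nat.lt_two_pow_self
    calc A * X + 1 ≤ (A + 1) * X := by nlinarith
      _ ≤ 2 ^ A * (2 ^ (m.size + n.size)) ^ D := Nat.mul_le_mul h₄ h₂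
      _ = 2 ^ (A + (m.size + n.size) * D) := by rw [← pow_mul, ← pow_add]
      _ ≤ _ := by
        rw [← pow_mul]
        exact Nat.pow_le_pow_right (by norm_num) (by nlinarith [Nat.zero_le (m.size + n.size)])
  calc 2 ^ (A * X) + 1 ≤ 2 ^ (A * X + 1) := by
        rw [pow_succ]; have := Nat.one_le_two_pow (n := A * X); omega
    _ ≤ _ := Nat.pow_le_pow_right (by norm_num) h₃

/-- The precision `2 ^ (c + d * s.size)` has `c + d * s.size + 1` bits, so the outer exponent is a
constant times a power of `2 ^ s.size ≤ 3 * s`, that is, polynomial in `s`. The factor `C` takes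
care of `s = 0`. -/
theorem exp_bound (e c d : ℕ) (he : 1 ≤ e) : ∃ C a G : ℕ, 1 < a ∧ 0 < G ∧ ∀ l s : ℕ, l ≤ s →
    2 ^ ((2 ^ e) ^ (l.size + (2 ^ (c + d * s.size)).size + 1)) ≤ C * a ^ s ^ G := by
  let G := e * (d + 1)
  let K := (2 ^ e) ^ (c + 2) * 3 ^ G
  have hG : 0 < G := by positivity
  have hK : 1 ≤ K := Nat.one_le_iff_ne_zero.2 (by positivity)
  refine ⟨2 ^ K, 2 ^ K, G, Nat.one_lt_two_pow (by omega), hG, fun l s hl => ?_⟩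
  rw [← pow_mul 2 K, ← pow_add]
  refine Nat.pow_le_pow_right (by norm_num) ?_
  rw [Nat.size_pow]
  have h₁ : l.size ≤ s.size := Nat.size_le_size hl
  have h₂ : (2 ^ e) ^ (l.size + (c + d * s.size + 1) + 1) ≤
      (2 ^ e) ^ (c + 2) * (2 ^ s.size) ^ G := by
    rw [← pow_mul, ← pow_mul, ← pow_mul, ← pow_add]
    refine Nat.pow_le_pow_right (by norm_num) ?_
    have : e * l.size ≤ e * s.size := Nat.mul_le_mul_left _ h₁
    simp only [G]
    nlinarith
  refine h₂.trans ?_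
  rcases Nat.eq_zero_or_pos s with rfl | hs
  · simp only [Nat.size_zero, pow_zero, one_pow, mul_one, K]
    exact (Nat.le_mul_of_pos_right _ (by positivity)).trans (Nat.le_add_right _ _)
  · have h₃ : 2 ^ s.size ≤ 3 * s := (two_pow_size_le s).trans (by omega)
    have h₄ := Nat.pow_le_pow_left h₃ G
    rw [mul_pow] at h₄
    calc _ ≤ (2 ^ e) ^ (c + 2) * (3 ^ G * s ^ G) := Nat.mul_le_mul_left _ h₄
      _ = K * s ^ G := by simp only [K]; ring
      _ ≤ _ := Nat.le_add_left _ _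

theorem DecisionProblem.len_le_size (S : DecisionProblem) (z : Input) : z.len ≤ S.size z :=
  Nat.le_add_right _ _

/-- A problem is in the exponential class if a program with an exponential time bound solves it,
for all precisions that exceed a polynomial. -/
theorem mem_EXProPolyPrec {S : DecisionProblem} {T' : Type} [Fintype T'] [DecidableEq T']
    (p : Cmd (Fin 3 ⊕ T')) (ans : Fin 3 ⊕ T') (A D c d : ℕ) (hd : 1 ≤ d)
    (h : ∀ z, S.WellPosed z → ∀ u : ℝ, 0 < u → u < 1 → ∀ s, InitialState u z s →
      Tri u p (2 ^ (A * ((z.len + 1) * (precision u + 1)) ^ D)) s fun s' =>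
        2 ^ (c + d * (S.size z).size) ≤ precision u → (z ∈ S.carrier ↔ s' ans 0 < 0)) :
    S ∈ EXProPolyPrec := by
  obtain ⟨C, a, G, ha, hG, hb⟩ := exp_bound (D + A + 1) c d (by omega)
  refine ⟨fun m n => 2 ^ ((2 ^ (D + A + 1)) ^ (m.size + n.size + 1)),
    fun n => 2 ^ (c + d * n.size), ⟨timeConstructible₂_pow _ ?_, timeConstructible_pow c d hd,
      fun n => Nat.one_le_two_pow, ?_⟩, polyBounded_pow c d, C, a, G, ha, hG, fun z _ => ?_⟩
  · exact Nat.le_self_pow (by omega) 2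
  · obtain ⟨M, hM⟩ := exists_machine p ans
    refine ⟨M, fun z hz u hu hu1 f hf => ?_⟩
    obtain ⟨⟨i, hi, b, hib⟩, s, hs, hyes, hno⟩ := hM u z _ _ (h z hz u hu hu1) f hf
    refine ⟨⟨i, hi.trans (arith_bound A D _ _), b, hib⟩, fun hp => ?_⟩
    have := hs hp
    exact ⟨fun hz => hyes (this.1 hz), fun hz => hno (not_lt.1 fun h => hz (this.2 h))⟩
  · exact hb _ _ (S.len_le_size z)

/-! ### Precision and elementary properties of rounding. -/

theorem lt_precision_iff {u : ℝ} (hu : 0 < u) (k : ℕ) : k < precision u ↔ u < (1 / 2) ^ k := by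
  rw [precision, Nat.lt_ceil, Real.lt_logb_iff_rpow_lt (by norm_num) (by positivity),
    Real.rpow_natCast, lt_one_div (by positivity) hu, one_div_pow]

theorem one_le_precision {u : ℝ} (hu : 0 < u) (hu1 : u < 1) : 1 ≤ precision u := by
  have := (lt_precision_iff hu 0).2 (by simpa using hu1)
  omega

/-- The factor `1 + δ` is positive. Hence comparing two stored numbers by the sign of their rounded
difference is always reliable, whatever the precision; all tests in the programs rest on this. -/
theorem Rounds.neg_iff {u z w : ℝ} (h : Rounds u z w) (hu : u ≤ 1) : w < 0 ↔ z < 0 := by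
  obtain ⟨δ, hδ, rfl⟩ := h
  have : 0 < 1 + δ := by have := (abs_lt.1 hδ).1; linarith
  constructor
  · intro h; by_contra h'; exact absurd h (not_lt.2 (mul_nonneg (not_lt.1 h') this.le))
  · intro h; exact mul_neg_of_neg_of_pos h this

theorem Rounds.pos_iff {u z w : ℝ} (h : Rounds u z w) (hu : u ≤ 1) : 0 < w ↔ 0 < z := by
  obtain ⟨δ, hδ, rfl⟩ := h
  have : 0 < 1 + δ := by have := (abs_lt.1 hδ).1; linarith
  rw [mul_pos_iff_of_pos_right this]

theorem Rounds.nonneg_iff {u z w : ℝ} (h : Rounds u z w) (hu : u ≤ 1) : 0 ≤ w ↔ 0 ≤ z := by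
  rw [← not_lt, ← not_lt, h.neg_iff hu]

theorem Rounds.le {u z w : ℝ} (h : Rounds u z w) (hz : 0 ≤ z) : w ≤ z * (1 + u) := by
  obtain ⟨δ, hδ, rfl⟩ := h
  exact mul_le_mul_of_nonneg_left (by have := (abs_lt.1 hδ).2; linarith) hz

theorem Rounds.ge {u z w : ℝ} (h : Rounds u z w) (hz : 0 ≤ z) : z * (1 - u) ≤ w := by
  obtain ⟨δ, hδ, rfl⟩ := h
  exact mul_le_mul_of_nonneg_left (by have := (abs_lt.1 hδ).1; linarith) hz

theorem Rounds.zero {u w : ℝ} (h : Rounds u 0 w) : w = 0 := by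
  obtain ⟨δ, -, rfl⟩ := h
  simp

theorem Rounds.refl {u : ℝ} (hu : 0 < u) (z : ℝ) : Rounds u z z := ⟨0, by simpa, by simp⟩

theorem Rounds.mono {u u' z w : ℝ} (h : Rounds u z w) (hu : u ≤ u') : Rounds u' z w := by
  obtain ⟨δ, hδ, rfl⟩ := h
  exact ⟨δ, hδ.trans_le hu, rfl⟩

section Put

variable {T : Type} [DecidableEq T]

@[simp] theorem put_self (s : State T) (d : T) (v : ℝ) : put s d v d 0 = v := by simp [put]

@[simp] theorem put_of_ne {d e : T} (s : State T) (v : ℝ) (h : e ≠ d) : put s d v e = s e := by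
  simp [put, h]

end Put

/-! ### A problem that needs exponential cost -/

/-- The input `64 ^ 2 ^ j`, padded with `n` bits. -/
noncomputable def towerInput (n j : ℕ) : Input := (List.replicate n false, [(64 : ℝ) ^ 2 ^ j])

open Classical in
/-- Decide the parity of `j`, given `64 ^ 2 ^ j`, where `j` is less than `2 ^ n` if the input has
`n` bits. All other inputs are ill-posed. -/
noncomputable def towerParity : DecisionProblem where
  carrier := {z | ∃ n j, j < 2 ^ n ∧ Even j ∧ z = towerInput n j}
  μ z := if ∃ n j, j < 2 ^ n ∧ z = towerInput n j then 1 else ∞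
  one_le_μ z := by split_ifs <;> simp

theorem towerInput_injective {n j n' j' : ℕ} (h : towerInput n j = towerInput n' j') :
    n = n' ∧ j = j' := by
  simp only [towerInput, Prod.mk.injEq, List.cons.injEq, and_true] at h
  refine ⟨by simpa using congrArg List.length h.1, ?_⟩
  have := pow_right_injective₀ (by norm_num : (0 : ℝ) < 64) (by norm_num) h.2
  exact Nat.pow_right_injective le_rfl this

theorem towerParity_wellPosed {z : Input} :
    towerParity.WellPosed z ↔ ∃ n j, j < 2 ^ n ∧ z = towerInput n j := by
  classical
  simp only [DecisionProblem.WellPosed, towerParity]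
  split_ifs with h <;> simp [h]

theorem towerInput_mem {n j : ℕ} (h : j < 2 ^ n) :
    towerInput n j ∈ towerParity.carrier ↔ Even j := by
  constructor
  · rintro ⟨n', j', -, hj, h⟩
    rwa [(towerInput_injective h).2]
  · exact fun hj => ⟨n, j, h, hj, rfl⟩

theorem towerParity_logCond {z : Input} (h : towerParity.WellPosed z) :
    towerParity.logCond z = 0 := by
  have h' := towerParity_wellPosed.1 h
  simp only [DecisionProblem.logCond, towerParity]
  rw [if_pos h']
  simp

/-! ### Solving the tower problem by repeated squaring. -/

namespace TowerProgram

/-- The tapes of the program below. -/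
abbrev Tp : Type := Fin 3 ⊕ Fin 4

/-- The tape with the real input. -/
abbrev x : Tp := .inl 1
/-- A tape with the unit roundoff. -/
abbrev a : Tp := .inr 0
/-- The tape with the number that is squared. -/
abbrev g : Tp := .inr 1
/-- The tape for comparisons. -/
abbrev t : Tp := .inr 2
/-- The tape with the parity of the number of squarings. -/
abbrev p : Tp := .inr 3

/-- Square once. -/
noncomputable def body : Cmd Tp :=
  .block [.basic (.arith .mul g g g), .ite p (.basic (.const (-1) p)) (.basic (.const 0 p)),
    .basic (.arith .sub g x t)]

/-- Square until the input is reached. -/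
noncomputable def prog : Cmd Tp :=
  .block [.basic (.unit a), .basic (.const (1 / 16) t), .basic (.arith .sub a t t),
    .ite t .skip (.block [.basic (.const 16 g), .basic (.arith .sub g x t), .loop t body])]

theorem tri_flip {u : ℝ} (hu1 : u < 1) (s : State Tp) :
    Tri u (.ite p (.basic (.const (-1) p)) (.basic (.const 0 p))) 2 s fun s' =>
      (s' p 0 < 0 ↔ ¬ s p 0 < 0) ∧ ∀ d ≠ p, s' d = s d := by
  rcases le_or_gt 0 (s p 0) with h | h
  · refine .ite_nonneg h (.basic ?_)
    rintro s' ⟨w, hw, rfl⟩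
    have := (hw.neg_iff hu1.le).2 (by norm_num)
    exact ⟨by simp [this, h], fun d hd => by simp [hd]⟩
  · refine .ite_neg h (.basic ?_)
    rintro s' ⟨w, hw, rfl⟩
    have := hw.zero
    exact ⟨by simp [this, h], fun d hd => by simp [hd]⟩

/-- The bounds for `g` after `i` squarings reproduce themselves, since `(8/7)^2 * (7/8) = 8/7` and
`(8/9)^2 * (9/8) = 8/9` absorb the rounding error. As `21 < 64 < 144 = 12 ^ 2`, the value stays
below `ξ` up to `i = j` and exceeds it at `i = j + 1`, so the number of rounds is exactly `j + 1`.
The number `r` counts the remaining ones. -/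
theorem tri_loop {u ξ : ℝ} (hu : 0 < u) (hu1 : u < 1 / 8) (j : ℕ)
    (hX : (7 / 8) * 64 ^ 2 ^ j ≤ ξ) (hX' : ξ ≤ (9 / 8) * 64 ^ 2 ^ j) (r : ℕ) :
    ∀ (i : ℕ) (s : State Tp), i + r = j + 1 → s x 0 = ξ → (8 / 7) * 12 ^ 2 ^ i ≤ s g 0 →
      s g 0 ≤ (8 / 9) * 21 ^ 2 ^ i → (s t 0 < 0 ↔ s g 0 < ξ) → (s p 0 < 0 ↔ Odd i) →
      Tri u (.loop t body) (10 * r + 1) s fun s' => (s' p 0 < 0 ↔ Odd (j + 1)) := by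
  induction r with
  | zero =>
    intro i s hi hx hg _ ht hp
    obtain rfl : i = j + 1 := by omega
    refine .loop_done (not_lt.1 fun h => ?_) hp
    have h₁ := ht.1 h
    have h₂ : (12 : ℝ) ^ 2 ^ (j + 1) = 144 ^ 2 ^ j := by
      rw [pow_succ', pow_mul]; norm_num
    have h₃ : (64 : ℝ) ^ 2 ^ j ≤ 144 ^ 2 ^ j := pow_le_pow_left₀ (by norm_num) (by norm_num) _
    have h₄ : (0 : ℝ) < 64 ^ 2 ^ j := by positivity
    linarith
  | succ r ih =>
    intro i s hi hx hg hg' ht hp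
    have hneg : s t 0 < 0 := by
      refine ht.2 ?_
      have h₁ : (21 : ℝ) ^ 2 ^ i ≤ 21 ^ 2 ^ j :=
        pow_le_pow_right₀ (by norm_num) (Nat.pow_le_pow_right (by norm_num) (by omega))
      have h₃ : (21 : ℝ) ^ 2 ^ j < 64 ^ 2 ^ j :=
        pow_lt_pow_left₀ (by norm_num) (by norm_num) (by positivity)
      have h₄ : (0 : ℝ) < 64 ^ 2 ^ j := by positivity
      -- A comparison of `21` with `64` alone is not enough, because `8/9 > 7/8`; the detour over
      -- `49` gains the factor `49/64`.
      have h₅ : (21 : ℝ) ^ 2 ^ j ≤ 49 / 64 * 64 ^ 2 ^ j := by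
        have : (21 : ℝ) ^ 2 ^ j ≤ (49 : ℝ) ^ 2 ^ j :=
          pow_le_pow_left₀ (by norm_num) (by norm_num) _
        have h₆ : (49 : ℝ) ^ 2 ^ j = (49 / 64 : ℝ) ^ 2 ^ j * 64 ^ 2 ^ j := by
          rw [← mul_pow]; norm_num
        have h₇ : (49 / 64 : ℝ) ^ 2 ^ j ≤ 49 / 64 :=
          pow_le_of_le_one (by norm_num) (by norm_num) (by positivity)
        nlinarith
      linarith
    refine .le (.loop_step (fun s' => s' x 0 = ξ ∧ (8 / 7) * 12 ^ 2 ^ (i + 1) ≤ s' g 0 ∧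
      s' g 0 ≤ (8 / 9) * 21 ^ 2 ^ (i + 1) ∧ (s' t 0 < 0 ↔ s' g 0 < ξ) ∧
      (s' p 0 < 0 ↔ Odd (i + 1))) hneg ?_ fun s' hs' =>
      ih (i + 1) s' (by omega) hs'.1 hs'.2.1 hs'.2.2.1 hs'.2.2.2.1 hs'.2.2.2.2)
      (show 9 + (10 * r + 1) + 1 ≤ 10 * (r + 1) + 1 by omega)
    refine .le (.consB ?_) (show 1 + 7 + 1 ≤ 9 by norm_num)
    rintro s₁ ⟨w, hw, rfl⟩
    refine .le (.cons _ (tri_flip (by linarith) _) fun s₂ hs₂ => .consB ?_)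
      (show 2 + (1 + 1 + 1) + 1 ≤ 7 by norm_num)
    rintro s₃ ⟨v, hv, rfl⟩
    refine .nil ?_
    simp only [ArithOp.eval] at hw hv
    obtain ⟨hp₂, hs₂⟩ := hs₂
    rw [hs₂ g (by decide), hs₂ x (by decide), put_self, put_of_ne _ _ (by decide), hx] at hv
    have hv' := hv.neg_iff (by linarith)
    have h0 : (0 : ℝ) < 12 ^ 2 ^ i := by positivity
    have hg0 : 0 ≤ s g 0 * s g 0 := mul_self_nonneg _
    have e₁ : (12 : ℝ) ^ 2 ^ (i + 1) = 12 ^ 2 ^ i * 12 ^ 2 ^ i := by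
      rw [pow_succ, pow_mul, sq]
    have e₂ : (21 : ℝ) ^ 2 ^ (i + 1) = 21 ^ 2 ^ i * 21 ^ 2 ^ i := by
      rw [pow_succ, pow_mul, sq]
    refine ⟨?_, ?_, ?_, ?_, ?_⟩
    · rw [put_of_ne _ _ (by decide), hs₂ x (by decide), put_of_ne _ _ (by decide), hx]
    · rw [put_of_ne _ _ (by decide), hs₂ g (by decide), put_self, e₁]
      have := hw.ge hg0
      nlinarith [mul_le_mul hg hg (by positivity) (by linarith)]
    · rw [put_of_ne _ _ (by decide), hs₂ g (by decide), put_self, e₂]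
      have := hw.le hg0
      nlinarith [mul_le_mul hg' hg' (by linarith) (by positivity)]
    · rw [put_self, put_of_ne _ _ (by decide), hs₂ g (by decide), put_self, hv']
      constructor <;> intro <;> linarith
    · rw [put_of_ne _ _ (by decide), hp₂, put_of_ne _ _ (by decide), hp, Nat.odd_add_one]

end TowerProgram

-- About `10 * (j + 1)` steps with `j < 2 ^ n` are exponential in the length, while the precision
-- only has to exceed a constant. Since the machine must halt in time for every `u`, it first tests
-- whether `u` is below about `1/16`, and gives up otherwise.
open TowerProgram in
theorem towerParity_mem : towerParity ∈ EXProPolyPrec := by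
  refine mem_EXProPolyPrec prog p 6 1 6 1 le_rfl fun z hz u hu hu1 s hs => ?_
  obtain ⟨n, j, hj, rfl⟩ := towerParity_wellPosed.1 hz
  obtain ⟨v, l, -, hl, -, hl1, -, hnil⟩ := hs
  obtain ⟨ξ, rfl, hX⟩ : ∃ ξ, l = [ξ] ∧ Rounds u (64 ^ 2 ^ j) ξ := by
    simp only [towerInput, List.forall₂_cons_left_iff, List.forall₂_nil_left_iff] at hl
    obtain ⟨ξ, _, hX, rfl, rfl⟩ := hl
    exact ⟨ξ, rfl, hX⟩
  have hx : s x 0 = ξ := by rw [hl1]; simp [tapeOfList]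
  have hlen : (towerInput n j).len = n + 1 := by simp [towerInput, Input.len]
  have htime : 10 * (j + 1) + 20 ≤
      2 ^ (6 * (((towerInput n j).len + 1) * (precision u + 1)) ^ 1) := by
    rw [hlen, pow_one]
    calc 10 * (j + 1) + 20 ≤ 2 ^ 5 * 2 ^ n := by
          have : 1 ≤ 2 ^ n := Nat.one_le_two_pow
          omega
      _ = 2 ^ (5 + n) := by rw [pow_add]
      _ ≤ _ := Nat.pow_le_pow_right (by norm_num) (by nlinarith [Nat.zero_le (n * precision u)])
  refine .le ?_ htime
  refine .le (.consB ?_) (show 1 + (10 * (j + 1) + 18) + 1 ≤ _ by omega)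
  rintro _ rfl
  refine .le (.consB ?_) (show 1 + (10 * (j + 1) + 16) + 1 ≤ _ by omega)
  rintro _ ⟨c, hc, rfl⟩
  refine .le (.consB ?_) (show 1 + (10 * (j + 1) + 14) + 1 ≤ _ by omega)
  rintro _ ⟨w, hw, rfl⟩
  simp only [ArithOp.eval] at hw
  rw [put_of_ne _ _ (by decide), put_self, put_self] at hw
  have hw' := hw.neg_iff hu1.le
  have hpow : (0 : ℝ) < 64 ^ 2 ^ j := by positivity
  refine .le (.cons _ (t₁ := 10 * (j + 1) + 10) ?_ fun s' hs' => .nil hs')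
    (show _ + 1 + 1 ≤ _ by omega)
  rcases le_or_gt 0 w with h | h
  · refine .le (.ite_nonneg (by simpa using h) (.skip fun hp => ?_)) (show 1 + 1 ≤ _ by omega)
    -- The program has given up, so `u` is at least about `1/16`; the required precision, at least
    -- `2 ^ 6`, forces `u < 2 ^ (-6)`.
    exfalso
    have h₆ : 6 < precision u := by
      refine lt_of_lt_of_le ?_ hp
      calc 6 < 2 ^ 6 := by norm_num
        _ ≤ _ := Nat.pow_le_pow_right (by norm_num) (by omega)
    have h₇ := (lt_precision_iff hu 6).1 h₆
    have h₉ := hc.ge (by norm_num)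
    have h₈ : ¬ (u - c < 0) := fun h' => absurd (hw'.2 h') (not_lt.2 h)
    norm_num at h₇
    linarith
  · have huc : u < c := by have := hw'.1 h; linarith
    have hu8 : u < 1 / 8 := by have := hc.le (by norm_num); linarith
    refine .le (.ite_neg (by simpa using h) (.consB ?_)) (show 1 + (10 * (j + 1) + 7) + 1 + 1 ≤ _ by omega)
    rintro _ ⟨g₀, hg₀, rfl⟩
    refine .le (.consB ?_) (show 1 + (10 * (j + 1) + 5) + 1 ≤ _ by omega)
    rintro _ ⟨t₀, ht₀, rfl⟩
    simp only [ArithOp.eval] at ht₀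
    rw [put_self, put_of_ne _ _ (by decide), put_of_ne _ _ (by decide), put_of_ne _ _ (by decide),
      put_of_ne _ _ (by decide), hx] at ht₀
    have ht₀' := ht₀.neg_iff hu1.le
    have h₁ := hg₀.le (by norm_num)
    have h₂ := hg₀.ge (by norm_num)
    have h₃ := hX.le hpow.le
    have h₄ := hX.ge hpow.le
    have h₅ : 7 / 8 * 64 ^ 2 ^ j ≤ ξ := by
      refine le_trans ?_ h₄
      rw [mul_comm]
      exact mul_le_mul_of_nonneg_left (by linarith) hpow.le
    have h₆ : ξ ≤ 9 / 8 * 64 ^ 2 ^ j := by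
      refine h₃.trans ?_
      rw [mul_comm (9 / 8 : ℝ)]
      exact mul_le_mul_of_nonneg_left (by linarith) hpow.le
    refine .le (.cons _ (tri_loop hu hu8 j (ξ := ξ) h₅ h₆ (j + 1) 0 _
      (by omega) ?_ ?_ ?_ ?_ ?_) fun s' hs' => .nil fun _ => ?_)
      (show (10 * (j + 1) + 1) + 1 + 1 ≤ _ by omega)
    · rw [put_of_ne _ _ (by decide), put_of_ne _ _ (by decide), put_of_ne _ _ (by decide),
        put_of_ne _ _ (by decide), put_of_ne _ _ (by decide), hx]
    · rw [put_of_ne _ _ (by decide), put_self]; norm_num; linarith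
    · rw [put_of_ne _ _ (by decide), put_self]; norm_num; linarith
    · rw [put_self, put_of_ne _ _ (by decide), put_self, ht₀']
      constructor <;> intro <;> linarith
    · rw [put_of_ne _ _ (by decide), put_of_ne _ _ (by decide), put_of_ne _ _ (by decide),
        put_of_ne _ _ (by decide), put_of_ne _ _ (by decide), hnil]
      simp
    · rw [towerInput_mem hj, hs', Nat.odd_add_one, Nat.not_odd_iff_even]

/-! ### Coupled computations -/

/-- The values `v` and `w` are the same signed monomial `σ b ^ (d * N + c)`, at `N` and at `N'`. -/
def Coupled (b : ℝ) (N N' K : ℤ) (v w : ℝ) : Prop :=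
  ∃ (σ : ℝ) (d c : ℤ), (σ = 0 ∨ σ = 1 ∨ σ = -1) ∧ |c| ≤ K ∧
    v = σ * b ^ (d * N + c) ∧ w = σ * b ^ (d * N' + c)

theorem Rounds.smul {u z w : ℝ} (h : Rounds u z w) (t : ℝ) : Rounds u (t * z) (t * w) := by
  obtain ⟨δ, hδ, rfl⟩ := h
  exact ⟨δ, hδ, by ring⟩

theorem rounds_of_abs_sub_lt {u z w : ℝ} (h : |w - z| < u * |z|) : Rounds u z w := by
  have hz : z ≠ 0 := by
    rintro rfl
    simp only [abs_zero, mul_zero] at h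
    exact absurd h (not_lt.2 (abs_nonneg _))
  refine ⟨(w - z) / z, ?_, ?_⟩
  · rw [abs_div, div_lt_iff₀ (abs_pos.2 hz)]
    exact h
  · rw [mul_add, mul_one, mul_div_cancel₀ _ hz]
    ring

/-- Rounding to powers of `b`. -/
theorem exists_rounds_zpow {b u z : ℝ} (hb : 1 < b) (hbu : b ≤ 1 + u) (hz : z ≠ 0) :
    ∃ (σ : ℝ) (g : ℤ), (σ = 1 ∨ σ = -1) ∧ Rounds u z (σ * b ^ g) ∧ b ^ g ≤ |z| ∧
      |z| < b ^ (g + 1) := by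
  obtain ⟨g, hg⟩ := exists_mem_Ico_zpow (abs_pos.2 hz) hb
  have hb0 : 0 < b := by linarith
  have hp : 0 < b ^ g := zpow_pos hb0 g
  have h₁ : |z| - b ^ g < u * |z| := by
    have h₂ := hg.2
    have h₃ := hg.1
    rw [zpow_add_one₀ hb0.ne'] at h₂
    have : |z| < b ^ g * (1 + u) := h₂.trans_le (mul_le_mul_of_nonneg_left hbu hp.le)
    have : u * b ^ g ≤ u * |z| := mul_le_mul_of_nonneg_left h₃ (by linarith)
    linarith
  rcases lt_or_gt_of_ne hz with h | h
  · refine ⟨-1, g, Or.inr rfl, rounds_of_abs_sub_lt ?_, hg.1, hg.2⟩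
    rw [abs_of_neg h] at h₁ hg ⊢
    rw [abs_of_nonneg (by linarith [hg.1])]
    linarith
  · refine ⟨1, g, Or.inl rfl, rounds_of_abs_sub_lt ?_, hg.1, hg.2⟩
    rw [abs_of_pos h] at h₁ hg ⊢
    rw [abs_of_nonpos (by linarith [hg.1])]
    linarith

section Coupling

variable {b u : ℝ} {N N' K C : ℤ}

theorem Coupled.mono {K' : ℤ} {v w : ℝ} (h : Coupled b N N' K v w) (hK : K ≤ K') :
    Coupled b N N' K' v w := by
  obtain ⟨σ, d, c, hσ, hc, hv, hw⟩ := h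
  exact ⟨σ, d, c, hσ, hc.trans hK, hv, hw⟩

theorem Coupled.zero (hK : 0 ≤ K) : Coupled b N N' K 0 0 :=
  ⟨0, 0, 0, Or.inl rfl, by simpa, by simp, by simp⟩

theorem Coupled.one (hK : 0 ≤ K) : Coupled b N N' K 1 1 :=
  ⟨1, 0, 0, Or.inr (Or.inl rfl), by simpa, by simp, by simp⟩

theorem Coupled.neg {v w : ℝ} (h : Coupled b N N' K v w) : Coupled b N N' K (-v) (-w) := by
  obtain ⟨σ, d, c, hσ, hc, rfl, rfl⟩ := h
  refine ⟨-σ, d, c, ?_, hc, by ring, by ring⟩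
  rcases hσ with rfl | rfl | rfl <;> norm_num

/-- The sign sits in `σ`, which both values share; so coupled computations branch alike. -/
theorem Coupled.neg_iff (hb : 0 < b) {v w : ℝ} (h : Coupled b N N' K v w) : v < 0 ↔ w < 0 := by
  obtain ⟨σ, d, c, hσ, hc, rfl, rfl⟩ := h
  have h₁ : 0 < b ^ (d * N + c) := zpow_pos hb _
  have h₂ : 0 < b ^ (d * N' + c) := zpow_pos hb _
  rcases hσ with rfl | rfl | rfl <;> simp <;> constructor <;> intro <;> linarith

theorem Coupled.mul (hb : 0 < b) {v w v' w' : ℝ} (h : Coupled b N N' K v w)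
    (h' : Coupled b N N' K v' w') : Coupled b N N' (2 * K) (v * v') (w * w') := by
  obtain ⟨σ, d, c, hσ, hc, rfl, rfl⟩ := h
  obtain ⟨σ', d', c', hσ', hc', rfl, rfl⟩ := h'
  refine ⟨σ * σ', d + d', c + c', ?_, (abs_add_le _ _).trans (by linarith), ?_, ?_⟩
  · rcases hσ with rfl | rfl | rfl <;> rcases hσ' with rfl | rfl | rfl <;> norm_num
  · rw [show (d + d') * N + (c + c') = (d * N + c) + (d' * N + c') by ring,
      zpow_add₀ hb.ne' (d * N + c)]
    ring
  · rw [show (d + d') * N' + (c + c') = (d * N' + c) + (d' * N' + c') by ring,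
      zpow_add₀ hb.ne' (d * N' + c)]
    ring

/-- In all three cases `σ⁻¹ = σ`; with `0⁻¹ = 0` this includes division by zero, where the machines
yield `0`. -/
theorem Coupled.inv {v w : ℝ} (h : Coupled b N N' K v w) :
    Coupled b N N' K v⁻¹ w⁻¹ := by
  obtain ⟨σ, d, c, hσ, hc, rfl, rfl⟩ := h
  refine ⟨σ, -d, -c, hσ, by rwa [abs_neg], ?_, ?_⟩
  · rw [show -d * N + -c = -(d * N + c) by ring, zpow_neg, mul_inv]
    rcases hσ with rfl | rfl | rfl <;> norm_num
  · rw [show -d * N' + -c = -(d * N' + c) by ring, zpow_neg, mul_inv]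
    rcases hσ with rfl | rfl | rfl <;> norm_num

theorem abs_sign_mul (hb : 0 < b) {σ : ℝ} (hσ : σ = 1 ∨ σ = -1) (i : ℤ) :
    |σ * b ^ i| = b ^ i := by
  rw [abs_mul, abs_of_pos (zpow_pos hb i)]
  rcases hσ with rfl | rfl <;> simp

/-- A much smaller summand is lost. -/
theorem rounds_add_of_small (hu1 : u < 1) {v w : ℝ} (h : 2 * |w| < u * |v|) :
    Rounds u (v + w) v := by
  refine rounds_of_abs_sub_lt ?_
  have h₁ : |v| - |w| ≤ |v + w| := by
    have := abs_sub_abs_le_abs_sub v (-w)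
    rwa [abs_neg, sub_neg_eq_add] at this
  rw [show v - (v + w) = -w by ring, abs_neg]
  have h₀ : 0 ≤ |w| := abs_nonneg w
  have hu0 : 0 < u := by
    by_contra hu
    nlinarith [abs_nonneg v]
  nlinarith [mul_le_mul_of_nonneg_left h₁ hu0.le]

/-- If the degrees differ, the exponents differ by at least `N - 2 K ≥ C`, so one summand is more
than `2 / u` times the other and is a rounding of the sum, for `N` and `N'` alike. If the degrees
agree, `b ^ (d N)` splits off and what remains is free of `N`: it vanishes, or is rounded to a power
of `b`. The two conditions on `C` keep the new exponent within `K + C`, even after cancellation. -/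
theorem Coupled.add (hb : 1 < b) (hbu : b ≤ 1 + u) (hu1 : u < 1) (hC : 2 < u * b ^ C)
    (hC' : 1 ≤ b ^ (C - 1) * (b - 1)) (hN : 2 * K + C ≤ N) (hN' : 2 * K + C ≤ N')
    (hK : 0 ≤ K) (hC0 : 0 ≤ C)
    {v w v' w' : ℝ} (h : Coupled b N N' K v w) (h' : Coupled b N N' K v' w') :
    ∃ r r', Rounds u (v + v') r ∧ Rounds u (w + w') r' ∧ Coupled b N N' (K + C) r r' := by
  have hb0 : 0 < b := by linarith
  have hu0 : 0 < u := by
    have : 0 < b ^ C := zpow_pos hb0 _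
    by_contra hu
    nlinarith
  -- it suffices to treat the case of a first summand of larger degree
  have key : ∀ (σ σ' : ℝ) (d c d' c' : ℤ), (σ = 1 ∨ σ = -1) → (σ' = 1 ∨ σ' = -1) → |c| ≤ K →
      |c'| ≤ K → d' < d → ∀ M : ℤ, 2 * K + C ≤ M →
      Rounds u (σ * b ^ (d * M + c) + σ' * b ^ (d' * M + c')) (σ * b ^ (d * M + c)) := by
    intro σ σ' d c d' c' hσ hσ' hc hc' hd M hM
    refine rounds_add_of_small hu1 ?_
    rw [abs_sign_mul hb0 hσ, abs_sign_mul hb0 hσ']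
    have hi : (d' * M + c') + C ≤ d * M + c := by
      have h₁ : M ≤ (d - d') * M := le_mul_of_one_le_left (by linarith) (by linarith)
      have := abs_le.1 hc
      have := abs_le.1 hc'
      nlinarith
    have h₂ := zpow_le_zpow_right₀ hb.le hi
    rw [zpow_add₀ hb0.ne'] at h₂
    have hp : 0 < b ^ (d' * M + c') := zpow_pos hb0 _
    have := mul_le_mul_of_nonneg_left h₂ hu0.le
    nlinarith [mul_lt_mul_of_pos_left hC hp]
  obtain ⟨σ, d, c, hσ, hc, rfl, rfl⟩ := h
  obtain ⟨σ', d', c', hσ', hc', rfl, rfl⟩ := h'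
  rcases hσ with rfl | hσ
  · exact ⟨_, _, .refl hu0 _, .refl hu0 _, σ', d', c', hσ', by linarith, by ring, by ring⟩
  rcases hσ' with rfl | hσ'
  · exact ⟨_, _, .refl hu0 _, .refl hu0 _, σ, d, c, Or.inr hσ, by linarith, by ring, by ring⟩
  rcases lt_trichotomy d' d with hd | rfl | hd
  · exact ⟨_, _, key σ σ' d c d' c' hσ hσ' hc hc' hd N hN,
      key σ σ' d c d' c' hσ hσ' hc hc' hd N' hN', σ, d, c, Or.inr hσ, by linarith, rfl, rfl⟩
  · have hfac : ∀ M : ℤ, σ * b ^ (d' * M + c) + σ' * b ^ (d' * M + c') =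
        b ^ (d' * M) * (σ * b ^ c + σ' * b ^ c') := by
      intro M; rw [zpow_add₀ hb0.ne', zpow_add₀ hb0.ne']; ring
    set r := σ * b ^ c + σ' * b ^ c' with hr
    rw [hfac, hfac]
    by_cases hr0 : r = 0
    · rw [hr0, mul_zero, mul_zero]
      exact ⟨0, 0, .refl hu0 _, .refl hu0 _, .zero (by linarith)⟩
    · obtain ⟨τ, g, hτ, hround, hg, hg'⟩ := exists_rounds_zpow hb hbu hr0
      refine ⟨_, _, hround.smul _, hround.smul _, τ, d', g, Or.inr hτ, ?_, ?_, ?_⟩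
      · have hcK := abs_le.1 hc
        have hcK' := abs_le.1 hc'
        have hup : |r| ≤ b ^ (K + C) := by
          calc |r| ≤ b ^ c + b ^ c' := by
                rw [hr]
                refine (abs_add_le _ _).trans_eq ?_
                rw [abs_sign_mul hb0 hσ, abs_sign_mul hb0 hσ']
            _ ≤ b ^ K + b ^ K :=
                add_le_add (zpow_le_zpow_right₀ hb.le hcK.2) (zpow_le_zpow_right₀ hb.le hcK'.2)
            _ ≤ _ := by
                rw [zpow_add₀ hb0.ne']
                have : 0 < b ^ K := zpow_pos hb0 _
                nlinarith
        -- Limited cancellation: distinct powers differ by at least `b ^ (i - 1) * (b - 1)`, which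
        -- `hC'` bounds from below.
        have hdiff : ∀ i j : ℤ, -K ≤ i → j < i → b ^ (-K - C) ≤ b ^ i - b ^ j := by
          intro i j hi hj
          have h₁ : b ^ j ≤ b ^ (i - 1) := zpow_le_zpow_right₀ hb.le (by omega)
          have h₂ : b ^ i = b ^ (i - 1) * b := by
            rw [← zpow_add_one₀ hb0.ne', sub_add_cancel]
          have h₃ : b ^ (-K - C) * (b ^ (C - 1) * (b - 1)) ≤ b ^ i - b ^ j := by
            rw [← mul_assoc, ← zpow_add₀ hb0.ne']
            have h₄ : b ^ (-K - C + (C - 1)) ≤ b ^ (i - 1) :=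
              zpow_le_zpow_right₀ hb.le (by omega)
            have := mul_le_mul_of_nonneg_right h₄ (by linarith : 0 ≤ b - 1)
            linarith
          have h₅ : 0 < b ^ (-K - C) := zpow_pos hb0 _
          nlinarith
        have hlow : b ^ (-K - C) ≤ |r| := by
          have hsame : ∀ i : ℤ, -K ≤ i → b ^ (-K - C) ≤ b ^ i := fun i hi =>
            zpow_le_zpow_right₀ hb.le (by omega)
          have hp₁ : 0 < b ^ c := zpow_pos hb0 _
          have hp₂ : 0 < b ^ c' := zpow_pos hb0 _
          rcases lt_trichotomy c' c with hcc | hcc | hcc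
          · have h₁ := hdiff c c' hcK.1 hcc
            rcases hσ with h | h <;> rcases hσ' with h' | h' <;> rw [hr, h, h', le_abs]
            · left; linarith
            · left; linarith
            · right; linarith
            · right; linarith
          · have h₁ := hsame c hcK.1
            rcases hσ with h | h <;> rcases hσ' with h' | h' <;> rw [hr, h, h', le_abs]
            · left; linarith
            · exfalso; apply hr0; rw [hr, h, h', hcc]; ring
            · exfalso; apply hr0; rw [hr, h, h', hcc]; ring
            · right; linarith
          · have h₁ := hdiff c' c hcK'.1 hcc
            rcases hσ with h | h <;> rcases hσ' with h' | h' <;> rw [hr, h, h', le_abs]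
            · left; linarith
            · right; linarith
            · left; linarith
            · right; linarith
        rw [abs_le]
        have h₁ : g ≤ K + C := (zpow_le_zpow_iff_right₀ hb).1 (hg.trans hup)
        have h₂ : -K - C < g + 1 := (zpow_lt_zpow_iff_right₀ hb).1 (hlow.trans_lt hg')
        constructor <;> omega
      · rw [zpow_add₀ hb0.ne']; ring
      · rw [zpow_add₀ hb0.ne']; ring
  · refine ⟨_, _, ?_, ?_, σ', d', c', Or.inr hσ', by linarith, rfl, rfl⟩
    · rw [add_comm]; exact key σ' σ d' c' d c hσ' hσ hc' hc hd N hN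
    · rw [add_comm]; exact key σ' σ d' c' d c hσ' hσ hc' hc hd N' hN'

theorem Coupled.arith (hb : 1 < b) (hbu : b ≤ 1 + u) (hu1 : u < 1) (hC : 2 < u * b ^ C)
    (hC' : 1 ≤ b ^ (C - 1) * (b - 1)) (hN : 2 * K + C ≤ N) (hN' : 2 * K + C ≤ N')
    (hK : 0 ≤ K) (hC0 : 0 ≤ C) (op : ArithOp)
    {v w v' w' : ℝ} (h : Coupled b N N' K v w) (h' : Coupled b N N' K v' w') :
    ∃ r r', Rounds u (op.eval v v') r ∧ Rounds u (op.eval w w') r' ∧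
      Coupled b N N' (2 * K + C) r r' := by
  have hb0 : 0 < b := by linarith
  have hu0 : 0 < u := by linarith
  cases op with
  | add =>
    obtain ⟨r, r', h₁, h₂, h₃⟩ := h.add hb hbu hu1 hC hC' hN hN' hK hC0 h'
    exact ⟨r, r', h₁, h₂, h₃.mono (by linarith)⟩
  | sub =>
    obtain ⟨r, r', h₁, h₂, h₃⟩ := h.add hb hbu hu1 hC hC' hN hN' hK hC0 h'.neg
    rw [← sub_eq_add_neg] at h₁ h₂
    exact ⟨r, r', h₁, h₂, h₃.mono (by linarith)⟩
  | mul => exact ⟨_, _, .refl hu0 _, .refl hu0 _, (h.mul hb0 h').mono (by linarith)⟩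
  | div =>
    refine ⟨_, _, .refl hu0 _, .refl hu0 _, ?_⟩
    simp only [ArithOp.eval, div_eq_mul_inv]
    exact (h.mul hb0 h'.inv).mono (by linarith)

/-- For the data common to both computations, namely built-in constants and witness entries: they
get degree `0`, and the bound on their size bounds the exponent. -/
theorem exists_rounds_coupled (hb : 1 < b) (hbu : b ≤ 1 + u) {z : ℝ} {m : ℕ}
    (hz : z = 0 ∨ b ^ (-(m : ℤ)) ≤ |z| ∧ |z| ≤ b ^ (m : ℤ)) :
    ∃ w, Rounds u z w ∧ Coupled b N N' (m + 1) w w := by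
  have hu0 : 0 < u := by linarith
  rcases eq_or_ne z 0 with rfl | hz0
  · exact ⟨0, .refl hu0 _, .zero (by positivity)⟩
  obtain ⟨h₁, h₂⟩ := hz.resolve_left hz0
  obtain ⟨σ, g, hσ, hr, hg, hg'⟩ := exists_rounds_zpow hb hbu hz0
  refine ⟨_, hr, σ, 0, g, Or.inr hσ, ?_, by simp, by simp⟩
  have h₃ : g ≤ m := (zpow_le_zpow_iff_right₀ hb).1 (hg.trans h₂)
  have h₄ : -(m : ℤ) < g + 1 := (zpow_lt_zpow_iff_right₀ hb).1 (h₁.trans_lt hg')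
  rw [abs_le]
  constructor <;> omega

end Coupling

/-! ### Coupled computations of a machine. -/

theorem Machine.exists_step (M : Machine) {u : ℝ} (hu : 0 < u) (c : M.Config) :
    ∃ c', M.Step u c c' := by
  cases h : M.prog c.node with
  | const r d next => exact ⟨_, by simp only [Machine.Step, h]; exact ⟨_, .refl hu _, rfl⟩⟩
  | arith op a b d next => exact ⟨_, by simp only [Machine.Step, h]; exact ⟨_, .refl hu _, rfl⟩⟩
  | copy a d next => exact ⟨_, by simp only [Machine.Step, h]; rfl⟩
  | readUnit d next => exact ⟨_, by simp only [Machine.Step, h]; rfl⟩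
  | shiftLeft d next => exact ⟨_, by simp only [Machine.Step, h]; rfl⟩
  | shiftRight d next => exact ⟨_, by simp only [Machine.Step, h]; rfl⟩
  | branch a yes no =>
    rcases lt_or_ge (c.tape a 0) 0 with h₀ | h₀
    · exact ⟨⟨no, c.tape⟩, by
        simp only [Machine.Step, h]; exact ⟨fun h' => absurd h₀ (not_lt.2 h'), fun _ => by trivial⟩⟩
    · exact ⟨⟨yes, c.tape⟩, by
        simp only [Machine.Step, h]; exact ⟨fun _ => by trivial, fun h' => absurd h' (not_lt.2 h₀)⟩⟩
  | halt b => exact ⟨_, by simp only [Machine.Step, h]; rfl⟩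

theorem Machine.halt_stays {M : Machine} {u : ℝ} {f : ℕ → M.Config}
    (hf : ∀ t, M.Step u (f t) (f (t + 1))) {s : ℕ} {b : Bool}
    (h : M.prog (f s).node = .halt b) (t : ℕ) (hst : s ≤ t) : f t = f s := by
  induction t, hst using Nat.le_induction with
  | base => rfl
  | succ t _ ih =>
    have := hf t
    simp only [Machine.Step] at this
    rw [ih, h] at this
    exact this

/-- A computation has at most one output. -/
theorem Machine.halt_unique {M : Machine} {u : ℝ} {f : ℕ → M.Config}
    (hf : ∀ t, M.Step u (f t) (f (t + 1))) {s t : ℕ} {b b' : Bool}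
    (h : M.prog (f s).node = .halt b) (h' : M.prog (f t).node = .halt b') : b = b' := by
  rcases le_total s t with hst | hst
  · have := halt_stays hf h t hst
    rw [this, h] at h'
    exact Node.halt.inj h'
  · have := halt_stays hf h' s hst
    rw [this, h'] at h
    exact (Node.halt.inj h).symm

/-- Two configurations at the same node, with coupled tapes. -/
def Machine.CoupledConfig (M : Machine) (b : ℝ) (N N' K : ℤ) (c c' : M.Config) : Prop :=
  c.node = c'.node ∧ ∀ d i, Coupled b N N' K (c.tape d i) (c'.tape d i)

theorem coupled_writeTape {τ : ℕ} {b : ℝ} {N N' K K' : ℤ} (hKK : K ≤ K') {t t' : Fin τ → ℤ → ℝ}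
    (h : ∀ d i, Coupled b N N' K (t d i) (t' d i)) (d : Fin τ) {v v' : ℝ}
    (hv : Coupled b N N' K' v v') (e : Fin τ) (i : ℤ) :
    Coupled b N N' K' (writeTape t d v e i) (writeTape t' d v' e i) := by
  by_cases he : e = d
  · subst he
    by_cases hi : i = 0
    · subst hi; simpa [writeTape] using hv
    · simpa [writeTape, hi] using (h e i).mono hKK
  · simpa [writeTape, he] using (h e i).mono hKK

theorem coupled_shift {τ : ℕ} {b : ℝ} {N N' K K' : ℤ} (hKK : K ≤ K') {t t' : Fin τ → ℤ → ℝ}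
    (h : ∀ d i, Coupled b N N' K (t d i) (t' d i)) (d : Fin τ) (k : ℤ → ℤ) (e : Fin τ) (i : ℤ) :
    Coupled b N N' K' (Function.update t d (fun i => t d (k i)) e i)
      (Function.update t' d (fun i => t' d (k i)) e i) := by
  by_cases he : e = d
  · subst he
    simpa using (h e (k i)).mono hKK
  · simpa [he] using (h e i).mono hKK

/-- Both machines sit at the same node and choose their roundings together. A product doubles the
bound on the exponents and a sum adds `C`, so `2 * K + C` covers all cases; the unit roundoff must
itself be coupled because it can be read. -/
theorem Machine.CoupledConfig.step {M : Machine} {b u : ℝ} {N N' K C : ℤ} (hb : 1 < b)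
    (hbu : b ≤ 1 + u) (hu1 : u < 1) (hC : 2 < u * b ^ C) (hC' : 1 ≤ b ^ (C - 1) * (b - 1))
    (hN : 2 * K + C ≤ N) (hN' : 2 * K + C ≤ N') (hC0 : 0 ≤ C) {m : ℕ}
    (hm : (m : ℤ) + 1 ≤ K)
    (hconst : ∀ i r d next, M.prog i = .const r d next →
      r = 0 ∨ b ^ (-(m : ℤ)) ≤ |r| ∧ |r| ≤ b ^ (m : ℤ))
    (hunit : Coupled b N N' K u u) {c c' : M.Config} (h : M.CoupledConfig b N N' K c c') :
    ∃ e e', M.Step u c e ∧ M.Step u c' e' ∧ M.CoupledConfig b N N' (2 * K + C) e e' := by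
  obtain ⟨hn, ht⟩ := h
  have hK : 0 ≤ K := by linarith [Int.natCast_nonneg m]
  have hKK : K ≤ 2 * K + C := by linarith
  simp only [Machine.Step, ← hn]
  cases hp : M.prog c.node with
  | const r d next =>
    obtain ⟨w, hw, hcw⟩ := exists_rounds_coupled (N := N) (N' := N') hb hbu (hconst _ _ _ _ hp)
    exact ⟨_, _, ⟨w, hw, rfl⟩, ⟨w, hw, rfl⟩, rfl,
      coupled_writeTape hKK ht d (hcw.mono (hm.trans hKK))⟩
  | arith op a a' d next =>
    obtain ⟨r, r', h₁, h₂, h₃⟩ := (ht a 0).arith hb hbu hu1 hC hC' hN hN' hK hC0 op (ht a' 0)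
    exact ⟨_, _, ⟨_, h₁, rfl⟩, ⟨_, h₂, rfl⟩, rfl, coupled_writeTape hKK ht d h₃⟩
  | copy a d next =>
    exact ⟨_, _, rfl, rfl, rfl, coupled_writeTape hKK ht d ((ht a 0).mono hKK)⟩
  | readUnit d next =>
    exact ⟨_, _, rfl, rfl, rfl, coupled_writeTape hKK ht d (hunit.mono hKK)⟩
  | shiftLeft d next => exact ⟨_, _, rfl, rfl, rfl, coupled_shift hKK ht d _⟩
  | shiftRight d next => exact ⟨_, _, rfl, rfl, rfl, coupled_shift hKK ht d _⟩
  | branch a yes no =>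
    have hsign := (ht a 0).neg_iff (by linarith)
    have ht' := fun d i => (ht d i).mono hKK
    rcases lt_or_ge (c.tape a 0) 0 with h₀ | h₀
    · exact ⟨⟨no, c.tape⟩, ⟨no, c'.tape⟩, ⟨fun h' => absurd h₀ (not_lt.2 h'), fun _ => rfl⟩,
        ⟨fun h' => absurd (hsign.1 h₀) (not_lt.2 h'), fun _ => rfl⟩, rfl, ht'⟩
    · exact ⟨⟨yes, c.tape⟩, ⟨yes, c'.tape⟩, ⟨fun _ => rfl, fun h' => absurd h' (not_lt.2 h₀)⟩,
        ⟨fun _ => rfl, fun h' => absurd (hsign.2 h') (not_lt.2 h₀)⟩, rfl, ht'⟩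
  | halt a =>
    exact ⟨_, _, rfl, rfl, hn, fun d i => (ht d i).mono hKK⟩

/-- The bound on the exponents after `t` steps. -/
theorem exists_coupled_sequences {M : Machine} {b u : ℝ} {N N' K C : ℤ} (hb : 1 < b)
    (hbu : b ≤ 1 + u) (hu1 : u < 1) (hC : 2 < u * b ^ C) (hC' : 1 ≤ b ^ (C - 1) * (b - 1))
    (hC0 : 0 ≤ C) {m : ℕ} (hm : (m : ℤ) + 1 ≤ K)
    (hconst : ∀ i r d next, M.prog i = .const r d next →
      r = 0 ∨ b ^ (-(m : ℤ)) ≤ |r| ∧ |r| ≤ b ^ (m : ℤ))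
    (hunit : Coupled b N N' K u u) (T : ℕ) (hN : 2 ^ (T + 1) * (K + C) ≤ N)
    (hN' : 2 ^ (T + 1) * (K + C) ≤ N') {c c' : M.Config} (h : M.CoupledConfig b N N' K c c') :
    ∃ f f' : ℕ → M.Config, f 0 = c ∧ f' 0 = c' ∧ (∀ t, M.Step u (f t) (f (t + 1))) ∧
      (∀ t, M.Step u (f' t) (f' (t + 1))) ∧ ∀ t ≤ T, (f t).node = (f' t).node := by
  have hu0 : 0 < u := by linarith
  have hK : 0 ≤ K := by linarith [Int.natCast_nonneg m]
  -- The solution of `B 0 = K`, `B (t + 1) = 2 * B t + C`.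
  let B : ℕ → ℤ := fun t => 2 ^ t * (K + C) - C
  have hBK : ∀ t, K ≤ B t := by
    intro t
    have : (1 : ℤ) ≤ 2 ^ t := one_le_pow₀ (by norm_num)
    simp only [B]
    nlinarith
  -- Computations are infinite sequences, so after time `T` the steps are chosen arbitrarily and no
  -- coupling is claimed.
  have hnext : ∀ (t : ℕ) (x : M.Config × M.Config), ∃ y : M.Config × M.Config,
      M.Step u x.1 y.1 ∧ M.Step u x.2 y.2 ∧
      (t < T → M.CoupledConfig b N N' (B t) x.1 x.2 →
        M.CoupledConfig b N N' (B (t + 1)) y.1 y.2) := by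
    intro t x
    by_cases hx : t < T ∧ M.CoupledConfig b N N' (B t) x.1 x.2
    · have hle : 2 * B t + C ≤ 2 ^ (T + 1) * (K + C) := by
        have h₁ : (2 : ℤ) ^ (t + 1) ≤ 2 ^ (T + 1) :=
          pow_le_pow_right₀ (by norm_num) (by omega)
        have h₂ : 2 * B t + C = 2 ^ (t + 1) * (K + C) - C := by simp only [B]; ring
        rw [h₂]
        nlinarith
      obtain ⟨e, e', h₁, h₂, h₃⟩ := hx.2.step hb hbu hu1 hC hC' (hle.trans hN)
        (hle.trans hN') hC0 (hm.trans (hBK t)) hconst (hunit.mono (hBK t))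
      refine ⟨(e, e'), h₁, h₂, fun _ _ => ?_⟩
      have : B (t + 1) = 2 * B t + C := by simp only [B]; ring
      rw [this]
      exact h₃
    · obtain ⟨e, he⟩ := M.exists_step hu0 x.1
      obtain ⟨e', he'⟩ := M.exists_step hu0 x.2
      exact ⟨(e, e'), he, he', fun h₁ h₂ => absurd ⟨h₁, h₂⟩ hx⟩
  choose g hg₁ hg₂ hg₃ using hnext
  let F : ℕ → M.Config × M.Config := fun t => Nat.rec (c, c') (fun t x => g t x) t
  have hF : ∀ t ≤ T, M.CoupledConfig b N N' (B t) (F t).1 (F t).2 := by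
    intro t
    induction t with
    | zero =>
      intro _
      have : B 0 = K := by simp [B]
      rw [this]
      exact h
    | succ t ih => exact fun ht => hg₃ t (F t) (by omega) (ih (by omega))
  exact ⟨fun t => (F t).1, fun t => (F t).2, rfl, rfl, fun t => hg₁ t _, fun t => hg₂ t _,
    fun t ht => (hF t ht).1⟩

/-! ### The base of the monomials, magnitudes and machine constants. -/

theorem exists_root (k : ℕ) : ∃ b : ℝ, 1 < b ∧ b ^ (2 ^ (k + 1)) = 2 ∧ b ≤ 1 + (1 / 2) ^ k := by
  refine ⟨(2 : ℝ) ^ ((1 : ℝ) / (2 ^ (k + 1) : ℕ)), ?_, ?_, ?_⟩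
  · exact Real.one_lt_rpow (by norm_num) (by positivity)
  · rw [← Real.rpow_natCast, ← Real.rpow_mul (by norm_num), one_div,
      inv_mul_cancel₀ (by positivity), Real.rpow_one]
  · have h₁ : (2 : ℝ) ≤ (1 + (1 / 2) ^ k) ^ (2 ^ (k + 1)) := by
      have h₂ : (-2 : ℝ) ≤ (1 / 2) ^ k := by linarith [show (0 : ℝ) < (1 / 2) ^ k by positivity]
      have h₃ := one_add_mul_le_pow h₂ (2 ^ (k + 1))
      have h₄ : ((2 ^ (k + 1) : ℕ) : ℝ) * (1 / 2) ^ k = 2 := by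
        push_cast
        rw [pow_succ, mul_right_comm, ← mul_pow]
        norm_num
      linarith
    have h₅ : (0 : ℝ) ≤ 1 + (1 / 2) ^ k := by positivity
    calc (2 : ℝ) ^ ((1 : ℝ) / (2 ^ (k + 1) : ℕ))
        ≤ ((1 + (1 / 2 : ℝ) ^ k) ^ (2 ^ (k + 1))) ^ ((1 : ℝ) / (2 ^ (k + 1) : ℕ)) :=
          Real.rpow_le_rpow (by norm_num) h₁ (by positivity)
      _ = _ := by
          rw [← Real.rpow_natCast, ← Real.rpow_mul h₅,
            mul_one_div_cancel (by positivity), Real.rpow_one]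

theorem precision_half_pow (k : ℕ) : precision ((1 / 2) ^ k) = k := by
  rw [precision, one_div_pow, one_div_one_div, ← Real.rpow_natCast,
    Real.logb_rpow (by norm_num) (by norm_num), Nat.ceil_natCast]

/-- Ensures that the infimum in `mgt` is attained; otherwise it could be the default value `sInf ∅ =
0` and carry no information. -/
theorem exists_rangeF (x : ℝ) : ∃ k, 1 ≤ k ∧ x ∈ rangeF k := by
  rcases eq_or_ne x 0 with rfl | hx
  · exact ⟨1, le_rfl, Or.inl rfl⟩
  obtain ⟨k₁, hk₁⟩ := pow_unbounded_of_one_lt |x| (show (1 : ℝ) < 2 by norm_num)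
  obtain ⟨k₂, hk₂⟩ := pow_unbounded_of_one_lt |x|⁻¹ (show (1 : ℝ) < 2 by norm_num)
  set k := k₁ + k₂ + 1
  have hk : k < 2 ^ k := Nat.lt_two_pow_self
  refine ⟨k, by omega, Or.inr ⟨?_, ?_⟩⟩
  · have h₁ : ((2 : ℕ) : ℝ) ^ ((-2 ^ k + 1 - 1 : ℤ)) ≤ ((2 : ℝ) ^ k₂)⁻¹ := by
      rw [← zpow_natCast, ← zpow_neg, Nat.cast_ofNat]
      refine zpow_le_zpow_right₀ (by norm_num) ?_
      have : (k : ℤ) < 2 ^ k := by exact_mod_cast hk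
      omega
    exact h₁.trans ((inv_le_comm₀ (by positivity) (abs_pos.2 hx)).2 hk₂.le)
  · have h₁ : (1 : ℝ) / 2 ≤ 1 - ((2 : ℕ) : ℝ) ^ (-((k + 1 : ℕ) : ℤ)) := by
      rw [zpow_neg, zpow_natCast, Nat.cast_ofNat]
      have : (2 : ℝ) ^ (1 : ℕ) ≤ 2 ^ (k + 1) := pow_le_pow_right₀ (by norm_num) (by omega)
      have := inv_anti₀ (by norm_num) this
      norm_num at this ⊢
      linarith
    have h₂ : |x| * 2 ≤ ((2 : ℕ) : ℝ) ^ ((2 ^ (k + 1) - 1 : ℤ)) := by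
      calc |x| * 2 ≤ 2 ^ k₁ * 2 := by linarith
        _ = (2 : ℝ) ^ ((k₁ + 1 : ℕ) : ℤ) := by rw [zpow_natCast, pow_succ]
        _ ≤ _ := by
          rw [Nat.cast_ofNat]
          refine zpow_le_zpow_right₀ (by norm_num) ?_
          have : (k : ℤ) < 2 ^ k := by exact_mod_cast hk
          rw [pow_succ]
          push_cast
          omega
    have h₃ : 0 < ((2 : ℕ) : ℝ) ^ ((2 ^ (k + 1) - 1 : ℤ)) := by positivity
    calc |x| = |x| * 2 * (1 / 2) := by ring
      _ ≤ _ := mul_le_mul h₂ h₁ (by norm_num) h₃.le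

theorem abs_le_of_mgt_le {x : ℝ} {q : ℕ} (h : mgt x ≤ q) :
    x = 0 ∨ ((2 : ℝ) ^ 2 ^ (q + 1))⁻¹ ≤ |x| ∧ |x| ≤ 2 ^ 2 ^ (q + 1) := by
  obtain ⟨h₁, h₂⟩ : mgt x ∈ {k : ℕ | 1 ≤ k ∧ x ∈ rangeF k} := Nat.sInf_mem (exists_rangeF x)
  refine h₂.imp id fun h₃ => ?_
  set k := mgt x
  obtain ⟨h₃, h₄⟩ := h₃
  rw [Nat.cast_ofNat] at h₃ h₄
  have hkq : (2 : ℕ) ^ (k + 1) ≤ 2 ^ (q + 1) := Nat.pow_le_pow_right (by norm_num) (by omega)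
  have hkq' : (2 : ℝ) ^ 2 ^ (k + 1) ≤ 2 ^ 2 ^ (q + 1) := pow_le_pow_right₀ (by norm_num) hkq
  constructor
  · refine le_trans ?_ h₃
    rw [← zpow_natCast, ← zpow_neg]
    refine zpow_le_zpow_right₀ (by norm_num) ?_
    have : ((2 ^ k : ℕ) : ℤ) ≤ ((2 ^ (q + 1) : ℕ) : ℤ) := by
      exact_mod_cast Nat.pow_le_pow_right (by norm_num) (by omega)
    push_cast at this ⊢
    omega
  · refine h₄.trans (le_trans ?_ hkq')
    have h₅ : (2 : ℝ) ^ ((2 ^ (k + 1) - 1 : ℤ)) ≤ 2 ^ 2 ^ (k + 1) := by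
      rw [← zpow_natCast]
      refine zpow_le_zpow_right₀ (by norm_num) ?_
      push_cast
      omega
    have h₆ : 0 < (2 : ℝ) ^ (-((k + 1 : ℕ) : ℤ)) := by positivity
    have h₇ : 0 < (2 : ℝ) ^ ((2 ^ (k + 1) - 1 : ℤ)) := by positivity
    nlinarith

theorem eval_mono (P : ℕ[X]) {m n : ℕ} (h : m ≤ n) : P.eval m ≤ P.eval n := by
  rw [Polynomial.eval_eq_sum_range, Polynomial.eval_eq_sum_range]
  exact Finset.sum_le_sum fun i _ => Nat.mul_le_mul_left _ (Nat.pow_le_pow_left h i)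

/-- For `n = 2 ^ i` a polynomial is at most `2 ^ (c + d * (i + 1))`, and `c + d * (i + 1) ≤ i ^ 2 /
2 ≤ 2 ^ i` for `i = c + 2 * d + 3`. -/
theorem exists_eval_le_two_pow (P : ℕ[X]) : ∃ n, 1 ≤ n ∧ P.eval n ≤ 2 ^ n := by
  obtain ⟨c, d, h⟩ := exists_eval_le_pow P
  have h₁ : c + d * (c + 2 * d + 3 + 1) ≤ 2 ^ (c + 2 * d + 3) := by
    have h₂ : (c + 2 * d + 3) ^ 2 ≤ 2 * 2 ^ (c + 2 * d + 3) := by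
      generalize c + 2 * d + 3 = i
      induction i with
      | zero => simp
      | succ i ih =>
        rcases Nat.lt_or_ge i 3 with hi | hi
        · interval_cases i <;> norm_num
        · rw [pow_succ 2]; nlinarith
    nlinarith
  refine ⟨2 ^ (c + 2 * d + 3), Nat.one_le_two_pow, (h _).trans ?_⟩
  rw [Nat.size_pow]
  exact Nat.pow_le_pow_right (by norm_num) h₁

theorem Machine.exists_const_bound (M : Machine) : ∃ R : ℕ, ∀ i r d next,
    M.prog i = .const r d next → r = 0 ∨ ((2 : ℝ) ^ R)⁻¹ ≤ |r| ∧ |r| ≤ 2 ^ R := by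
  have h : ∀ i, ∃ R : ℕ, ∀ r d next, M.prog i = .const r d next →
      r = 0 ∨ ((2 : ℝ) ^ R)⁻¹ ≤ |r| ∧ |r| ≤ 2 ^ R := by
    intro i
    cases hp : M.prog i with
    | const r d next =>
      rcases eq_or_ne r 0 with rfl | hr
      · exact ⟨0, fun r d next h => Or.inl (Node.const.inj h).1.symm⟩
      obtain ⟨k₁, hk₁⟩ := pow_unbounded_of_one_lt |r| (show (1 : ℝ) < 2 by norm_num)
      obtain ⟨k₂, hk₂⟩ := pow_unbounded_of_one_lt |r|⁻¹ (show (1 : ℝ) < 2 by norm_num)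
      refine ⟨k₁ + k₂, fun r' d next h => Or.inr ?_⟩
      rw [← (Node.const.inj h).1]
      constructor
      · rw [inv_le_comm₀ (by positivity) (abs_pos.2 hr)]
        exact hk₂.le.trans (pow_le_pow_right₀ (by norm_num) (by omega))
      · exact hk₁.le.trans (pow_le_pow_right₀ (by norm_num) (by omega))
    | _ => exact ⟨0, fun r d next h => by simp at h⟩
  choose R hR using h
  refine ⟨Finset.univ.sup R, fun i r d next hp => (hR i r d next hp).imp id fun h => ?_⟩
  have hle : (2 : ℝ) ^ R i ≤ 2 ^ Finset.univ.sup R :=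
    pow_le_pow_right₀ (by norm_num) (Finset.le_sup (Finset.mem_univ i))
  exact ⟨(inv_anti₀ (by positivity) hle).trans h.1, h.2.trans hle⟩

theorem coupled_tapeOfList {b : ℝ} {N N' K : ℤ} (hK : 0 ≤ K) {l l' : List ℝ}
    (h : List.Forall₂ (Coupled b N N' K) l l') (i : ℤ) :
    Coupled b N N' K (tapeOfList l i) (tapeOfList l' i) := by
  have hlen := h.length_eq
  simp only [tapeOfList, hlen]
  split_ifs with h₁ h₂
  · generalize i.toNat = j
    clear hlen
    induction h generalizing j with
    | nil => simpa using .zero hK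
    | cons hab _ ih =>
      cases j with
      | zero => simpa using hab
      | succ j => simpa using ih j
  · exact .one hK
  · exact .zero hK

theorem exists_rounds_list {b u : ℝ} {N N' : ℤ} (hb : 1 < b) (hbu : b ≤ 1 + u) {m : ℕ}
    {l : List ℝ} (hl : ∀ z ∈ l, z = 0 ∨ b ^ (-(m : ℤ)) ≤ |z| ∧ |z| ≤ b ^ (m : ℤ)) :
    ∃ l', List.Forall₂ (Rounds u) l l' ∧ List.Forall₂ (Coupled b N N' (m + 1)) l' l' := by
  induction l with
  | nil => exact ⟨[], .nil, .nil⟩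
  | cons z l ih =>
    obtain ⟨l', h₁, h₂⟩ := ih fun z hz => hl z (List.mem_cons_of_mem _ hz)
    obtain ⟨w, hw, hw'⟩ := exists_rounds_coupled (N := N) (N' := N') hb hbu
      (hl z List.mem_cons_self)
    exact ⟨w :: l', .cons hw h₁, .cons hw' h₂⟩

/-- A machine with few steps and low precision does not distinguish two towers. -/
theorem exists_coupled_computations (M : Machine) {R k Q T n j : ℕ} (hk : 1 ≤ k)
    (hR : ∀ i r d next, M.prog i = .const r d next → r = 0 ∨ ((2 : ℝ) ^ R)⁻¹ ≤ |r| ∧ |r| ≤ 2 ^ R)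
    {y : List ℝ} (hy : ∀ a ∈ y, mgt a ≤ Q) (hj : T + R + 2 * k + Q + 7 ≤ j) :
    ∃ f f', M.IsComputation ((1 / 2) ^ k) ((towerInput n j).1, (towerInput n j).2 ++ y) f ∧
      M.IsComputation ((1 / 2) ^ k) ((towerInput n (j + 1)).1, (towerInput n (j + 1)).2 ++ y) f' ∧
      ∀ t ≤ T, (f t).node = (f' t).node := by
  obtain ⟨b, hb, hbL, hbu⟩ := exists_root k
  set u : ℝ := (1 / 2) ^ k with hu
  have hu0 : 0 < u := by positivity
  have hu1 : u < 1 := pow_lt_one₀ (by norm_num) (by norm_num) (by omega)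
  have hb0 : 0 < b := by linarith
  set L := 2 ^ (k + 1) with hL
  have hL1 : 1 ≤ L := Nat.one_le_two_pow
  have hbLm : ∀ m : ℕ, b ^ ((L * m : ℕ) : ℤ) = 2 ^ m := fun m => by
    rw [zpow_natCast, pow_mul, hbL]
  -- Chosen such that `b ^ (C - 1) = 2 ^ (k + 2) = 4 / u`, which gives both conditions of
  -- `Coupled.add`.
  let C : ℤ := ((L * (k + 2) : ℕ) : ℤ) + 1
  have hbC : b ^ (C - 1) = 2 ^ (k + 2) := by
    rw [show C - 1 = ((L * (k + 2) : ℕ) : ℤ) by simp [C], hbLm]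
  have hbC' : b ^ C = 2 ^ (k + 2) * b := by
    rw [← hbC, ← zpow_add_one₀ hb0.ne', sub_add_cancel]
  have h2k : (1 : ℝ) ≤ 2 ^ k := one_le_pow₀ (by norm_num)
  have huk : u * 2 ^ k = 1 := by rw [hu, ← mul_pow]; norm_num
  have hC : 2 < u * b ^ C := by
    rw [hbC', pow_add]
    nlinarith
  have hC' : 1 ≤ b ^ (C - 1) * (b - 1) := by
    rw [hbC]
    -- If `b - 1` were less than `2 ^ (-(k + 2)) = 1 / (2 L)`, then `2 = b ^ L ≤ exp (L (b - 1)) <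
    -- exp (1 / 2)`, which contradicts `e < 4`.
    by_contra hlt
    rw [not_le] at hlt
    have h₁ : b ≤ Real.exp (b - 1) := by linarith [Real.add_one_le_exp (b - 1)]
    have h₂ : (2 : ℝ) ≤ Real.exp (L * (b - 1)) := by
      rw [Real.exp_nat_mul, ← hbL]
      exact pow_le_pow_left₀ hb0.le h₁ _
    have h₃ : (L : ℝ) * (b - 1) < 1 / 2 := by
      have : (2 : ℝ) ^ (k + 2) = 2 * L := by rw [hL]; push_cast; ring
      rw [this] at hlt
      linarith
    have h₄ : Real.exp (1 / 2) * Real.exp (1 / 2) = Real.exp 1 := by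
      rw [← Real.exp_add]; norm_num
    have h₅ := Real.exp_lt_exp.2 h₃
    have h₆ := Real.exp_one_lt_d9
    nlinarith
  let m := L * (R + k + 2 ^ (Q + 1))
  let K : ℤ := (m : ℤ) + 1
  have hK : 0 ≤ K := by positivity
  -- As `64 = 2 ^ 6 = b ^ (6 L)`, the two real inputs are exactly `b ^ N` and `b ^ N'`.
  let N : ℤ := ((L * (6 * 2 ^ j) : ℕ) : ℤ)
  let N' : ℤ := ((L * (6 * 2 ^ (j + 1)) : ℕ) : ℤ)
  have hm : ∀ e : ℕ, e ≤ R + k + 2 ^ (Q + 1) → ∀ z : ℝ,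
      (z = 0 ∨ ((2 : ℝ) ^ e)⁻¹ ≤ |z| ∧ |z| ≤ 2 ^ e) →
      z = 0 ∨ b ^ (-(m : ℤ)) ≤ |z| ∧ |z| ≤ b ^ (m : ℤ) := by
    intro e he z hz
    have h₁ : (2 : ℝ) ^ e ≤ 2 ^ (R + k + 2 ^ (Q + 1)) := pow_le_pow_right₀ (by norm_num) he
    rw [zpow_neg, hbLm]
    exact hz.imp id fun h => ⟨(inv_anti₀ (by positivity) h₁).trans h.1, h.2.trans h₁⟩
  have hunit : Coupled b N N' K u u := by
    refine ⟨1, 0, -((L * k : ℕ) : ℤ), Or.inr (Or.inl rfl), ?_, ?_, ?_⟩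
    · rw [abs_neg, Nat.abs_cast]
      have : L * k ≤ m := Nat.mul_le_mul_left _ (by rw [add_assoc, add_left_comm]; exact Nat.le_add_right _ _)
      simp only [K]
      omega
    all_goals
      rw [zero_mul, zero_add, zpow_neg, hbLm, one_mul]
      exact eq_inv_of_mul_eq_one_left huk
  -- The doubling of exponents in `T` steps stays below `2 ^ j`; this is what the lower bound on `j`
  -- is for. The entries of `y` contribute `2 ^ (Q + 1)`, which costs only about `Q` in that bound.
  have hN : 2 ^ (T + 1) * (K + C) ≤ N := by
    have h₁ : 2 ^ (T + 1) * (m + 1 + (L * (k + 2) + 1)) ≤ L * (6 * 2 ^ j) := by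
      have h₂ : R + 2 * k + 4 < 2 ^ (R + 2 * k + 4) := Nat.lt_two_pow_self
      have h₃ : 2 ^ (R + 2 * k + 4) ≤ 2 ^ (R + 2 * k + Q + 4) :=
        Nat.pow_le_pow_right (by norm_num) (by omega)
      have h₄ : 2 ^ (Q + 1) ≤ 2 ^ (R + 2 * k + Q + 4) :=
        Nat.pow_le_pow_right (by norm_num) (by omega)
      calc 2 ^ (T + 1) * (m + 1 + (L * (k + 2) + 1))
          ≤ 2 ^ (T + 1) * (L * (R + 2 * k + 4 + 2 ^ (Q + 1))) := by
            refine Nat.mul_le_mul_left _ ?_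
            simp only [m]
            nlinarith
        _ ≤ 2 ^ (T + 1) * (L * (2 * 2 ^ (R + 2 * k + Q + 4))) :=
            Nat.mul_le_mul_left _ (Nat.mul_le_mul_left _ (by omega))
        _ = L * 2 ^ (T + 1 + 1 + (R + 2 * k + Q + 4)) := by
          rw [pow_add 2 (T + 1 + 1), pow_succ 2 (T + 1)]; ring
        _ ≤ L * 2 ^ j :=
            Nat.mul_le_mul_left _ (Nat.pow_le_pow_right (by norm_num) (by omega))
        _ ≤ _ := Nat.mul_le_mul_left _ (by omega)
    have h₂ : ((2 ^ (T + 1) * (m + 1 + (L * (k + 2) + 1)) : ℕ) : ℤ) ≤ N := by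
      show _ ≤ ((L * (6 * 2 ^ j) : ℕ) : ℤ)
      exact Int.ofNat_le.2 h₁
    refine le_trans (le_of_eq ?_) h₂
    simp only [K, C]
    push_cast
    ring
  have hNN : N ≤ N' := by
    simp only [N, N']
    have : L * (6 * 2 ^ j) ≤ L * (6 * 2 ^ (j + 1)) := by
      rw [pow_succ]; exact Nat.mul_le_mul_left _ (by omega)
    exact_mod_cast this
  have hx : ∀ i : ℕ, (64 : ℝ) ^ 2 ^ i = b ^ (((L * (6 * 2 ^ i) : ℕ) : ℤ)) := by
    intro i
    rw [hbLm, pow_mul]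
    norm_num
  obtain ⟨y', hy₁, hy₂⟩ := exists_rounds_list (N := N) (N' := N') hb hbu (m := m) (l := y)
    fun z hz => hm (2 ^ (Q + 1)) (by omega) z (abs_le_of_mgt_le (hy z hz))
  have hrefl : ∀ l : List ℝ, List.Forall₂ (Rounds u) l l := fun l =>
    List.forall₂_same.2 fun z _ => .refl hu0 z
  have hbits : ∀ w : List Bool, List.Forall₂ (Coupled b N N' K) (realBits w) (realBits w) := by
    intro w
    refine List.forall₂_same.2 fun z hz => ?_
    simp only [realBits, List.mem_map] at hz
    obtain ⟨a, -, rfl⟩ := hz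
    cases a
    · exact .zero hK
    · exact .one hK
  let init : List ℝ → M.Config := fun x => ⟨0, fun d =>
      if d.val = 0 then tapeOfList (realBits (List.replicate n false))
      else if d.val = 1 then tapeOfList x
      else if d.val = 2 then tapeOfList (realBits (precision u).bits)
      else fun _ => 0⟩
  have hinit : ∀ i : ℕ, M.IsInitial u ((towerInput n i).1, (towerInput n i).2 ++ y)
      (init ((64 : ℝ) ^ 2 ^ i :: y')) := fun i =>
    ⟨_, _, hrefl _, .cons (.refl hu0 _) hy₁, rfl⟩
  have hcoupled : M.CoupledConfig b N N' K (init ((64 : ℝ) ^ 2 ^ j :: y'))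
      (init ((64 : ℝ) ^ 2 ^ (j + 1) :: y')) := by
    refine ⟨rfl, fun d i => ?_⟩
    simp only [init]
    split_ifs
    · exact coupled_tapeOfList hK (hbits _) i
    · refine coupled_tapeOfList hK (.cons ?_ hy₂) i
      exact ⟨1, 1, 0, Or.inr (Or.inl rfl), by simpa using hK, by rw [hx]; simp [N],
        by rw [hx]; simp [N']⟩
    · exact coupled_tapeOfList hK (hbits _) i
    · exact .zero hK
  obtain ⟨f, f', hf0, hf0', hf, hf', hff⟩ := exists_coupled_sequences hb hbu hu1 hC hC'
    (by positivity) le_rfl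
    (fun i r d next hp => hm R (by rw [add_assoc]; exact Nat.le_add_right _ _) r (hR i r d next hp)) hunit T hN (hN.trans hNN) hcoupled
  exact ⟨f, f', ⟨hf0 ▸ hinit j, hf⟩, ⟨hf0' ▸ hinit (j + 1), hf'⟩, hff⟩

/-- A witness `y` for an even `j` is also tried for `j + 1`, where condition (ii) bounds the
condition of `B` as well. The machine for `B` would have to tell the two instances apart with
polynomial precision and time, whereas `j = 2 ^ n - 2` exceeds the polynomial bound needed for
`exists_coupled_computations`. -/
theorem towerParity_notMem : towerParity ∉ NPBro := by
  rintro ⟨B, ⟨Arith, Prec, ⟨-, -, hPrec, M, hM⟩, ⟨P₁, hP₁⟩, P₂, hP₂⟩, p, q, Q, h⟩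
  obtain ⟨R, hR⟩ := M.exists_const_bound
  let q₀ := ⌈Q.eval 0⌉₊
  -- A bound for the sizes of both instances of `B`: the inputs have length `n + 1`, and the
  -- logarithm of their condition is `0`, so that of `B` is at most `Q.eval 0`.
  let S : ℕ[X] := Polynomial.X + 1 + p.comp (Polynomial.X + 1) + Polynomial.C q₀
  obtain ⟨n, hn, hF⟩ := exists_eval_le_two_pow
    (P₂.comp S + 2 * P₁.comp S + q.comp (Polynomial.X + 1) + Polynomial.C (R + 9))
  have hS : S.eval n = n + 1 + p.eval (n + 1) + q₀ := by simp [S]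
  simp only [Polynomial.eval_add, Polynomial.eval_comp, Polynomial.eval_mul, Polynomial.eval_C,
    Polynomial.eval_X, Polynomial.eval_one, Polynomial.eval_ofNat] at hF
  obtain ⟨j, hj⟩ : ∃ j, 2 ^ n = j + 2 := ⟨2 ^ n - 2, by
    have : 2 ^ 1 ≤ 2 ^ n := Nat.pow_le_pow_right (by norm_num) hn
    omega⟩
  have hjeven : Even j := by
    have : Even (2 ^ n) := (even_two.pow_of_ne_zero (by omega))
    rw [hj] at this
    exact (Nat.even_add.1 this).2 even_two
  have hlen : ∀ i, (towerInput n i).len = n + 1 := fun i => by simp [towerInput, Input.len]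
  have hwp : ∀ i < 2 ^ n, towerParity.WellPosed (towerInput n i) := fun i hi =>
    towerParity_wellPosed.2 ⟨n, i, hi, rfl⟩
  have hsize : ∀ i < 2 ^ n, towerParity.size (towerInput n i) = n + 1 := fun i hi => by
    rw [DecisionProblem.size, towerParity_logCond (hwp i hi), hlen]; simp
  have hj₁ : j < 2 ^ n := by omega
  have hj₂ : j + 1 < 2 ^ n := by omega
  obtain ⟨y, hyl, hyB, hy⟩ := (h _ _).1 ((towerInput_mem hj₁).2 hjeven)
  obtain ⟨hyW, hyc, hyq⟩ := hy (hwp j hj₁)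
  change y.length = p.eval (towerInput n j).len at hyl
  change ∀ a ∈ y, mgt a ≤ q.eval (towerParity.size (towerInput n j)) at hyq
  change _ ≤ Q.eval (towerParity.logCond (towerInput n j)) at hyc
  rw [hlen] at hyl
  rw [hsize j hj₁] at hyq
  have hnot : towerInput n (j + 1) ∉ towerParity.carrier := fun h' =>
    (Nat.even_add_one.1 ((towerInput_mem hj₂).1 h')) hjeven
  obtain ⟨hyB', hy'⟩ := (h _ _).2 hnot y (by
    change y.length = p.eval (towerInput n (j + 1)).len
    rw [hlen, hyl])
  obtain ⟨hyW', hyc'⟩ := hy' (hwp _ hj₂)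
  change _ ≤ Q.eval (towerParity.logCond (towerInput n (j + 1))) at hyc'
  rw [towerParity_logCond (hwp _ hj₁)] at hyc
  rw [towerParity_logCond (hwp _ hj₂)] at hyc'
  set z : Input := ((towerInput n j).1, (towerInput n j).2 ++ y) with hz
  set z' : Input := ((towerInput n (j + 1)).1, (towerInput n (j + 1)).2 ++ y) with hz'
  have hzl : z.len = n + 1 + p.eval (n + 1) := by
    simp [hz, towerInput, Input.len, hyl]; ring
  have hzl' : z'.len = n + 1 + p.eval (n + 1) := by
    simp [hz', towerInput, Input.len, hyl]; ring
  have hs : B.size z ≤ S.eval n := by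
    rw [hS, DecisionProblem.size, hzl]
    exact Nat.add_le_add_left (Nat.ceil_le_ceil hyc) _
  have hs' : B.size z' ≤ S.eval n := by
    rw [hS, DecisionProblem.size, hzl']
    exact Nat.add_le_add_left (Nat.ceil_le_ceil hyc') _
  -- `Prec` and `Arith` need not be monotone, but the larger of the two required precisions serves
  -- both instances: their lengths agree, so the time bound of one applies to the other.
  obtain ⟨k, hk₁, hk₂, hkP, hkT⟩ : ∃ k, Prec (B.size z) ≤ k ∧ Prec (B.size z') ≤ k ∧
      k ≤ P₁.eval (S.eval n) ∧ Arith z.len k ≤ P₂.eval (S.eval n) := by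
    rcases le_total (Prec (B.size z)) (Prec (B.size z')) with hle | hle
    · refine ⟨_, hle, le_rfl, (hP₁ _).trans (eval_mono _ hs'), ?_⟩
      rw [hzl, ← hzl']
      exact (hP₂ z' hyW').trans (eval_mono _ hs')
    · exact ⟨_, le_rfl, hle, (hP₁ _).trans (eval_mono _ hs), (hP₂ z hyW).trans (eval_mono _ hs)⟩
  have hk : 1 ≤ k := (hPrec _).trans hk₁
  obtain ⟨f, f', hf, hf', hff⟩ := exists_coupled_computations M (n := n) hk hR hyq
    (T := Arith z.len k) (j := j) (by omega)
  have hu0 : (0 : ℝ) < (1 / 2) ^ k := by positivity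
  have hu1 : ((1 : ℝ) / 2) ^ k < 1 := pow_lt_one₀ (by norm_num) (by norm_num) (by omega)
  obtain ⟨⟨s, hsT, a, hsa⟩, hout⟩ := hM z hyW _ hu0 hu1 f hf
  obtain ⟨-, hout'⟩ := hM z' hyW' _ hu0 hu1 f' hf'
  rw [precision_half_pow] at hsT hout hout'
  obtain ⟨s₁, h₁⟩ := (hout hk₁).1 hyB
  obtain ⟨s₂, h₂⟩ := (hout' hk₂).2 hyB'
  have h₃ := Machine.halt_unique hf.2 hsa h₁
  rw [hff s hsT] at hsa
  have h₄ := Machine.halt_unique hf'.2 hsa h₂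
  rw [h₃] at h₄
  exact Bool.noConfusion h₄

/-! ### Programs with bounded loops -/

section Ends

variable {T : Type} [DecidableEq T]

/-- A bound for the number of steps, if no loop is repeated more than `L` times. -/
def Cmd.cost (L : ℕ) : Cmd T → ℕ
  | .basic _ => 1
  | .skip => 1
  | .seq a b => a.cost L + b.cost L + 1
  | .ite _ a b => a.cost L + b.cost L + 1
  | .loop _ c => L * (c.cost L + 1) + 1

/-- The nesting depth of loops is fixed by the program, so the cost is polynomial in `L`; `2 ≤ L`
turns sums into higher powers. -/
theorem Cmd.cost_le (c : Cmd T) : ∃ K, ∀ L, 2 ≤ L → c.cost L ≤ L ^ K := by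
  have key : ∀ {L a b K₁ K₂ : ℕ}, 2 ≤ L → a ≤ L ^ K₁ → b ≤ L ^ K₂ →
      a + b + 1 ≤ L ^ (K₁ + K₂ + 2) := by
    intro L a b K₁ K₂ hL ha hb
    have h₁ : L ^ K₁ ≤ L ^ (K₁ + K₂) := Nat.pow_le_pow_right (by omega) (by omega)
    have h₂ : L ^ K₂ ≤ L ^ (K₁ + K₂) := Nat.pow_le_pow_right (by omega) (by omega)
    have h₃ : 1 ≤ L ^ (K₁ + K₂) := Nat.one_le_pow _ _ (by omega)
    have h₄ : 2 ^ 2 ≤ L ^ 2 := Nat.pow_le_pow_left hL 2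
    rw [pow_add L (K₁ + K₂)]
    calc a + b + 1 ≤ L ^ (K₁ + K₂) * 2 ^ 2 := by omega
      _ ≤ _ := Nat.mul_le_mul_left _ h₄
  induction c with
  | basic b => exact ⟨0, fun L hL => by simp [cost]⟩
  | skip => exact ⟨0, fun L hL => by simp [cost]⟩
  | seq a b iha ihb =>
    obtain ⟨K₁, h₁⟩ := iha
    obtain ⟨K₂, h₂⟩ := ihb
    exact ⟨_, fun L hL => key hL (h₁ L hL) (h₂ L hL)⟩
  | ite _ a b iha ihb =>
    obtain ⟨K₁, h₁⟩ := iha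
    obtain ⟨K₂, h₂⟩ := ihb
    exact ⟨_, fun L hL => key hL (h₁ L hL) (h₂ L hL)⟩
  | loop _ c ih =>
    obtain ⟨K, h⟩ := ih
    refine ⟨K + 1 + 1 + 2, fun L hL => ?_⟩
    have h₁ : L * c.cost L ≤ L ^ (K + 1) := by
      rw [pow_succ, mul_comm]; exact Nat.mul_le_mul_right _ (h L hL)
    have := key hL h₁ (K₂ := 1) (b := L) (by simp)
    simp only [cost]
    rw [mul_add, mul_one]
    exact this

/-- With unit roundoff `u`, all executions of `c` from `s` repeat no loop more than `L` times, and
end in a state that satisfies `Q`. -/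
def Ends (u : ℝ) (L : ℕ) (c : Cmd T) (s : State T) (Q : State T → Prop) : Prop :=
  Tri u c (c.cost L) s Q

variable {u : ℝ} {L : ℕ} {c c₁ c₂ : Cmd T} {s : State T} {Q R : State T → Prop}

namespace Ends

theorem imp (h : Ends u L c s Q) (hQ : ∀ s', Q s' → R s') : Ends u L c s R := Tri.imp h hQ

theorem const {r : ℝ} {d : T} (h : ∀ w, Rounds u r w → Q (put s d w)) :
    Ends u L (.basic (.const r d)) s Q :=
  .basic fun _ ⟨w, hw, e⟩ => e ▸ h w hw

theorem arith {op : ArithOp} {a b d : T}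
    (h : ∀ w, Rounds u (op.eval (s a 0) (s b 0)) w → Q (put s d w)) :
    Ends u L (.basic (.arith op a b d)) s Q :=
  .basic fun _ ⟨w, hw, e⟩ => e ▸ h w hw

theorem copy {a d : T} (h : Q (put s d (s a 0))) : Ends u L (.basic (.copy a d)) s Q :=
  .basic fun _ e => e ▸ h

theorem unit {d : T} (h : Q (put s d u)) : Ends u L (.basic (.unit d)) s Q :=
  .basic fun _ e => e ▸ h

theorem shl {d : T} (h : Q (Function.update s d (sl (s d) 1))) :
    Ends u L (.basic (.shl d)) s Q :=
  .basic fun _ e => e ▸ h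

theorem shr {d : T} (h : Q (Function.update s d (sl (s d) (-1)))) :
    Ends u L (.basic (.shr d)) s Q :=
  .basic fun _ e => e ▸ h

theorem skip (h : Q s) : Ends u L .skip s Q := Tri.skip h

theorem seq (h : Ends u L c₁ s fun s' => Ends u L c₂ s' Q) : Ends u L (.seq c₁ c₂) s Q :=
  Tri.seq _ h fun _ => id

theorem ite {a : T} (h₁ : 0 ≤ s a 0 → Ends u L c₁ s Q) (h₂ : s a 0 < 0 → Ends u L c₂ s Q) :
    Ends u L (.ite a c₁ c₂) s Q := by
  rcases le_or_gt 0 (s a 0) with h | h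
  · exact (Tri.ite_nonneg h (h₁ h)).le (by simp [Cmd.cost])
  · exact (Tri.ite_neg h (h₂ h)).le (by simp [Cmd.cost])

theorem nil (h : Q s) : Ends u L (.block []) s Q := skip h

theorem cons {l : List (Cmd T)} (h : Ends u L c s fun s' => Ends u L (.block l) s' Q) :
    Ends u L (.block (c :: l)) s Q :=
  seq h

/-- A loop is executed at most `n` times if the invariant counts the remaining executions. -/
theorem loop {a : T} (I : ℕ → State T → Prop) (n : ℕ) (hn : n ≤ L) (h0 : I n s)
    (hstep : ∀ j s', I j s' → s' a 0 < 0 → ∃ i, j = i + 1 ∧ Ends u L c s' (I i))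
    (hdone : ∀ j s', I j s' → 0 ≤ s' a 0 → Q s') : Ends u L (.loop a c) s Q := by
  have key : ∀ n s, I n s → Tri u (.loop a c) (n * (c.cost L + 1) + 1) s Q := by
    intro n
    induction n with
    | zero =>
      intro s hs
      rcases le_or_gt 0 (s a 0) with h | h
      · exact (Tri.loop_done h (hdone _ _ hs h)).le (by simp)
      · obtain ⟨i, hi, -⟩ := hstep _ _ hs h
        omega
    | succ n ih =>
      intro s hs
      rcases le_or_gt 0 (s a 0) with h | h
      · exact (Tri.loop_done h (hdone _ _ hs h)).le (by simp)
      · obtain ⟨i, hi, h'⟩ := hstep _ _ hs h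
        obtain rfl : n = i := by omega
        exact (Tri.loop_step _ h h' ih).le (by rw [Nat.succ_mul]; omega)
  exact (key n s h0).le (by
    simp only [Cmd.cost]
    exact Nat.add_le_add_right (Nat.mul_le_mul_right _ hn) _)

end Ends

/-- The instruction does not mention tape `R`. -/
def Basic.Avoids (R : T) : Basic T → Prop
  | .const _ d => R ≠ d
  | .arith _ a b d => R ≠ a ∧ R ≠ b ∧ R ≠ d
  | .copy a d => R ≠ a ∧ R ≠ d
  | .unit d => R ≠ d
  | .shl d => R ≠ d
  | .shr d => R ≠ d

/-- The program does not mention tape `R`. -/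
def Cmd.Avoids (R : T) : Cmd T → Prop
  | .basic b => b.Avoids R
  | .skip => True
  | .seq c₁ c₂ => c₁.Avoids R ∧ c₂.Avoids R
  | .ite a c₁ c₂ => R ≠ a ∧ c₁.Avoids R ∧ c₂.Avoids R
  | .loop a c => R ≠ a ∧ c.Avoids R

theorem Cmd.avoids_block {l : List (Cmd T)} {R : T} :
    (Cmd.block l).Avoids R ↔ ∀ c ∈ l, c.Avoids R := by
  induction l with
  | nil => simp [Cmd.block, Cmd.Avoids]
  | cons c l ih => simp [Cmd.block, Cmd.Avoids, ih]

theorem Basic.Avoids.res {b : Basic T} {d : T} (hb : b.Avoids d) {s s' : State T} {g : ℤ → ℝ}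
    (h : b.Res u (Function.update s d g) s') :
    ∃ s'', b.Res u s s'' ∧ s' = Function.update s'' d g ∧ s'' d = s d := by
  have hput : ∀ {e : T} {v : ℝ}, d ≠ e →
      put (Function.update s d g) e v = Function.update (put s e v) d g := by
    intro e v he
    simp only [put, Function.update_of_ne he.symm]
    exact Function.update_comm he _ _ _
  cases b <;> simp only [Basic.Avoids] at hb <;> simp only [Basic.Res] at h ⊢
  case const r e =>
    obtain ⟨w, hw, rfl⟩ := h
    exact ⟨_, ⟨w, hw, rfl⟩, hput hb, put_of_ne _ _ hb⟩
  case arith op a b e =>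
    obtain ⟨w, hw, rfl⟩ := h
    rw [Function.update_of_ne hb.1.symm, Function.update_of_ne hb.2.1.symm] at hw
    exact ⟨_, ⟨w, hw, rfl⟩, hput hb.2.2, put_of_ne _ _ hb.2.2⟩
  case copy a e =>
    subst h
    exact ⟨_, rfl, by rw [hput hb.2, Function.update_of_ne hb.1.symm], put_of_ne _ _ hb.2⟩
  case unit e =>
    subst h
    exact ⟨_, rfl, hput hb, put_of_ne _ _ hb⟩
  all_goals
    subst h
    refine ⟨_, rfl, ?_, Function.update_of_ne hb _ _⟩
    rw [Function.update_of_ne hb.symm]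
    exact Function.update_comm hb _ _ _

theorem Tri.update {t : ℕ} {d : T} (h : Tri u c t s Q) (hc : c.Avoids d) (g : ℤ → ℝ) :
    Tri u c t (Function.update s d g) fun s' =>
      ∃ s'', Q s'' ∧ s' = Function.update s'' d g ∧ s'' d = s d := by
  induction h with
  | basic h =>
    refine .basic fun s' hs' => ?_
    obtain ⟨s'', h₁, h₂, h₃⟩ := Basic.Avoids.res hc hs'
    exact ⟨s'', h _ h₁, h₂, h₃⟩
  | skip h => exact .skip ⟨_, h, rfl, rfl⟩
  | seq R h₁ h₂ ih₁ ih₂ =>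
    refine .seq _ (ih₁ hc.1) ?_
    rintro _ ⟨s'', hs, rfl, e⟩
    exact e ▸ ih₂ _ hs hc.2
  | ite_nonneg h₀ h ih =>
    exact .ite_nonneg (by rwa [Function.update_of_ne hc.1.symm]) (ih hc.2.1)
  | ite_neg h₀ h ih =>
    exact .ite_neg (by rwa [Function.update_of_ne hc.1.symm]) (ih hc.2.2)
  | loop_done h₀ h =>
    exact .loop_done (by rwa [Function.update_of_ne hc.1.symm]) ⟨_, h, rfl, rfl⟩
  | loop_step R h₀ h₁ h₂ ih₁ ih₂ =>
    refine .loop_step _ (by rwa [Function.update_of_ne hc.1.symm]) (ih₁ hc.2) ?_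
    rintro _ ⟨s'', hs, rfl, e⟩
    exact e ▸ ih₂ _ hs hc
  | mono h ht hQ ih =>
    exact (ih hc).mono ht fun s' ⟨s'', h₁, h₂⟩ => ⟨s'', hQ _ h₁, h₂⟩

/-- A program behaves in the same way, whatever is on a tape that it does not mention. -/
theorem Ends.update {d : T} (h : Ends u L c s Q) (hc : c.Avoids d) (g : ℤ → ℝ) :
    Ends u L c (Function.update s d g) fun s' =>
      ∃ s'', Q s'' ∧ s' = Function.update s'' d g ∧ s'' d = s d :=
  Tri.update h hc g

/-! ### Rulers -/

/-- The tape has negative entries exactly in the cells `0, …, n - 1`. -/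
def Ruler (n : ℕ) (f : ℤ → ℝ) : Prop := ∀ i, f i < 0 ↔ 0 ≤ i ∧ i < n

/-- A ruler, with the head behind its last mark. -/
def OpenRuler (n : ℕ) (g : ℤ → ℝ) : Prop := ∃ f, Ruler n f ∧ g = sl f n

theorem openRuler_zero {f : ℤ → ℝ} : OpenRuler 0 f ↔ ∀ i, 0 ≤ f i := by
  simp only [OpenRuler, Ruler, Nat.cast_zero, sl_zero]
  constructor
  · rintro ⟨g, h, rfl⟩ i
    by_contra h'
    have := (h i).1 (not_le.1 h')
    omega
  · exact fun h => ⟨f, fun i => ⟨fun h' => absurd h' (not_lt.2 (h i)), fun h' => by omega⟩, rfl⟩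

/-- Move the head of `R` back to the first mark, and execute `c` for each of the marks passed. -/
def Cmd.rewind (R : T) (c : Cmd T) : Cmd T :=
  .block [.basic (.shr R), .loop R (.block [c, .basic (.shr R)]), .basic (.shl R)]

/-- Execute `c` for each mark on `R`. -/
def Cmd.forR (R : T) (c : Cmd T) : Cmd T :=
  .block [.loop R (.block [c, .basic (.shl R)]), .rewind R .skip]

/-- Add a mark to an open ruler. -/
noncomputable def Cmd.mark (P : T) : Cmd T := .block [.basic (.const (-1) P), .basic (.shl P)]

/-- Go back to the first mark. -/
def Cmd.close (P : T) : Cmd T := .rewind P .skip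

/-- Remove all marks. -/
noncomputable def Cmd.wipe (P : T) : Cmd T :=
  .loop P (.block [.basic (.const 0 P), .basic (.shl P)])

/-- The invariant `I` refers to states with `R` in its home position `f`. As `c` does not mention
`R`, `Ends.update` transfers `hstep` to the actual position of the head. The head runs through cells
`j - 1, …, 0` and stops at `-1`, where no mark is. -/
theorem Ends.rewind {R : T} {f : ℤ → ℝ} {n j : ℕ} (hf : Ruler n f) (hj : j ≤ n) (hL : j ≤ L)
    (hs : s R = sl f j) (hc : c.Avoids R) (I : ℕ → State T → Prop)
    (h0 : I 0 (Function.update s R f))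
    (hstep : ∀ i < j, ∀ s', I i s' → s' R = f → Ends u L c s' (I (i + 1)))
    (hQ : ∀ s', I j s' → s' R = f → Q s') : Ends u L (.rewind R c) s Q := by
  refine .cons (.shr (.cons (.loop (fun k s'' => k ≤ j ∧ ∃ s', I (j - k) s' ∧ s' R = f ∧
    s'' = Function.update s' R (sl f (k - 1))) j hL ?_ ?_ ?_)))
  · refine ⟨le_rfl, _, by simpa using h0, by simp, ?_⟩
    rw [hs, Function.update_idem, sl_sl]
    congr 2
  · rintro k _ ⟨hk, s', h₁, h₂, rfl⟩ h
    rw [Function.update_self, sl_apply, hf] at h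
    obtain ⟨k, rfl⟩ : ∃ i, k = i + 1 := ⟨k - 1, by omega⟩
    refine ⟨k, rfl, .cons (((hstep _ (by omega) s' h₁ h₂).update hc _).imp ?_)⟩
    rintro _ ⟨s'', h₃, rfl, h₄⟩
    refine .cons (.shr (.nil ⟨by omega, s'', by
      rwa [show j - k = j - (k + 1) + 1 by omega], h₄.trans h₂, ?_⟩))
    rw [Function.update_self, Function.update_idem, sl_sl]
    congr 2
    push_cast
    ring
  · rintro k _ ⟨hk, s', h₁, h₂, rfl⟩ h
    have : k = 0 := by
      by_contra h'
      refine absurd h (not_le.2 ?_)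
      rw [Function.update_self, sl_apply, hf]
      omega
    subst this
    refine .cons (.shl (.nil (hQ _ ?_ ?_)))
    · rw [Function.update_self, Function.update_idem, sl_sl]
      rw [show (1 : ℤ) + (((0 : ℕ) : ℤ) - 1) = 0 by norm_num, sl_zero]
      rw [← h₂, Function.update_eq_self]
      simpa using h₁
    · rw [Function.update_self, Function.update_self, sl_sl]
      rw [show (1 : ℤ) + (((0 : ℕ) : ℤ) - 1) = 0 by norm_num, sl_zero]

theorem Ends.forR {R : T} {n : ℕ} (hn : n ≤ L) (hf : Ruler n (s R)) (hc : c.Avoids R)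
    (I : ℕ → State T → Prop) (h0 : I 0 s)
    (hstep : ∀ i < n, ∀ s', I i s' → s' R = s R → Ends u L c s' (I (i + 1)))
    (hQ : ∀ s', I n s' → s' R = s R → Q s') : Ends u L (.forR R c) s Q := by
  refine .cons (.loop (fun k s'' => k ≤ n ∧ ∃ s', I (n - k) s' ∧ s' R = s R ∧
    s'' = Function.update s' R (sl (s R) (n - k : ℕ))) n hn ?_ ?_ ?_)
  · exact ⟨le_rfl, s, by simpa using h0, rfl, by simp⟩
  · rintro k _ ⟨hk, s', h₁, h₂, rfl⟩ h
    rw [Function.update_self, sl_apply, hf] at h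
    obtain ⟨k, rfl⟩ : ∃ i, k = i + 1 := ⟨k - 1, by omega⟩
    refine ⟨k, rfl, .cons (((hstep _ (by omega) s' h₁ h₂).update hc _).imp ?_)⟩
    rintro _ ⟨s'', h₃, rfl, h₄⟩
    refine .cons (.shl (.nil ⟨by omega, s'', by
      rwa [show n - k = n - (k + 1) + 1 by omega], h₄.trans h₂, ?_⟩))
    rw [Function.update_self, Function.update_idem, sl_sl]
    congr 2
    omega
  · rintro k _ ⟨hk, s', h₁, h₂, rfl⟩ h
    have : k = 0 := by
      by_contra h'
      refine absurd h (not_le.2 ?_)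
      rw [Function.update_self, sl_apply, hf]
      omega
    subst this
    refine .cons (.rewind hf le_rfl hn ?_ trivial (fun _ s'' => s'' = s') ?_ ?_ ?_)
    · rw [Function.update_self]; simp
    · rw [Function.update_idem, ← h₂, Function.update_eq_self]
    · rintro i _ _ rfl _
      exact .skip rfl
    · rintro _ rfl h
      exact .nil (hQ _ (by simpa using h₁) h)

@[simp] theorem Cmd.avoids_rewind {R d : T} : (Cmd.rewind R c).Avoids d ↔ d ≠ R ∧ c.Avoids d := by
  simp only [Cmd.rewind, Cmd.block, Cmd.Avoids, Basic.Avoids]; tauto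

@[simp] theorem Cmd.avoids_forR {R d : T} : (Cmd.forR R c).Avoids d ↔ d ≠ R ∧ c.Avoids d := by
  simp only [Cmd.forR, Cmd.rewind, Cmd.block, Cmd.Avoids, Basic.Avoids]; tauto

@[simp] theorem Cmd.avoids_close {R d : T} : (Cmd.close R).Avoids d ↔ d ≠ R := by
  simp [Cmd.close, Cmd.Avoids]

@[simp] theorem Cmd.avoids_mark {R d : T} : (Cmd.mark R).Avoids d ↔ d ≠ R := by
  simp [Cmd.mark, Cmd.block, Cmd.Avoids, Basic.Avoids]

@[simp] theorem Cmd.avoids_wipe {R d : T} : (Cmd.wipe R).Avoids d ↔ d ≠ R := by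
  simp [Cmd.wipe, Cmd.block, Cmd.Avoids, Basic.Avoids]

theorem Ends.mark {P : T} {n : ℕ} (hu : u ≤ 1) (hP : OpenRuler n (s P))
    (h : ∀ g, OpenRuler (n + 1) g → Q (Function.update s P g)) : Ends u L (.mark P) s Q := by
  obtain ⟨f, hf, hP⟩ := hP
  refine .cons (.const fun w hw => .cons (.shl (.nil ?_)))
  have hw := (hw.neg_iff hu).2 (by norm_num)
  rw [put, Function.update_self, Function.update_idem]
  refine h _ ⟨Function.update f n w, fun i => ?_, ?_⟩
  · by_cases hi : i = n
    · subst hi; simp [hw]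
    · rw [Function.update_of_ne hi, hf]; push_cast; omega
  · ext i
    simp only [sl_apply, hP, Function.update_apply]
    push_cast
    rw [show i + ((n : ℤ) + 1) = i + 1 + n by ring]
    exact if_congr (by omega) rfl rfl

theorem Ends.close {P : T} {n : ℕ} (hn : n ≤ L) (hP : OpenRuler n (s P))
    (h : ∀ f, Ruler n f → Q (Function.update s P f)) : Ends u L (.close P) s Q := by
  obtain ⟨f, hf, hP⟩ := hP
  refine .rewind hf le_rfl hn hP trivial (fun _ s' => s' = Function.update s P f) rfl ?_ ?_
  · rintro _ _ _ rfl _; exact .skip rfl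
  · rintro _ rfl _; exact h f hf

theorem Ends.wipe {P : T} {n : ℕ} (hn : n ≤ L) (hP : Ruler n (s P))
    (h : ∀ f, OpenRuler 0 f → Q (Function.update s P f)) : Ends u L (.wipe P) s Q := by
  refine .loop (fun k s' => k ≤ n ∧ ∃ f, Ruler k f ∧
    s' = Function.update s P f) n hn ⟨le_rfl, _, hP, by simp⟩ ?_ ?_
  · rintro k _ ⟨hk, f, hf, rfl⟩ h
    rw [Function.update_self, hf] at h
    obtain ⟨k, rfl⟩ : ∃ i, k = i + 1 := ⟨k - 1, by omega⟩
    refine ⟨k, rfl, .cons (.const fun w hw => .cons (.shl (.nil ⟨by omega,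
      sl (Function.update f 0 0) 1, ?_, ?_⟩)))⟩
    · intro i
      by_cases hi : i + 1 = 0
      · simp [hi]; omega
      · rw [sl_apply, Function.update_of_ne hi, hf]; push_cast; omega
    · rw [hw.zero]; simp [put]
  · rintro k _ ⟨hk, f, hf, rfl⟩ h'
    refine h f (openRuler_zero.2 fun i => ?_)
    rw [Function.update_self] at h'
    have : k = 0 := by
      by_contra hk'
      exact absurd h' (not_le.2 ((hf 0).2 (by omega)))
    subst this
    by_contra h''
    have := (hf i).1 (not_le.1 h'')
    omega

theorem Ends.forR_shl {R d : T} {n : ℕ} (hn : n ≤ L) (hf : Ruler n (s R)) (hd : R ≠ d)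
    (h : Q (Function.update s d (sl (s d) n))) : Ends u L (.forR R (.basic (.shl d))) s Q := by
  refine .forR hn hf hd (fun i s' => s' = Function.update s d (sl (s d) i)) (by simp) ?_ ?_
  · rintro i _ _ rfl _
    refine .shl ?_
    simp only [Function.update_self, Function.update_idem, sl_sl]
    congr 2
    push_cast
    ring
  · rintro _ rfl _; exact h

theorem Ends.forR_shr {R d : T} {n : ℕ} (hn : n ≤ L) (hf : Ruler n (s R)) (hd : R ≠ d)
    (h : Q (Function.update s d (sl (s d) (-n)))) : Ends u L (.forR R (.basic (.shr d))) s Q := by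
  refine .forR hn hf hd (fun i s' => s' = Function.update s d (sl (s d) (-i))) (by simp) ?_ ?_
  · rintro i _ _ rfl _
    refine .shr ?_
    simp only [Function.update_self, Function.update_idem, sl_sl]
    congr 2
    push_cast
    ring
  · rintro _ rfl _; exact h

theorem Ends.forR_mark {R P : T} {n j : ℕ} (hu : u ≤ 1) (hn : n ≤ L) (hf : Ruler n (s R))
    (hd : R ≠ P) (hP : OpenRuler j (s P))
    (h : ∀ g, OpenRuler (j + n) g → Q (Function.update s P g)) :
    Ends u L (.forR R (.mark P)) s Q := by
  refine .forR hn hf (by simpa using hd)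
    (fun i s' => ∃ g, OpenRuler (j + i) g ∧ s' = Function.update s P g)
    ⟨_, hP, by simp⟩ ?_ ?_
  · rintro i _ _ ⟨g, hg, rfl⟩ _
    refine .mark hu (n := j + i) (by simpa using hg) fun g' hg' => ⟨g', hg', by simp⟩
  · rintro _ ⟨g, hg, rfl⟩ _; exact h g hg

theorem Ends.forR_forR_mark {R R' P : T} {n n' j : ℕ} (hu : u ≤ 1) (hn : n ≤ L) (hn' : n' ≤ L)
    (hf : Ruler n (s R)) (hf' : Ruler n' (s R')) (hR : R ≠ R') (hd : R ≠ P) (hd' : R' ≠ P)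
    (hP : OpenRuler j (s P)) (h : ∀ g, OpenRuler (j + n * n') g → Q (Function.update s P g)) :
    Ends u L (.forR R (.forR R' (.mark P))) s Q := by
  refine .forR hn hf (by simpa using ⟨hR, hd⟩)
    (fun i s' => ∃ g, OpenRuler (j + i * n') g ∧ s' = Function.update s P g)
    ⟨_, by simpa using hP, by simp⟩ ?_ ?_
  · rintro i _ _ ⟨g, hg, rfl⟩ _
    refine .forR_mark hu hn' (by rwa [Function.update_of_ne hd']) hd' (j := j + i * n')
      (by simpa using hg) fun g' hg' => ⟨g', ?_, by simp⟩
    rwa [Nat.succ_mul, ← add_assoc]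
  · rintro _ ⟨g, hg, rfl⟩ _; exact h g hg

end Ends

/-! ### Unary polynomials, measuring and copying lists. -/

section Routines

variable {T : Type} [DecidableEq T] {u : ℝ} {L : ℕ} {s : State T} {Q : State T → Prop}

/-- The states agree, except possibly on the tapes of the list. -/
def EqOff (V : List T) (s s' : State T) : Prop := ∀ d, d ∉ V → s' d = s d

theorem EqOff.refl (V : List T) (s : State T) : EqOff V s s := fun _ _ => rfl

theorem EqOff.trans {V : List T} {s₁ s₂ s₃ : State T} (h : EqOff V s₁ s₂) (h' : EqOff V s₂ s₃) :
    EqOff V s₁ s₃ := fun d hd => (h' d hd).trans (h d hd)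

theorem EqOff.mono {V V' : List T} {s s' : State T} (h : EqOff V s s') (hV : V ⊆ V') :
    EqOff V' s s' := fun d hd => h d fun h' => hd (hV h')

theorem EqOff.update {V : List T} {s s' : State T} (h : EqOff V s s') {d : T} (hd : d ∈ V)
    (g : ℤ → ℝ) : EqOff V s (Function.update s' d g) := fun e he => by
  rw [Function.update_of_ne (by rintro rfl; exact he hd), h e he]

theorem EqOff.put {V : List T} {s s' : State T} (h : EqOff V s s') {d : T} (hd : d ∈ V)
    (v : ℝ) : EqOff V s (put s' d v) := h.update hd _

theorem EqOff.cons_left {V : List T} {s s' : State T} {d : T} (h : EqOff (d :: V) s s')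
    (hd : s' d = s d) : EqOff V s s' := fun e he => by
  by_cases hed : e = d
  · rw [hed, hd]
  · exact h e (by simp [hed, he])

theorem update_sl (g : ℤ → ℝ) (m : ℤ) (v : ℝ) :
    Function.update (sl g m) 0 v = sl (Function.update g m v) m := by
  ext i
  simp only [Function.update_apply, sl_apply]
  exact if_congr (by omega) rfl rfl

/-- The value of a polynomial in unary. -/
theorem exists_polynomial_cmd (p : ℕ[X]) (N : T) : ∀ P P' : T, N ≠ P → N ≠ P' → P ≠ P' →
    ∃ c : Cmd T, ∀ {u : ℝ} {L : ℕ} {s : State T} {Q : State T → Prop} (n : ℕ), u ≤ 1 →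
      n ≤ L → p.eval (n + 1) ≤ L → Ruler n (s N) → OpenRuler 0 (s P) → OpenRuler 0 (s P') →
      (∀ s', OpenRuler (p.eval n) (s' P) → OpenRuler 0 (s' P') → EqOff [P, P'] s s' → Q s') →
      Ends u L c s Q := by
  induction p using Polynomial.recOnHorner with
  | M0 =>
    intro P P' h₁ h₂ h₃
    exact ⟨.skip, fun n _ _ _ _ hP hP' h => .skip (h _ (by simpa using hP) hP' (.refl _ _))⟩
  | MC p a _ _ ih =>
    intro P P' h₁ h₂ h₃
    obtain ⟨c, hc⟩ := ih P P' h₁ h₂ h₃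
    have key : ∀ a : ℕ, ∃ c' : Cmd T, ∀ {u : ℝ} {L : ℕ} {s : State T} {Q : State T → Prop} (n : ℕ),
        u ≤ 1 → OpenRuler n (s P) →
        (∀ s', OpenRuler (n + a) (s' P) → EqOff [P] s s' → Q s') → Ends u L c' s Q := by
      intro a
      induction a with
      | zero => exact ⟨.skip, fun n _ hP h => .skip (h _ hP (.refl _ _))⟩
      | succ a ih =>
        obtain ⟨c', hc'⟩ := ih
        refine ⟨.block [.mark P, c'], fun n hu hP h => .cons (.mark hu hP fun g hg =>
          .cons (hc' (n + 1) hu (by simpa using hg) fun s' hs' he => .nil (h s' ?_ ?_)))⟩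
        · rwa [← add_assoc, add_right_comm]
        · exact ((EqOff.refl _ _).update (by simp) g).trans he
    obtain ⟨c', hc'⟩ := key a
    refine ⟨.block [c, c'], fun {u L s Q} n hu hn hL hN hP hP' h => .cons (hc n hu hn ?_ hN hP hP'
      fun s' h₁ h₂ h₃ => .cons (hc' _ hu h₁ fun s'' h₄ h₅ => .nil (h s'' ?_ ?_ ?_)))⟩
    · simp only [Polynomial.eval_add] at hL; omega
    · simpa using h₄
    · rwa [h₅ _ (by simp [Ne.symm ‹P ≠ P'›])]
    · exact h₃.trans (h₅.mono (by simp))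
  -- The tapes change roles: the value of `p` is computed on `P'`, nested loops over `P'` and `N`
  -- write the product on `P`, and `P'` is wiped.
  | MX p _ ih =>
    intro P P' h₁ h₂ h₃
    obtain ⟨c, hc⟩ := ih P' P h₂ h₁ h₃.symm
    refine ⟨.block [c, .close P', .forR P' (.forR N (.mark P)), .wipe P'],
      fun {u L s Q} n hu hn hL hN hP hP' h => ?_⟩
    -- The bound is assumed at `n + 1`, since for `n = 0` a bound on `p n * n` says nothing about `p
    -- n`.
    have hL' : p.eval (n + 1) ≤ L := by
      rw [Polynomial.eval_mul, Polynomial.eval_X] at hL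
      exact (Nat.le_mul_of_pos_right _ (by omega)).trans hL
    have hL'' : p.eval n ≤ L := (eval_mono p (Nat.le_succ n)).trans hL'
    refine .cons (hc n hu hn hL' hN hP' hP fun s' h₄ h₅ h₆ => .cons (.close hL'' h₄ fun f hf =>
      .cons (.forR_forR_mark hu hL'' hn (by simpa using hf) ?_ h₂.symm h₃.symm h₁ (j := 0) ?_
        fun g hg => .cons (.wipe hL'' ?_ fun f' hf' => .nil (h _ ?_ ?_ ?_)))))
    · rwa [Function.update_of_ne h₂, h₆ N (by simp [h₁, h₂])]
    · rwa [Function.update_of_ne h₃]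
    · simpa [Function.update_of_ne h₃.symm] using hf
    · simpa [Function.update_of_ne h₃] using hg
    · simpa using hf'
    · refine (((h₆.mono ?_).update ?_ _).update ?_ _).update ?_ _ <;> simp

theorem tapeOfList_natCast (l : List ℝ) (i : ℕ) : tapeOfList l i = l.getD i 0 := by
  simp [tapeOfList]

theorem tapeOfList_neg (l : List ℝ) (i : ℕ) :
    tapeOfList l (-(i + 1)) = if i < l.length then 1 else 0 := by
  rw [tapeOfList, if_neg (by omega)]
  exact if_congr (by omega) rfl rfl

/-- The length of the list on tape `I`, in unary on tape `P`. -/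
noncomputable def Cmd.measure (I P blank tmp : T) : Cmd T :=
  .block [.basic (.shr I), .basic (.arith .sub blank I tmp),
    .loop tmp (.block [.mark P, .basic (.shr I), .basic (.arith .sub blank I tmp)]),
    .close P, .forR P (.basic (.shl I)), .basic (.shl I)]

/-- The entries themselves cannot show where a list ends; the length is read off the ones in the
negative cells, each tested by the sign of `0 - 1`. -/
theorem Ends.measure {I P blank tmp : T} {l : List ℝ} (hu : u ≤ 1) (hL : l.length ≤ L)
    (hIP : I ≠ P) (hIb : I ≠ blank) (hIt : I ≠ tmp) (hPb : P ≠ blank) (hPt : P ≠ tmp)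
    (hbt : blank ≠ tmp) (hI : s I = tapeOfList l) (hb : s blank 0 = 0) (hP : OpenRuler 0 (s P))
    (h : ∀ s', Ruler l.length (s' P) → EqOff [P, tmp] s s' → Q s') :
    Ends u L (.measure I P blank tmp) s Q := by
  have test : ∀ {s' : State T} {i : ℕ} {w : ℝ}, i ≤ l.length → s' blank 0 = 0 →
      s' I = sl (tapeOfList l) (-(i + 1)) →
      Rounds u (ArithOp.eval .sub (s' blank 0) (s' I 0)) w → (w < 0 ↔ i < l.length) := by
    intro s' i w hi h₁ h₂ hw
    rw [hw.neg_iff hu, h₁, h₂, sl_apply, zero_add, tapeOfList_neg, ArithOp.eval]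
    split_ifs with h <;> simp [h]
  refine .cons (.shr (.cons (.arith fun w hw => .cons (.loop (fun k s' => k ≤ l.length ∧
    s' I = sl (tapeOfList l) (-((l.length - k : ℕ) + 1)) ∧ OpenRuler (l.length - k) (s' P) ∧
    (s' tmp 0 < 0 ↔ 0 < k) ∧ EqOff [I, P, tmp] s s') l.length hL ?_ ?_ ?_))))
  · have := test (i := 0) (by omega) (by simp [hIb.symm, hb]) (by simp [hI]) hw
    refine ⟨le_rfl, by simp [hIt, hI], by simpa [hPt, hIP.symm] using hP, by simpa using this, ?_⟩
    exact ((EqOff.refl _ _).update (by simp) _).put (by simp) _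
  · rintro k s₁ ⟨hk, h₁, h₂, h₃, h₄⟩ h₅
    obtain ⟨k, rfl⟩ : ∃ i, k = i + 1 := ⟨k - 1, by have := h₃.1 h₅; omega⟩
    refine ⟨k, rfl, .cons (.mark hu h₂ fun g hg => .cons (.shr (.cons (.arith fun w hw =>
      .nil ?_))))⟩
    have e : l.length - (k + 1) + 1 = l.length - k := by omega
    have e' : sl (s₁ I) (-1) = sl (tapeOfList l) (-((l.length - k : ℕ) + 1)) := by
      rw [h₁, sl_sl, ← e]; congr 1; push_cast; ring
    have := test (i := l.length - k) (by omega)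
      (by simp [hIb.symm, hPb.symm, h₄ blank (by simp [hIb.symm, hPb.symm, hbt]), hb])
      (by simp [hIP, e']) hw
    refine ⟨by omega, by simp [hIt, hIP, e'], ?_, ?_, ?_⟩
    · rw [e] at hg; simpa [hPt, hIP.symm] using hg
    · rw [put_self, this]; omega
    · exact ((h₄.update (by simp) _).update (by simp) _).put (by simp) _
  · rintro k s₁ ⟨hk, h₁, h₂, h₃, h₄⟩ h₅
    have hk0 : k = 0 := by
      by_contra h'
      exact absurd (h₃.2 (by omega)) (not_lt.2 h₅)
    subst hk0
    refine .cons (.close hL h₂ fun f hf => .cons (.forR_shl hL (by simpa using hf) hIP.symm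
      (.cons (.shl (.nil (h _ ?_ ?_))))))
    · simpa [hIP.symm] using hf
    · refine EqOff.cons_left (d := I) (((h₄.update ?_ _).update ?_ _).update ?_ _) ?_ <;>
        simp [hIP, h₁, hI]

/-- Copy the cells at distance at most the length of the ruler `R`. -/
def Cmd.blit (R a d : T) : Cmd T :=
  .block [.forR R (.block [.basic (.shr a), .basic (.shr d)]),
    .forR R (.block [.basic (.copy a d), .basic (.shl a), .basic (.shl d),
      .basic (.copy a d), .basic (.shl a), .basic (.shl d)]),
    .forR R (.block [.basic (.shr a), .basic (.shr d)])]

theorem Ends.forR_shr_shr {R a d : T} {n : ℕ} (hn : n ≤ L) (hf : Ruler n (s R)) (ha : R ≠ a)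
    (hd : R ≠ d) (had : a ≠ d)
    (h : Q (Function.update (Function.update s a (sl (s a) (-n))) d (sl (s d) (-n)))) :
    Ends u L (.forR R (.block [.basic (.shr a), .basic (.shr d)])) s Q := by
  refine .forR hn hf (by simp [Cmd.block, Cmd.Avoids, Basic.Avoids, ha, hd]) (fun i s' => s' =
    Function.update (Function.update s a (sl (s a) (-i))) d (sl (s d) (-i))) (by simp) ?_ ?_
  · rintro i _ _ rfl _
    refine .cons (.shr (.cons (.shr (.nil ?_))))
    funext e
    by_cases h₁ : e = d
    · subst h₁
      simp only [Function.update_self, Function.update_of_ne had.symm, sl_sl]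
      congr 1; push_cast; ring
    · by_cases h₂ : e = a
      · subst h₂
        simp only [Function.update_self, Function.update_of_ne h₁, sl_sl]
        congr 1; push_cast; ring
      · simp [h₁, h₂]
  · rintro _ rfl _; exact h

theorem Ends.blit {R a d : T} {n : ℕ} (hn : n ≤ L) (hf : Ruler n (s R)) (ha : R ≠ a)
    (hd : R ≠ d) (had : a ≠ d)
    (h : Q (Function.update s d fun i => if -n ≤ i ∧ i < n then s a i else s d i)) :
    Ends u L (.blit R a d) s Q := by
  -- The target after `k` cells have been copied. Each mark of `R` pays for two of the `2 * n`
  -- cells.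
  let F : ℤ → ℤ → ℝ := fun k i => if -n ≤ i ∧ i < -n + k then s a i else s d i
  have hF : ∀ k : ℤ, 0 ≤ k → Function.update (F k) (-n + k) (s a (-n + k)) = F (k + 1) := by
    intro k hk
    ext i
    simp only [F, Function.update_apply]
    by_cases hi : i = -n + k
    · rw [if_pos hi, if_pos (by omega), hi]
    · rw [if_neg hi]
      exact if_congr (by omega) rfl rfl
  refine .cons (.forR_shr_shr hn hf ha hd had (.cons (.forR hn (by simpa [ha, hd] using hf)
    (by simp [Cmd.block, Cmd.Avoids, Basic.Avoids, ha, hd]) (fun i s' => s' =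
      Function.update (Function.update s a (sl (s a) (-n + 2 * i))) d (sl (F (2 * i)) (-n + 2 * i)))
      ?_ ?_ ?_)))
  · congr 1
    · simp
    · have : F (2 * (0 : ℕ)) = s d := by
        ext i; simp only [F]; exact if_neg (by omega)
      rw [this]; simp
  · rintro i _ _ rfl _
    refine .cons (.copy (.cons (.shl (.cons (.shl (.cons (.copy (.cons (.shl (.cons (.shl
      (.nil ?_))))))))))))
    funext e
    by_cases h₁ : e = d
    · subst h₁
      simp only [put, Function.update_self, Function.update_of_ne had.symm,
        Function.update_of_ne had, sl_sl, update_sl, sl_apply, zero_add]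
      rw [hF _ (by omega), show (1 : ℤ) + (-n + 2 * i) = -n + (2 * i + 1) by ring,
        hF _ (by omega)]
      push_cast
      rw [show (2 : ℤ) * (i + 1) = 2 * i + 1 + 1 by ring]
      congr 1
      ring
    · by_cases h₂ : e = a
      · subst h₂
        simp only [put, Function.update_self, Function.update_of_ne had, sl_sl]
        congr 1; push_cast; ring
      · simp [put, h₁, h₂]
  · rintro _ rfl _
    refine .cons (.forR_shr_shr hn (by simpa [ha, hd] using hf) ha hd had (.nil ?_))
    convert h using 1
    funext e
    by_cases h₁ : e = d
    · subst h₁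
      simp only [Function.update_self, sl_sl]
      rw [show (-n : ℤ) + (-n + 2 * n) = 0 by ring, sl_zero]
      ext i
      simp only [F]
      exact if_congr (by omega) rfl rfl
    · by_cases h₂ : e = a
      · subst h₂
        simp only [Function.update_self, Function.update_of_ne had, sl_sl]
        rw [show (-n : ℤ) + (-n + 2 * n) = 0 by ring, sl_zero]
      · simp [h₁, h₂]

end Routines

/-! ### Binary counters -/

/-- The binary expansion of `k`, with its length in unary in the negative cells. -/
def bitTape (k : ℕ) (i : ℤ) : ℝ :=
  if 0 ≤ i then if k.testBit i.toNat then 1 else 0 else if -i ≤ k.size then 1 else 0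

theorem tapeOfList_bits (k : ℕ) : tapeOfList (realBits k.bits) = bitTape k := by
  ext i
  simp only [tapeOfList, bitTape, realBits, List.length_map, ← Nat.size_eq_bits_len]
  refine if_congr Iff.rfl ?_ rfl
  rw [Nat.testBit_eq_inth, List.getI_eq_getElem?_getD, List.getD_eq_getElem?_getD,
    List.getElem?_map]
  cases k.bits[i.toNat]? <;> simp

/-- The carry: if bit `i` is the lowest zero, then `k = 2 ^ (i + 1) * q + (2 ^ i - 1)` and `k + 1 =
2 ^ (i + 1) * q + 2 ^ i`. The length grows only if `i` is the old length. -/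
theorem exists_trailing_ones (k : ℕ) : ∃ i, (∀ j < i, k.testBit j = true) ∧ k.testBit i = false ∧
    (∀ j, (k + 1).testBit j = if j < i then false else if j = i then true else k.testBit j) ∧
    (k + 1).size = max k.size (i + 1) := by
  have hex : ∃ i, k.testBit i = false := ⟨k, Nat.testBit_eq_false_of_lt Nat.lt_two_pow_self⟩
  classical
  let i := Nat.find hex
  have h₁ : ∀ j < i, k.testBit j = true := fun j hj => by
    simpa using Nat.find_min hex hj
  have h₂ : k.testBit i = false := Nat.find_spec hex
  have hmod : k % 2 ^ (i + 1) = 2 ^ i - 1 := by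
    refine Nat.eq_of_testBit_eq fun j => ?_
    rw [Nat.testBit_mod_two_pow, Nat.testBit_two_pow_sub_one]
    rcases lt_trichotomy j i with h | rfl | h
    · simp [h, h₁ j h, h.trans (Nat.lt_succ_self i)]
    · simp [h₂]
    · simp [not_lt.2 h.le, show ¬ j < i + 1 by omega]
  have hpos : 0 < 2 ^ i := by positivity
  have hk : k = 2 ^ (i + 1) * (k / 2 ^ (i + 1)) + (2 ^ i - 1) := by
    rw [← hmod, Nat.div_add_mod]
  have hk' : k + 1 = 2 ^ (i + 1) * (k / 2 ^ (i + 1)) + 2 ^ i := by omega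
  have hlt : 2 ^ i < 2 ^ (i + 1) := by rw [pow_succ]; omega
  refine ⟨i, h₁, h₂, fun j => ?_, ?_⟩
  · have e := Nat.testBit_two_pow_mul_add (k / 2 ^ (i + 1)) hlt j
    rw [← hk'] at e
    rw [e]
    rcases lt_trichotomy j i with h | rfl | h
    · rw [if_pos (by omega), if_pos h, Nat.testBit_two_pow_of_ne (by omega)]
    · rw [if_pos (by omega), if_neg (by omega), if_pos rfl, Nat.testBit_two_pow_self]
    · rw [if_neg (by omega), if_neg (by omega), if_neg (by omega), Nat.testBit_div_two_pow]
      congr 1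
      omega
  · refine le_antisymm (Nat.size_le.2 ?_) (max_le (Nat.size_le_size (Nat.le_succ k))
      (Nat.lt_size.2 ?_))
    · have h₃ := Nat.lt_size_self k
      have h₄ : 2 ^ k.size ≤ 2 ^ max k.size (i + 1) :=
        Nat.pow_le_pow_right (by norm_num) (le_max_left _ _)
      refine lt_of_le_of_ne (by omega) fun h => ?_
      have h₅ : k = 2 ^ max k.size (i + 1) - 1 := by omega
      have h₆ : k.testBit i = true := by
        rw [h₅, Nat.testBit_two_pow_sub_one]
        simp
      simp [h₂] at h₆
    · have : 0 ≤ 2 ^ (i + 1) * (k / 2 ^ (i + 1)) := Nat.zero_le _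
      omega

section Routines

variable {T : Type} [DecidableEq T] {u : ℝ} {L : ℕ} {s : State T} {Q : State T → Prop}

/-- Add one to the binary counter on tape `C`. -/
noncomputable def Cmd.incr (C P one blank tmp : T) : Cmd T :=
  .block [.basic (.arith .sub blank C tmp),
    .loop tmp (.block [.basic (.const 0 C), .basic (.shl C), .mark P,
      .basic (.arith .sub blank C tmp)]),
    .basic (.copy one C), .mark P, .close P, .forR P (.basic (.shr C)),
    .forR P (.block [.basic (.copy one C), .basic (.shr C)]),
    .forR P (.basic (.shl C)), .basic (.shl C), .wipe P]

theorem Ends.incr {C P one blank tmp : T} {k : ℕ} (hu : u ≤ 1) (hL : k.size + 2 ≤ L)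
    (hCP : C ≠ P) (hCo : C ≠ one) (hCb : C ≠ blank) (hCt : C ≠ tmp) (hPo : P ≠ one)
    (hPb : P ≠ blank) (hPt : P ≠ tmp) (hot : one ≠ tmp) (hbt : blank ≠ tmp)
    (hC : s C = bitTape k) (ho : s one 0 = 1) (hb : s blank 0 = 0) (hP : OpenRuler 0 (s P))
    (h : ∀ s', s' C = bitTape (k + 1) → OpenRuler 0 (s' P) → EqOff [C, P, tmp] s s' → Q s') :
    Ends u L (.incr C P one blank tmp) s Q := by
  obtain ⟨i, h₁, h₂, h₃, h₄⟩ := exists_trailing_ones k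
  have hi : i ≤ k.size := by
    by_contra h'
    have := h₁ k.size (by omega)
    rw [Nat.testBit_eq_false_of_lt (Nat.lt_size_self k)] at this
    simp at this
  -- The tape after the lowest `j` bits have been cleared; meanwhile `P` records `j`, for the way
  -- back.
  let G : ℤ → ℤ → ℝ := fun j x => if 0 ≤ x ∧ x < j then 0 else bitTape k x
  have hG0 : G 0 = bitTape k := by ext x; simp only [G]; exact if_neg (by omega)
  have hG : ∀ j : ℤ, 0 ≤ j → Function.update (G j) j 0 = G (j + 1) := by
    intro j hj
    ext x
    simp only [G, Function.update_apply]
    by_cases hx : x = j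
    · rw [if_pos hx, if_pos (by omega)]
    · rw [if_neg hx]; exact if_congr (by omega) rfl rfl
  have test : ∀ {s' : State T} {j : ℕ} {w : ℝ}, j ≤ i → s' blank 0 = 0 →
      s' C = sl (G j) j → Rounds u (ArithOp.eval .sub (s' blank 0) (s' C 0)) w →
      (w < 0 ↔ j < i) := by
    intro s' j w hj e₁ e₂ hw
    have : G j j = if k.testBit j then 1 else 0 := by
      simp only [G]
      rw [if_neg (by omega), bitTape, if_pos (by omega), Int.toNat_natCast]
    rw [hw.neg_iff hu, e₁, e₂, sl_apply, zero_add, this, ArithOp.eval]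
    rcases hj.lt_or_eq with h | rfl
    · simp [h₁ j h, h]
    · simp [h₂]
  refine .cons (.arith fun w hw => .cons (.loop (fun r s' => r ≤ i ∧
    s' C = sl (G (i - r : ℕ)) (i - r : ℕ) ∧ OpenRuler (i - r) (s' P) ∧
    (s' tmp 0 < 0 ↔ 0 < r) ∧ EqOff [C, P, tmp] s s') i (by omega) ?_ ?_ ?_))
  · have := test (j := 0) (by omega) hb (by simp [hC, hG0]) hw
    refine ⟨le_rfl, by simp [hCt, hC, hG0], by simpa [hPt] using hP, by simpa using this, ?_⟩
    exact (EqOff.refl _ _).put (by simp) _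
  · rintro r s₁ ⟨hr, e₁, e₂, e₃, e₄⟩ e₅
    obtain ⟨r, rfl⟩ : ∃ i, r = i + 1 := ⟨r - 1, by have := e₃.1 e₅; omega⟩
    have e : i - r = i - (r + 1) + 1 := by omega
    refine ⟨r, rfl, .cons (.const fun w hw => .cons (.shl (.cons (.mark hu (n := i - (r + 1)) ?_
      fun g hg => .cons (.arith fun w' hw' => .nil ?_)))))⟩
    · simpa [put, hCP.symm] using e₂
    rw [hw.zero] at hw' ⊢
    have e' : (Function.update (put s₁ C 0) C (sl (put s₁ C 0 C) 1)) C =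
        sl (G (i - r : ℕ)) (i - r : ℕ) := by
      rw [put, Function.update_self, Function.update_self, e₁, update_sl, sl_sl, hG _ (by omega),
        e]
      push_cast
      congr 1
      ring
    have := test (j := i - r) (by omega) (by
      simp [put, hCb.symm, hPb.symm, e₄ blank (by simp [hCb.symm, hPb.symm, hbt]), hb])
      (by rw [Function.update_of_ne hCP]; exact e') hw'
    refine ⟨by omega, ?_, ?_, ?_, ?_⟩
    · rw [put_of_ne _ _ hCt, Function.update_of_ne hCP]; exact e'
    · rw [← e] at hg; simpa [hPt] using hg
    · rw [put_self, this]; omega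
    · exact (((e₄.put (by simp) _).update (by simp) _).update (by simp) _).put (by simp) _
  · rintro r s₁ ⟨hr, e₁, e₂, e₃, e₄⟩ e₅
    have hr0 : r = 0 := by
      by_contra h'
      exact absurd (e₃.2 (by omega)) (not_lt.2 e₅)
    subst hr0
    rw [Nat.sub_zero] at e₁ e₂
    have eo : s₁ one = s one := e₄ one (by simp [hCo.symm, hPo.symm, hot])
    -- The unary length is renewed by writing ones to cells `-1, …, -(i + 1)`; this suffices because
    -- the new length is the maximum of `k.size` and `i + 1`.
    let H : ℤ → ℤ → ℝ := fun t x =>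
      if -t ≤ x ∧ x < 0 then 1 else Function.update (G i) i 1 x
    have hH0 : H 0 = Function.update (G i) i 1 := by
      ext x; simp only [H]; exact if_neg (by omega)
    have hH : ∀ t : ℤ, 0 ≤ t → Function.update (H t) (-1 - t) 1 = H (t + 1) := by
      intro t ht
      ext x
      simp only [H]
      by_cases hx : x = -1 - t
      · rw [hx, Function.update_self, if_pos (by omega)]
      · rw [Function.update_of_ne hx]; exact if_congr (by omega) rfl rfl
    have hHi : H (i + 1) = bitTape (k + 1) := by
      ext x
      simp only [H, G, bitTape, Function.update_apply]
      by_cases hx : 0 ≤ x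
      · obtain ⟨j, rfl⟩ := Int.eq_ofNat_of_zero_le hx
        simp only [Int.toNat_natCast, h₃]
        rw [if_neg (by omega), if_pos hx]
        rcases lt_trichotomy j i with h | rfl | h
        · rw [if_neg (by omega), if_pos (by omega)]; simp [h]
        · simp
        · rw [if_neg (by omega), if_neg (by omega)]
          simp [show ¬ j < i by omega, show j ≠ i by omega]
      · have h₅ : x ≠ i := by omega
        simp only [hx, h₅, if_false, h₄]
        by_cases h₆ : -x ≤ i + 1
        · rw [if_pos (by omega), if_pos (by rw [Nat.cast_max, le_max_iff]; push_cast; omega)]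
        · rw [if_neg (by omega), if_neg (by simp)]
          exact if_congr (by rw [Nat.cast_max, le_max_iff]; push_cast; omega) rfl rfl
    refine .cons (.copy (.cons (.mark hu (by simpa [put, hCP.symm] using e₂) fun g hg =>
      .cons (.close (n := i + 1) (by omega) (by simpa using hg) fun f hf =>
      .cons (.forR_shr (n := i + 1) (by omega) (by simpa using hf) hCP.symm (.cons (.forR
      (n := i + 1) (by omega) (by simpa [hCP.symm] using hf)
      (by simp [Cmd.block, Cmd.Avoids, Basic.Avoids, hCP.symm, hPo]) (fun t s' =>
        s' C = sl (H t) (-1 - t) ∧ EqOff [C, P, tmp] s s') ?_ ?_ ?_)))))))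
    · refine ⟨?_, ?_⟩
      · simp only [put, Function.update_self, Function.update_of_ne hCP, e₁, eo, ho, update_sl,
          sl_sl]
        rw [Nat.cast_zero, hH0]
        congr 1
        push_cast
        ring
      · refine EqOff.update (EqOff.update (EqOff.update (e₄.put ?_ _) ?_ _) ?_ _) ?_ _ <;> simp
    · rintro t _ s' ⟨f₁, f₂⟩ f₃
      refine .cons (.copy (.cons (.shr (.nil ⟨?_, ?_⟩))))
      · rw [f₂ one (by simp [hCo.symm, hPo.symm, hot]), ho]
        simp only [put, Function.update_self, f₁, update_sl, sl_sl]
        rw [hH _ (by omega)]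
        push_cast
        congr 1
        ring
      · exact (f₂.put (by simp) _).update (by simp) _
    · rintro s' ⟨f₁, f₂⟩ f₃
      have hP' : Ruler (i + 1) (s' P) := by rw [f₃]; simpa [hCP.symm] using hf
      refine .cons (.forR_shl (n := i + 1) (by omega) hP' hCP.symm (.cons (.shl (.cons
        (.wipe (n := i + 1) (by omega) (by simpa [hCP.symm] using hP') fun f' hf' =>
          .nil (h _ ?_ ?_ ?_))))))
      · simp only [Function.update_self, Function.update_of_ne hCP, f₁, sl_sl]
        push_cast
        rw [hHi, show (1 : ℤ) + (i + 1 + (-1 - (i + 1))) = 0 by ring, sl_zero]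
      · simpa using hf'
      · exact ((f₂.update (by simp) _).update (by simp) _).update (by simp) _

end Routines

/-! ### Generating vectors from bit strings -/

/-- The operations encoded by bit strings. They act on a register, which is finally appended to the
vector that is generated. -/
inductive GenOp
  | nop | sq | mul | neg | inv | zero | push

/-- The operation encoded by three bits. -/
def GenOp.ofBits : Bool → Bool → Bool → GenOp
  | false, false, true => .inv
  | false, true, false => .mul
  | false, true, true => .push
  | true, false, false => .sq
  | true, false, true => .zero
  | true, true, false => .neg
  | _, _, _ => .nop

/-- The register, a vector, and the number of its entries generated so far. -/
structure GenState where
  reg : ℝ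
  vec : List ℝ
  pos : ℕ

/-- The possible effects of an operation; `γ` is the factor used by `mul`. -/
def GenOp.Step (u γ : ℝ) : GenOp → GenState → GenState → Prop
  | .nop, D, D' => D' = D
  | .sq, D, D' => ∃ w, Rounds u (D.reg * D.reg) w ∧ D' = { D with reg := w }
  | .mul, D, D' => ∃ w, Rounds u (D.reg * γ) w ∧ D' = { D with reg := w }
  | .neg, D, D' => ∃ w, Rounds u (0 - D.reg) w ∧ D' = { D with reg := w }
  | .inv, D, D' => ∃ w, Rounds u (1 / D.reg) w ∧ D' = { D with reg := w }
  | .zero, D, D' => D' = { D with reg := 0 }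
  | .push, D, D' => D' = if D.pos < D.vec.length then ⟨1, D.vec.set D.pos D.reg, D.pos + 1⟩
      else { D with reg := 1 }

/-- The possible effects of a sequence of operations. -/
def GenRun (u γ : ℝ) : List GenOp → GenState → GenState → Prop
  | [], D, D' => D' = D
  | o :: l, D, D' => ∃ D₁, o.Step u γ D D₁ ∧ GenRun u γ l D₁ D'

theorem genRun_append {u γ : ℝ} {l l' : List GenOp} {D D' : GenState} :
    GenRun u γ (l ++ l') D D' ↔ ∃ D₁, GenRun u γ l D D₁ ∧ GenRun u γ l' D₁ D' := by
  induction l generalizing D with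
  | nil => simp [GenRun]
  | cons o l ih =>
    simp only [List.cons_append, GenRun, ih]
    constructor
    · rintro ⟨D₁, h₁, D₂, h₂, h₃⟩; exact ⟨D₂, ⟨D₁, h₁, h₂⟩, h₃⟩
    · rintro ⟨D₂, ⟨D₁, h₁, h₂⟩, h₃⟩; exact ⟨D₁, h₁, D₂, h₂, h₃⟩

/-- The `i`-th operation encoded by the binary expansion of `n`. -/
def genOp (n i : ℕ) : GenOp :=
  .ofBits (n.testBit (3 * i)) (n.testBit (3 * i + 1)) (n.testBit (3 * i + 2))

/-- The first `l` operations encoded by the binary expansion of `n`. -/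
def genOps (n l : ℕ) : List GenOp := (List.range l).map (genOp n)

/-- Names of auxiliary tapes. -/
inductive Aux
  | blank | one | ra | ra' | rb | p0 | p1 | nn | mm | mm' | g | c | ch | kt | us | yv | go | t0 | t1
  | t2 | pt | hf | kb | qt | r | eps | ans
  deriving DecidableEq

instance : Fintype Aux :=
  ⟨{.blank, .one, .ra, .ra', .rb, .p0, .p1, .nn, .mm, .mm', .g, .c, .ch, .kt, .us, .yv, .go, .t0,
    .t1, .t2, .pt, .hf, .kb, .qt, .r, .eps, .ans}, fun x => by cases x <;> simp⟩

/-- The tapes: three for the input, those of a simulated machine with `τ` tapes, a flag for each of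
its `N` nodes, and the auxiliary ones. -/
abbrev Tp (τ N : ℕ) : Type := Fin 3 ⊕ (Fin τ ⊕ Fin N ⊕ Aux)

variable {τ N : ℕ}

/-- An auxiliary tape. -/
abbrev ax (a : Aux) : Tp τ N := .inr (.inr (.inr a))

/-- A tape of the simulated machine. -/
abbrev tg (d : Fin τ) : Tp τ N := .inr (.inl d)

/-- The flag of a node of the simulated machine. -/
abbrev fl (i : Fin N) : Tp τ N := .inr (.inr (.inl i))

/-- The tape with the bits of the input. -/
abbrev bitsTape : Tp τ N := .inl 0

/-- The tape with the reals of the input. -/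
abbrev realsTape : Tp τ N := .inl 1

/-- Execute an operation. -/
def GenOp.cmd : GenOp → Cmd (Tp τ N)
  | .nop => .skip
  | .sq => .basic (.arith .mul (ax .g) (ax .g) (ax .g))
  | .mul => .basic (.arith .mul (ax .g) (ax .c) (ax .g))
  | .neg => .basic (.arith .sub (ax .blank) (ax .g) (ax .g))
  | .inv => .basic (.arith .div (ax .one) (ax .g) (ax .g))
  | .zero => .basic (.copy (ax .blank) (ax .g))
  | .push => .block [.ite (ax .mm) .skip (.block [.basic (.copy (ax .g) realsTape),
      .basic (.shl realsTape), .basic (.shl (ax .mm))]), .basic (.copy (ax .one) (ax .g))]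

/-- The contents of the tapes while a vector is generated. -/
structure GenRel (x : List ℝ) (f : ℤ → ℝ) (D : GenState) (s : State (Tp τ N)) : Prop where
  reg : s (ax .g) 0 = D.reg
  vec : s realsTape = sl (tapeOfList (x ++ D.vec)) (x.length + D.pos)
  mark : s (ax .mm) = sl f D.pos
  ruler : Ruler D.vec.length f
  le : D.pos ≤ D.vec.length

variable {u γ : ℝ} {L : ℕ} {s : State (Tp τ N)} {Q : State (Tp τ N) → Prop} {x : List ℝ}
  {f : ℤ → ℝ} {D : GenState}

theorem update_tapeOfList (l : List ℝ) {i : ℕ} (hi : i < l.length) (v : ℝ) :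
    Function.update (tapeOfList l) i v = tapeOfList (l.set i v) := by
  ext j
  by_cases hj : j = i
  · subst hj
    rw [Function.update_self, tapeOfList_natCast, List.getD_eq_getElem _ _ (by simpa)]
    simp
  · rw [Function.update_of_ne hj]
    simp only [tapeOfList, List.length_set]
    refine if_ctx_congr Iff.rfl (fun h => ?_) fun _ => rfl
    rw [List.getD_eq_getElem?_getD, List.getD_eq_getElem?_getD, List.getElem?_set_ne (by omega)]

theorem GenRel.setReg (h : GenRel x f D s) (w : ℝ) :
    GenRel x f { D with reg := w } (put s (ax .g) w) :=
  ⟨by simp, by rw [put_of_ne _ _ (by simp)]; exact h.vec,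
    by rw [put_of_ne _ _ (by simp)]; exact h.mark, h.ruler, h.le⟩

theorem Ends.genOp_cmd (o : GenOp) (h : GenRel x f D s) (ho : s (ax .one) 0 = 1)
    (hb : s (ax .blank) 0 = 0) (hc : s (ax .c) 0 = γ)
    (hQ : ∀ s' D', o.Step u γ D D' → D'.vec.length = D.vec.length → GenRel x f D' s' →
      EqOff [ax .g, ax .mm, realsTape] s s' → Q s') : Ends u L o.cmd s Q := by
  have key : ∀ w, EqOff [ax .g, ax .mm, realsTape] s (put s (ax .g) w) := fun w =>
    (EqOff.refl _ _).put (by simp) _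
  cases o with
  | nop => exact .skip (hQ _ _ rfl rfl h (.refl _ _))
  | sq =>
    refine .arith fun w hw => hQ _ _ ⟨w, ?_, rfl⟩ rfl (h.setReg w) (key w)
    simpa only [ArithOp.eval, h.reg] using hw
  | mul =>
    refine .arith fun w hw => hQ _ _ ⟨w, ?_, rfl⟩ rfl (h.setReg w) (key w)
    simpa only [ArithOp.eval, h.reg, hc] using hw
  | neg =>
    refine .arith fun w hw => hQ _ _ ⟨w, ?_, rfl⟩ rfl (h.setReg w) (key w)
    simpa only [ArithOp.eval, h.reg, hb] using hw
  | inv =>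
    refine .arith fun w hw => hQ _ _ ⟨w, ?_, rfl⟩ rfl (h.setReg w) (key w)
    simpa only [ArithOp.eval, h.reg, ho] using hw
  | zero => exact .copy (hb ▸ hQ _ { D with reg := 0 } rfl rfl (h.setReg _) (key _))
  | push =>
    refine .cons (.ite (fun h₀ => .skip (.cons (.copy (.nil ?_)))) fun h₀ =>
      .cons (.copy (.cons (.shl (.cons (.shl (.nil (.cons (.copy (.nil ?_)))))))))) 
    all_goals rw [h.mark, sl_apply, zero_add] at h₀
    · have h₁ : ¬ D.pos < D.vec.length := fun h₁ =>
        absurd ((h.ruler _).2 ⟨by omega, by omega⟩) (not_lt.2 h₀)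
      refine hQ _ { D with reg := 1 } ?_ rfl (ho ▸ h.setReg _) (key _)
      simp [GenOp.Step, h₁]
    · have h₁ := (h.ruler _).1 h₀
      have h₂ : D.pos < D.vec.length := by omega
      refine hQ _ ⟨1, D.vec.set D.pos D.reg, D.pos + 1⟩ ?_ (by simp) ⟨?_, ?_, ?_, ?_, ?_⟩ ?_
      · simp [GenOp.Step, h₂]
      · simp [put, ho]
      · simp only [put, ne_eq, reduceCtorEq, not_false_eq_true, Function.update_of_ne,
          Function.update_self, h.vec, update_sl, sl_sl, h.reg]
        have := update_tapeOfList (x ++ D.vec) (i := x.length + D.pos) (by simpa) D.reg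
        push_cast at this ⊢
        rw [this, List.set_append_right _ _ (by omega), Nat.add_sub_cancel_left]
        congr 1
        ring
      · simp [put, h.mark, add_comm]
      · simpa using h.ruler
      · simpa using h₂
      · exact ((((EqOff.refl _ _).put (by simp) _).update (by simp) _).update (by simp) _).put
          (by simp) _

/-- Read three bits from the counter and execute the operation encoded by them. -/
def genStep : Cmd (Tp τ N) :=
  .block [.basic (.arith .sub (ax .blank) (ax .ch) (ax .t0)), .basic (.shl (ax .ch)),
    .basic (.arith .sub (ax .blank) (ax .ch) (ax .t1)), .basic (.shl (ax .ch)),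
    .basic (.arith .sub (ax .blank) (ax .ch) (ax .t2)), .basic (.shl (ax .ch)),
    .ite (ax .t0)
      (.ite (ax .t1) (.ite (ax .t2) GenOp.nop.cmd GenOp.inv.cmd)
        (.ite (ax .t2) GenOp.mul.cmd GenOp.push.cmd))
      (.ite (ax .t1) (.ite (ax .t2) GenOp.sq.cmd GenOp.zero.cmd)
        (.ite (ax .t2) GenOp.neg.cmd GenOp.nop.cmd))]

theorem Ends.genStep {n i : ℕ} (hu : u ≤ 1) (h : GenRel x f D s) (ho : s (ax .one) 0 = 1)
    (hb : s (ax .blank) 0 = 0) (hc : s (ax .c) 0 = γ) (hn : s (ax .ch) = sl (bitTape n) (3 * i))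
    (hQ : ∀ s' D', (genOp n i).Step u γ D D' → D'.vec.length = D.vec.length → GenRel x f D' s' →
      s' (ax .ch) = sl (bitTape n) (3 * (i + 1)) →
      EqOff [ax .g, ax .mm, realsTape, ax .ch, ax .t0, ax .t1, ax .t2] s s' → Q s') :
    Ends u L genStep s Q := by
  have test : ∀ {j : ℕ} {w : ℝ}, Rounds u (ArithOp.eval .sub 0 (bitTape n j)) w →
      (w < 0 ↔ n.testBit j = true) := by
    intro j w hw
    rw [hw.neg_iff hu, ArithOp.eval, bitTape, if_pos (by omega), Int.toNat_natCast]
    cases n.testBit j <;> simp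
  refine .cons (.arith fun w₀ h₀ => .cons (.shl (.cons (.arith fun w₁ h₁ => .cons (.shl
    (.cons (.arith fun w₂ h₂ => .cons (.shl ?_))))))))
  simp only [put, ne_eq, reduceCtorEq, not_false_eq_true, Function.update_of_ne, Sum.inr.injEq,
    Function.update_self, hb, hn, sl_sl, sl_apply, zero_add] at h₀ h₁ h₂
  have b₀ := test (j := 3 * i) (by simpa using h₀)
  have b₁ := test (j := 3 * i + 1) (by simpa [add_comm] using h₁)
  have b₂ := test (j := 3 * i + 2) (by
    convert h₂ using 3; push_cast; ring)
  set s₁ := Function.update (put _ (ax .t2) w₂) _ _ with hs₁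
  have e₀ : s₁ (ax .t0) 0 = w₀ := by simp [hs₁, put]
  have e₁ : s₁ (ax .t1) 0 = w₁ := by simp [hs₁, put]
  have e₂ : s₁ (ax .t2) 0 = w₂ := by simp [hs₁, put]
  have e₃ : s₁ (ax .ch) = sl (bitTape n) (3 * (i + 1)) := by
    simp only [hs₁, put, ne_eq, reduceCtorEq, not_false_eq_true, Function.update_of_ne,
      Sum.inr.injEq, Function.update_self, hn, sl_sl]
    congr 1; ring
  have e₄ : EqOff [ax .ch, ax .t0, ax .t1, ax .t2] s s₁ :=
    ((((((EqOff.refl _ _).put (by simp) _).update (by simp) _).put (by simp) _).update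
      (by simp) _).put (by simp) _).update (by simp) _
  have h' : GenRel x f D s₁ := ⟨by rw [e₄ _ (by simp)]; exact h.reg,
    by rw [e₄ _ (by simp)]; exact h.vec, by rw [e₄ _ (by simp)]; exact h.mark, h.ruler, h.le⟩
  have key : ∀ o, genOp n i = o → Ends u L o.cmd s₁ fun s' => Ends u L (.block []) s' Q := by
    rintro _ rfl
    refine .genOp_cmd _ h' (by rw [e₄ _ (by simp)]; exact ho) (by rw [e₄ _ (by simp)]; exact hb)
      (by rw [e₄ _ (by simp)]; exact hc) fun s' D' f₁ f₂ f₃ f₄ => .nil (hQ s' D' f₁ f₂ f₃ ?_ ?_)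
    · rw [f₄ _ (by simp), e₃]
    · exact (e₄.mono (by simp)).trans (f₄.mono (by simp))
  refine .cons (.ite (fun h₀ => ?_) fun h₀ => ?_) <;>
  refine .ite (fun h₁ => ?_) (fun h₁ => ?_) <;>
  refine .ite (fun h₂ => key _ ?_) (fun h₂ => key _ ?_) <;>
  rw [e₀] at h₀ <;> rw [e₁] at h₁ <;> rw [e₂] at h₂ <;>
  simp only [← not_lt, b₀, b₁, b₂, Bool.not_eq_true] at h₀ h₁ h₂ <;>
  simp [genOp, h₀, h₁, h₂, GenOp.ofBits]

/-- Generate a vector from the counter. -/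
def generate : Cmd (Tp τ N) :=
  .block [.basic (.copy (ax .one) (ax .g)), .forR (ax .p1) (.basic (.shl realsTape)),
    .forR (ax .rb) genStep,
    .forR (ax .rb) (.block [.basic (.shr (ax .ch)), .basic (.shr (ax .ch)),
      .basic (.shr (ax .ch))]),
    .rewind (ax .mm) (.basic (.shr realsTape)), .forR (ax .p1) (.basic (.shr realsTape))]

theorem Ends.generate {n l : ℕ} {y : List ℝ} (hu : u ≤ 1) (ho : s (ax .one) 0 = 1)
    (hb : s (ax .blank) 0 = 0) (hc : s (ax .c) 0 = γ) (hn : s (ax .ch) = bitTape n)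
    (hx : s realsTape = tapeOfList (x ++ y)) (hm : Ruler y.length (s (ax .mm)))
    (hp : Ruler x.length (s (ax .p1))) (hr : Ruler l (s (ax .rb)))
    (hl : l ≤ L) (hxL : x.length ≤ L) (hyL : y.length ≤ L)
    (hQ : ∀ s' D, GenRun u γ (genOps n l) ⟨1, y, 0⟩ D → D.vec.length = y.length →
      s' realsTape = tapeOfList (x ++ D.vec) →
      EqOff [ax .g, realsTape, ax .t0, ax .t1, ax .t2] s s' → Q s') :
    Ends u L generate s Q := by
  refine .cons (.copy (.cons (.forR_shl hxL (by simpa using hp) (by simp) (.cons (.forR hl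
    (by simpa using hr) (by simp [RoundoffComplexity.genStep, GenOp.cmd, Cmd.block, Cmd.Avoids,
      Basic.Avoids]) (fun i s' => ∃ D, GenRun u γ (genOps n i) ⟨1, y, 0⟩ D ∧
      D.vec.length = y.length ∧ GenRel x (s (ax .mm)) D s' ∧ s' (ax .ch) = sl (bitTape n) (3 * i) ∧
      EqOff [ax .g, ax .mm, realsTape, ax .ch, ax .t0, ax .t1, ax .t2] s s') ?_ ?_ ?_)))))
  · refine ⟨⟨1, y, 0⟩, rfl, rfl, ⟨?_, ?_, ?_, ?_, ?_⟩, ?_, ?_⟩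
    · simp [put, ho]
    · simp [put, hx]
    · simp [put]
    · simpa using hm
    · simp
    · simp [put, hn]
    · exact ((EqOff.refl _ _).put (by simp) _).update (by simp) _
  · rintro i _ s' ⟨D, h₁, h₂, h₃, h₄, h₅⟩ _
    refine .genStep hu h₃ (by rw [h₅ _ (by simp)]; exact ho) (by rw [h₅ _ (by simp)]; exact hb)
      ((congrFun (h₅ _ (by simp)) 0).trans hc) h₄ fun s'' D' g₁ g₂ g₃ g₄ g₅ =>
      ⟨D', ?_, g₂.trans h₂, g₃, by rw [g₄]; push_cast; rfl, h₅.trans g₅⟩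
    rw [genOps, List.range_succ, List.map_append, genRun_append]
    exact ⟨D, h₁, D', g₁, rfl⟩
  · rintro s' ⟨D, h₁, h₂, h₃, h₄, h₅⟩ -
    refine .cons (.forR hl (by rw [h₅ _ (by simp)]; exact hr)
      (by simp [Cmd.block, Cmd.Avoids, Basic.Avoids]) (fun i s'' => s'' =
        Function.update s' (ax .ch) (sl (bitTape n) (3 * l - 3 * i))) ?_ ?_ ?_)
    · simp [← h₄]
    · rintro i _ _ rfl _
      refine .cons (.shr (.cons (.shr (.cons (.shr (.nil ?_))))))
      simp only [Function.update_self, Function.update_idem, sl_sl]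
      congr 2; push_cast; ring
    · rintro _ rfl -
      -- The head of `mm` has advanced by `D.pos` cells, together with that of the reals, so
      -- rewinding it also counts the way back on the reals.
      refine .cons (.rewind h₃.ruler h₃.le (by have := h₃.le; omega)
        (by simpa using h₃.mark) (by simp [Cmd.Avoids, Basic.Avoids]) (fun i s'' =>
        s'' realsTape = sl (tapeOfList (x ++ D.vec)) (x.length + D.pos - i) ∧
        EqOff [ax .g, realsTape, ax .t0, ax .t1, ax .t2] s s'') ?_ ?_ ?_)
      · refine ⟨by simp [h₃.vec], ?_⟩
        refine EqOff.cons_left (d := ax .ch) (EqOff.cons_left (d := ax .mm)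
          (((h₅.mono ?_).update ?_ _).update ?_ _) ?_) ?_
        · simp
        all_goals simp [hn]
      · rintro i _ s₁ ⟨g₁, g₂⟩ _
        refine .shr ⟨?_, g₂.update (by simp) _⟩
        simp only [Function.update_self, g₁, sl_sl]
        congr 1; push_cast; ring
      · rintro s₁ ⟨g₁, g₂⟩ _
        refine .cons (.forR_shr hxL (by rw [g₂ _ (by simp)]; exact hp) (by simp)
          (.nil (hQ _ D h₁ h₂ ?_ (g₂.update (by simp) _))))
        simp [g₁]

/-! ### Approximation by generated vectors -/

/-- The positive numbers `a` and `b` differ by at most `n` roundings. -/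
def Near (u : ℝ) (n : ℕ) (a b : ℝ) : Prop :=
  0 < a ∧ 0 < b ∧ a * (1 - u) ^ n ≤ b ∧ b * (1 - u) ^ n ≤ a

section Near

variable {u a b a' b' : ℝ} {n n' : ℕ}

theorem Near.mono (hu : 0 < u) (hu1 : u < 1) (h : Near u n a b) (hn : n ≤ n') : Near u n' a b := by
  have := pow_le_pow_of_le_one (by linarith : 0 ≤ 1 - u) (by linarith) hn
  exact ⟨h.1, h.2.1, (mul_le_mul_of_nonneg_left this h.1.le).trans h.2.2.1,
    (mul_le_mul_of_nonneg_left this h.2.1.le).trans h.2.2.2⟩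

theorem Near.mul (hu1 : u < 1) (h : Near u n a b) (h' : Near u n' a' b') :
    Near u (n + n') (a * a') (b * b') := by
  have h1 : 0 < 1 - u := by linarith
  refine ⟨mul_pos h.1 h'.1, mul_pos h.2.1 h'.2.1, ?_, ?_⟩
  · rw [pow_add, mul_mul_mul_comm]
    exact mul_le_mul h.2.2.1 h'.2.2.1 (mul_pos h'.1 (pow_pos h1 _)).le h.2.1.le
  · rw [pow_add, mul_mul_mul_comm]
    exact mul_le_mul h.2.2.2 h'.2.2.2 (mul_pos h'.2.1 (pow_pos h1 _)).le h.1.le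

theorem Near.inv (h : Near u n a b) : Near u n a⁻¹ b⁻¹ := by
  obtain ⟨ha, hb, h₁, h₂⟩ := h
  refine ⟨inv_pos.2 ha, inv_pos.2 hb, ?_, ?_⟩
  · rw [inv_mul_le_iff₀ ha, ← div_eq_mul_inv, le_div_iff₀ hb, mul_comm]; exact h₂
  · rw [inv_mul_le_iff₀ hb, ← div_eq_mul_inv, le_div_iff₀ ha, mul_comm]; exact h₁

theorem Near.trans (hu1 : u < 1) {c : ℝ} (h : Near u n a b) (h' : Near u n' b c) :
    Near u (n + n') a c := by
  have h1 : 0 < 1 - u := by linarith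
  refine ⟨h.1, h'.2.1, ?_, ?_⟩
  · rw [pow_add, ← mul_assoc]
    exact (mul_le_mul_of_nonneg_right h.2.2.1 (pow_pos h1 _).le).trans h'.2.2.1
  · rw [pow_add, mul_comm ((1 - u) ^ n), ← mul_assoc]
    exact (mul_le_mul_of_nonneg_right h'.2.2.2 (pow_pos h1 _).le).trans h.2.2.2

theorem Near.refl (ha : 0 < a) : Near u 0 a a := ⟨ha, ha, by simp, by simp⟩

/-- The symmetric form holds because `(1 + u) * (1 - u) ≤ 1`. Symmetry lets errors pass through
inverses and products. -/
theorem Rounds.near (hu1 : u < 1) (ha : 0 < a) (h : Rounds u a b) : Near u 1 a b := by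
  have hb := (h.pos_iff hu1.le).2 ha
  have h₁ := h.le ha.le
  refine ⟨ha, hb, by simpa using h.ge ha.le, ?_⟩
  rw [pow_one]
  calc b * (1 - u) ≤ a * (1 + u) * (1 - u) := mul_le_mul_of_nonneg_right h₁ (by linarith)
    _ ≤ a := by nlinarith [mul_nonneg ha.le (sq_nonneg u)]

theorem Near.rounds (hu1 : u < 1) (h : Near u n a b) (hr : Rounds u b b') :
    Near u (n + 1) a b' :=
  h.trans hu1 (hr.near hu1 h.2.1)

end Near

variable {u γ : ℝ}

/-- Square and multiply, along the binary expansion of `e`. Squaring doubles the number of roundings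
and adds one, `2 * (2 * e - 1) + 1 = 4 * e - 1`, and a multiplication by `γ` adds one more. For `e =
0` the truncated subtraction rightly gives `0`. -/
theorem exists_genRun_pow (hu : 0 < u) (hu1 : u < 1) (hγ : 0 < γ) (b : ℕ) : ∀ e < 2 ^ b,
    ∃ w : List GenOp, w.length ≤ 2 * b ∧ ∀ D D', D.reg = 1 → GenRun u γ w D D' →
      ∃ g, Near u (2 * e - 1) (γ ^ e) g ∧ D' = { D with reg := g } := by
  induction b with
  | zero =>
    intro e he
    obtain rfl : e = 0 := by simpa using he
    refine ⟨[], by simp, fun D D' hD h => ⟨1, by simpa using Near.refl one_pos, ?_⟩⟩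
    rw [← hD]; exact h
  | succ b ih =>
    intro e he
    obtain ⟨w, hw, h⟩ := ih (e / 2) (by rw [pow_succ] at he; omega)
    rcases Nat.eq_zero_or_pos (e / 2) with h₀ | h₀
    · rcases (show e = 0 ∨ e = 1 by omega) with rfl | rfl
      · refine ⟨[], by simp, fun D D' hD h => ⟨1, by simpa using Near.refl one_pos, ?_⟩⟩
        rw [← hD]; exact h
      · refine ⟨[.mul], by simp; omega, ?_⟩
        rintro D D' hD ⟨_, ⟨g, hg, rfl⟩, rfl⟩
        rw [hD, one_mul] at hg
        exact ⟨g, by simpa using hg.near hu1 hγ, rfl⟩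
    · have hsq : ∀ D D', D.reg = 1 → GenRun u γ (w ++ [.sq]) D D' →
          ∃ g, Near u (4 * (e / 2) - 1) (γ ^ (2 * (e / 2))) g ∧ D' = { D with reg := g } := by
        intro D D' hD hr
        obtain ⟨D₁, h₁, _, ⟨g', hg', rfl⟩, rfl⟩ := genRun_append.1 hr
        obtain ⟨g, hg, rfl⟩ := h D D₁ hD h₁
        refine ⟨g', ?_, rfl⟩
        have := ((hg.mul hu1 hg).rounds hu1 hg').mono hu hu1 (n' := 4 * (e / 2) - 1) (by omega)
        rwa [← pow_add, ← two_mul] at this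
      rcases Nat.even_or_odd' e with ⟨k, rfl | rfl⟩
      · refine ⟨w ++ [.sq], by simp; omega, fun D D' hD hr => ?_⟩
        obtain ⟨g, hg, hD'⟩ := hsq D D' hD hr
        rw [Nat.mul_div_cancel_left k two_pos] at hg
        exact ⟨g, hg.mono hu hu1 (by omega), hD'⟩
      · refine ⟨(w ++ [.sq]) ++ [.mul], by simp; omega, fun D D' hD hr => ?_⟩
        obtain ⟨D₁, h₁, _, ⟨g', hg', rfl⟩, rfl⟩ := genRun_append.1 hr
        obtain ⟨g, hg, rfl⟩ := hsq D D₁ hD h₁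
        rw [show (2 * k + 1) / 2 = k by omega] at hg h₀
        refine ⟨g', ?_, rfl⟩
        have := ((hg.mul hu1 (Near.refl hγ)).rounds hu1 hg').mono hu hu1
          (n' := 2 * (2 * k + 1) - 1) (by omega)
        rwa [← pow_succ] at this

/-- The factor `γ` is the gap between consecutive powers, and `(1 - u) ^ n ≥ 1 - ε / 8`, by
Bernoulli, stands for the accumulated roundings; together they cost less than `ε`. -/
theorem rounds_of_near {ε z v : ℝ} {n : ℕ} (hu : 0 < u) (hu1 : u < 1) (hε : 0 < ε) (hε1 : ε ≤ 1)
    (hγ : γ ≤ 1 + ε / 2) (hn : n * u ≤ ε / 8) (hz : 0 < z) (hv : 0 < v)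
    (h₁ : z * (1 - u) ^ n ≤ γ * v) (h₂ : v * (1 - u) ^ n ≤ γ * z) : Rounds ε z v := by
  have h₃ : 1 - ε / 8 ≤ (1 - u) ^ n := by
    have := one_add_mul_le_pow (a := -u) (by linarith) n
    rw [← sub_eq_add_neg] at this
    linarith
  have h₄ : z * (1 - ε / 8) ≤ (1 + ε / 2) * v :=
    (mul_le_mul_of_nonneg_left h₃ hz.le).trans (h₁.trans (mul_le_mul_of_nonneg_right hγ hv.le))
  have h₅ : v * (1 - ε / 8) ≤ (1 + ε / 2) * z :=
    (mul_le_mul_of_nonneg_left h₃ hv.le).trans (h₂.trans (mul_le_mul_of_nonneg_right hγ hz.le))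
  refine ⟨v / z - 1, ?_, by field_simp; ring⟩
  rw [abs_lt, lt_sub_iff_add_lt, sub_lt_iff_lt_add, lt_div_iff₀ hz, div_lt_iff₀ hz]
  constructor
  · have : (1 + ε / 2) * ((-ε + 1) * z) < (1 + ε / 2) * v := by
      refine lt_of_lt_of_le ?_ h₄
      nlinarith [mul_pos hz hε, mul_pos hz (mul_pos hε hε)]
    exact lt_of_mul_lt_mul_left this (by linarith)
  · have : (1 - ε / 8) * v < (1 - ε / 8) * ((ε + 1) * z) := by
      rw [mul_comm _ v]
      refine lt_of_le_of_lt h₅ ?_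
      nlinarith [mul_pos hz hε, mul_nonneg (mul_pos hz hε).le (sub_nonneg.2 hε1)]
    exact lt_of_mul_lt_mul_left this (by linarith)

theorem Rounds.neg {ε z v : ℝ} (h : Rounds ε z v) : Rounds ε (-z) (-v) := by
  obtain ⟨δ, hδ, rfl⟩ := h
  exact ⟨δ, hδ, by ring⟩

section Approximation

variable {ε : ℝ} {K M b : ℕ}

/-- Every number of moderate size is approximated by some number that can be generated quickly. -/
theorem exists_genRun_push (hu : 0 < u) (hu1 : u < 1) (hε : 0 < ε) (hε1 : ε ≤ 1) (hγ1 : 1 < γ)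
    (hγ : γ ≤ 1 + ε / 2) (hK : 2 ≤ γ ^ K) (hb : K * (M + 1) ≤ 2 ^ b)
    (hn : (2 * 2 ^ b + 2 : ℕ) * u ≤ ε / 8) (z : ℝ)
    (hz : z = 0 ∨ ((2 : ℝ) ^ M)⁻¹ ≤ |z| ∧ |z| ≤ 2 ^ M) :
    ∃ w : List GenOp, w.length ≤ 2 * b + 3 ∧ ∀ D D', D.reg = 1 → D.pos < D.vec.length →
      GenRun u γ w D D' → ∃ v, Rounds ε z v ∧ D' = ⟨1, D.vec.set D.pos v, D.pos + 1⟩ := by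
  rcases hz with rfl | ⟨hz₁, hz₂⟩
  · refine ⟨[.zero, .push], by simp, ?_⟩
    rintro D D' hD hp ⟨_, rfl, _, h, rfl⟩
    exact ⟨0, .refl hε 0, by simpa [GenOp.Step, hp] using h⟩
  have hz0 : 0 < |z| := lt_of_lt_of_le (by positivity) hz₁
  have hlog : ∀ a : ℝ, 1 ≤ a → a ≤ 2 ^ M → ∃ e < 2 ^ b, γ ^ e ≤ a ∧ a < γ ^ (e + 1) := by
    intro a ha ha'
    obtain ⟨e, he, he'⟩ := exists_nat_pow_near ha hγ1
    refine ⟨e, lt_of_not_ge fun h => ?_, he, he'⟩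
    -- Exponents from `2 ^ b ≥ K * (M + 1)` on are too large, as `γ ^ K ≥ 2`.
    have h₁ : (2 : ℝ) ^ (M + 1) ≤ γ ^ e := by
      calc (2 : ℝ) ^ (M + 1) ≤ (γ ^ K) ^ (M + 1) := pow_le_pow_left₀ (by norm_num) hK _
        _ = γ ^ (K * (M + 1)) := by rw [← pow_mul]
        _ ≤ γ ^ e := pow_le_pow_right₀ hγ1.le (hb.trans h)
    have h₂ : (2 : ℝ) ^ M < 2 ^ (M + 1) := pow_lt_pow_right₀ (by norm_num) (by omega)
    linarith
  have habs : ∃ w : List GenOp, w.length ≤ 2 * b + 1 ∧ ∀ D D', D.reg = 1 → GenRun u γ w D D' →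
      ∃ e < 2 ^ b, ∃ g, |z| * (1 - u) ^ (2 * e + 1) ≤ γ * g ∧ g * (1 - u) ^ (2 * e + 1) ≤ γ * |z| ∧
        0 < g ∧ D' = { D with reg := g } := by
    have hγ0 : 0 < γ := by linarith
    have h1u : ∀ n : ℕ, 0 ≤ (1 - u) ^ n := fun n => pow_nonneg (by linarith) n
    -- Powers of `γ > 1` reach numbers `≥ 1` only; for smaller ones the reciprocal is generated and
    -- inverted at the end.
    rcases le_total 1 |z| with h1 | h1
    · obtain ⟨e, he, h₁, h₂⟩ := hlog _ h1 hz₂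
      obtain ⟨w, hw, h⟩ := exists_genRun_pow hu hu1 hγ0 b e he
      refine ⟨w, by omega, fun D D' hD hr => ?_⟩
      obtain ⟨g, hg, rfl⟩ := h D D' hD hr
      obtain ⟨g₁, g₂, g₃, g₄⟩ := hg.mono hu hu1 (n' := 2 * e + 1) (by omega)
      refine ⟨e, he, g, ?_, ?_, g₂, rfl⟩
      · rw [pow_succ'] at h₂
        refine (mul_le_mul_of_nonneg_right h₂.le (h1u _)).trans ?_
        rw [mul_assoc]
        exact mul_le_mul_of_nonneg_left g₃ hγ0.le
      · refine (g₄.trans h₁).trans ?_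
        exact le_mul_of_one_le_left hz0.le hγ1.le
    · have h1' : 1 ≤ |z|⁻¹ := (one_le_inv₀ hz0).2 h1
      obtain ⟨e, he, h₁, h₂⟩ := hlog _ h1' (inv_le_of_inv_le₀ (by positivity) hz₁)
      obtain ⟨w, hw, h⟩ := exists_genRun_pow hu hu1 hγ0 b e he
      refine ⟨w ++ [.inv], by simp; omega, fun D D' hD hr => ?_⟩
      obtain ⟨D₁, hr₁, _, ⟨g', hg', rfl⟩, rfl⟩ := genRun_append.1 hr
      obtain ⟨g, hg, rfl⟩ := h D D₁ hD hr₁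
      rw [one_div] at hg'
      obtain ⟨g₁, g₂, g₃, g₄⟩ := (hg.inv.rounds hu1 hg').mono hu hu1 (n' := 2 * e + 1) (by omega)
      refine ⟨e, he, g', ?_, ?_, g₂, rfl⟩
      · have h₃ : |z| ≤ (γ ^ e)⁻¹ := (le_inv_comm₀ (by positivity) hz0).1 h₁
        refine (mul_le_mul_of_nonneg_right h₃ (h1u _)).trans (g₃.trans ?_)
        exact le_mul_of_one_le_left g₂.le hγ1.le
      · refine g₄.trans ?_
        rw [inv_le_iff_one_le_mul₀ (by positivity), mul_right_comm, ← pow_succ']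
        rw [inv_lt_iff_one_lt_mul₀ hz0] at h₂
        linarith
  obtain ⟨w, hw, h⟩ := habs
  have hround : ∀ e : ℕ, e < 2 ^ b → ∀ n : ℕ, n ≤ 2 * e + 2 → n * u ≤ ε / 8 := by
    intro e he n hne
    refine le_trans (mul_le_mul_of_nonneg_right ?_ hu.le) hn
    exact_mod_cast (show n ≤ 2 * 2 ^ b + 2 by omega)
  rcases lt_or_gt_of_ne (abs_pos.1 hz0) with hneg | hpos
  · refine ⟨w ++ [.neg, .push], by simp; omega, fun D D' hD hp hr => ?_⟩
    obtain ⟨D₁, hr₁, D₂, ⟨g', hg', rfl⟩, D₃, h₃, rfl⟩ := genRun_append.1 hr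
    obtain ⟨e, he, g, h₁, h₂, hg, rfl⟩ := h D D₁ hD hr₁
    have hg'' : Rounds u g (-g') := by simpa using hg'.neg
    obtain ⟨g₁, g₂, g₃, g₄⟩ := hg''.near hu1 hg
    rw [abs_of_neg hneg] at h₁ h₂
    rw [pow_one] at g₃ g₄
    refine ⟨g', ?_, by simpa [GenOp.Step, hp] using h₃⟩
    have h1u : 0 ≤ 1 - u := by linarith
    have h1u' : 0 ≤ (1 - u) ^ (2 * e + 1) := pow_nonneg h1u _
    have := rounds_of_near hu hu1 hε hε1 hγ (hround e he _ le_rfl) (neg_pos.2 hneg) g₂ ?_ ?_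
    · simpa using this.neg
    · rw [pow_succ, ← mul_assoc]
      refine (mul_le_mul_of_nonneg_right h₁ h1u).trans ?_
      rw [mul_assoc]
      exact mul_le_mul_of_nonneg_left g₃ (by linarith)
    · rw [pow_succ, mul_comm ((1 - u) ^ _), ← mul_assoc]
      exact (mul_le_mul_of_nonneg_right g₄ h1u').trans h₂
  · refine ⟨w ++ [.push], by simp; omega, fun D D' hD hp hr => ?_⟩
    obtain ⟨D₁, hr₁, D₃, h₃, rfl⟩ := genRun_append.1 hr
    obtain ⟨e, he, g, h₁, h₂, hg, rfl⟩ := h D D₁ hD hr₁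
    rw [abs_of_pos hpos] at h₁ h₂
    exact ⟨g, rounds_of_near hu hu1 hε hε1 hγ (hround e he _ (by omega)) hpos hg h₁ h₂,
      by simpa [GenOp.Step, hp] using h₃⟩

theorem exists_genRun_vec (hu : 0 < u) (hu1 : u < 1) (hε : 0 < ε) (hε1 : ε ≤ 1) (hγ1 : 1 < γ)
    (hγ : γ ≤ 1 + ε / 2) (hK : 2 ≤ γ ^ K) (hb : K * (M + 1) ≤ 2 ^ b)
    (hn : (2 * 2 ^ b + 2 : ℕ) * u ≤ ε / 8) (y : List ℝ)
    (hy : ∀ z ∈ y, z = 0 ∨ ((2 : ℝ) ^ M)⁻¹ ≤ |z| ∧ |z| ≤ 2 ^ M) :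
    ∃ w : List GenOp, w.length ≤ y.length * (2 * b + 3) ∧ ∀ D D', D.reg = 1 →
      D.pos + y.length = D.vec.length → GenRun u γ w D D' →
      ∃ y', List.Forall₂ (Rounds ε) y y' ∧ D'.vec = D.vec.take D.pos ++ y' ∧
        D'.vec.length ≤ D'.pos := by
  induction y with
  | nil =>
    refine ⟨[], by simp, ?_⟩
    rintro D _ hD hp rfl
    rw [List.length_nil, add_zero] at hp
    exact ⟨[], .nil, by simp [hp], hp.ge⟩
  | cons z y ih =>
    obtain ⟨w, hw, h⟩ := ih fun z' hz' => hy z' (List.mem_cons_of_mem _ hz')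
    obtain ⟨w', hw', h'⟩ := exists_genRun_push hu hu1 hε hε1 hγ1 hγ hK hb hn z
      (hy z List.mem_cons_self)
    refine ⟨w' ++ w, by rw [List.length_append, List.length_cons, add_mul, one_mul]; omega,
      fun D D' hD hp hr => ?_⟩
    rw [List.length_cons] at hp
    obtain ⟨D₁, hr₁, hr₂⟩ := genRun_append.1 hr
    obtain ⟨v, hv, rfl⟩ := h' D D₁ hD (by omega) hr₁
    obtain ⟨y', h₁, h₂, h₃⟩ := h _ D' rfl (by simp; omega) hr₂
    refine ⟨v :: y', .cons hv h₁, ?_, h₃⟩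
    rw [h₂]
    dsimp only
    rw [List.take_add_one, List.getElem?_set_self (by omega), List.take_set_of_le le_rfl]
    simp

end Approximation

/-- The program always reads a fixed number of operations; those that follow a complete vector
cannot spoil it. -/
theorem GenRun.vec_eq {l : List GenOp} {D D' : GenState} (h : GenRun u γ l D D')
    (hD : D.vec.length ≤ D.pos) : D'.vec = D.vec := by
  induction l generalizing D with
  | nil => exact congrArg GenState.vec h
  | cons o l ih =>
    obtain ⟨D₁, h₁, h₂⟩ := h
    have : D₁.vec = D.vec ∧ D₁.pos = D.pos := by
      cases o <;> simp only [GenOp.Step] at h₁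
      case push => rw [if_neg (by omega)] at h₁; subst h₁; exact ⟨rfl, rfl⟩
      all_goals (obtain ⟨_, _, rfl⟩ := h₁; exact ⟨rfl, rfl⟩)
    rw [ih h₂ (by rw [this.1, this.2]; exact hD), this.1]

/-- A number whose first three bits encode the operation. -/
def GenOp.code : GenOp → ℕ
  | .nop => 0
  | .sq => 1
  | .mul => 2
  | .neg => 3
  | .inv => 4
  | .zero => 5
  | .push => 6

theorem genOp_code (o : GenOp) (n : ℕ) : genOp (2 ^ 3 * n + o.code) 0 = o := by
  have h : o.code < 2 ^ 3 := by cases o <;> decide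
  simp only [genOp, Nat.testBit_two_pow_mul_add n h]
  cases o <;> rfl

theorem genOp_code_succ (o : GenOp) (n i : ℕ) :
    genOp (2 ^ 3 * n + o.code) (i + 1) = genOp n i := by
  have h : o.code < 2 ^ 3 := by cases o <;> decide
  simp only [genOp, Nat.testBit_two_pow_mul_add n h]
  rw [if_neg (by omega), if_neg (by omega), if_neg (by omega)]
  congr 2

theorem exists_genOps (w : List GenOp) : ∃ n < 2 ^ (3 * w.length), ∀ l, w.length ≤ l →
    ∃ w', genOps n l = w ++ w' := by
  induction w with
  | nil => exact ⟨0, by simp, fun l _ => ⟨_, rfl⟩⟩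
  | cons o w ih =>
    obtain ⟨n, hn, h⟩ := ih
    have ho : o.code < 2 ^ 3 := by cases o <;> decide
    refine ⟨2 ^ 3 * n + o.code, ?_, fun l hl => ?_⟩
    · rw [List.length_cons, mul_add, pow_add, mul_comm]
      omega
    · obtain ⟨l, rfl⟩ : ∃ l', l = l' + 1 := ⟨l - 1, by simp at hl; omega⟩
      obtain ⟨w', hw'⟩ := h l (by simpa using hl)
      refine ⟨w', ?_⟩
      rw [List.cons_append, ← hw', genOps, List.range_succ_eq_map, List.map_cons, genOp_code,
        List.map_map]
      congr 1
      exact List.map_congr_left fun i _ => genOp_code_succ o n i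

/-- The number `l` has two roles: it is the number of operations read, and it bounds the length of
the codes in bits. The factor `3` in `hl` serves the second. The old vector `y₀` does not matter,
because all its entries are overwritten. -/
theorem exists_code {ε : ℝ} {K M b l : ℕ} (hu : 0 < u) (hu1 : u < 1) (hε : 0 < ε) (hε1 : ε ≤ 1)
    (hγ1 : 1 < γ) (hγ : γ ≤ 1 + ε / 2) (hK : 2 ≤ γ ^ K) (hb : K * (M + 1) ≤ 2 ^ b)
    (hn : (2 * 2 ^ b + 2 : ℕ) * u ≤ ε / 8) (y : List ℝ)
    (hy : ∀ z ∈ y, z = 0 ∨ ((2 : ℝ) ^ M)⁻¹ ≤ |z| ∧ |z| ≤ 2 ^ M)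
    (hl : 3 * (y.length * (2 * b + 3)) ≤ l) :
    ∃ n < 2 ^ l, ∀ (y₀ : List ℝ) (D : GenState), y₀.length = y.length →
      GenRun u γ (genOps n l) ⟨1, y₀, 0⟩ D → List.Forall₂ (Rounds ε) y D.vec := by
  obtain ⟨w, hw, h⟩ := exists_genRun_vec hu hu1 hε hε1 hγ1 hγ hK hb hn y hy
  obtain ⟨n, hn, h'⟩ := exists_genOps w
  refine ⟨n, hn.trans_le (Nat.pow_le_pow_right (by norm_num) (by omega)), fun y₀ D hy₀ hr => ?_⟩
  obtain ⟨w', hw'⟩ := h' l (by omega)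
  rw [hw', genRun_append] at hr
  obtain ⟨D₁, h₁, h₂⟩ := hr
  obtain ⟨y', h₃, h₄, h₅⟩ := h _ D₁ rfl (by simp [hy₀]) h₁
  rw [h₂.vec_eq h₅, h₄]
  simpa using h₃

/-! ### Simulation of a machine with a larger unit roundoff -/

/-- `f` is an infinite run of the machine, from the configuration `c`. -/
def Machine.IsRun (M : Machine) (v : ℝ) (c : M.Config) (f : ℕ → M.Config) : Prop :=
  f 0 = c ∧ ∀ t, M.Step v (f t) (f (t + 1))

theorem Machine.exists_isRun (M : Machine) {v : ℝ} (hv : 0 < v) (c : M.Config) :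
    ∃ f, M.IsRun v c f := by
  choose g hg using fun c => Machine.exists_step M hv c
  exact ⟨fun i => g^[i] c, rfl, fun t => by
    beta_reduce; rw [Function.iterate_succ_apply']; exact hg _⟩

/-- A simulation reveals the run step by step, while runs are infinite; so the current run is always
continued arbitrarily and corrected at the next step. -/
theorem Machine.IsRun.exists_extend {M : Machine} {v : ℝ} (hv : 0 < v) {c₀ : M.Config}
    {f : ℕ → M.Config} (hf : M.IsRun v c₀ f) (j : ℕ) {c : M.Config} (hc : M.Step v (f j) c) :
    ∃ f', M.IsRun v c₀ f' ∧ (∀ i ≤ j, f' i = f i) ∧ f' (j + 1) = c := by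
  obtain ⟨g, hg0, hg⟩ := M.exists_isRun hv c
  let f' : ℕ → M.Config := fun i => if i ≤ j then f i else g (i - (j + 1))
  have h₁ : ∀ i ≤ j, f' i = f i := fun i hi => if_pos hi
  have h₂ : ∀ i, f' (j + 1 + i) = g i := fun i => by
    simp only [f']; rw [if_neg (by omega), Nat.add_sub_cancel_left]
  refine ⟨f', ⟨by rw [h₁ 0 (Nat.zero_le _)]; exact hf.1, fun t => ?_⟩, h₁, (h₂ 0).trans hg0⟩
  rcases lt_trichotomy t j with h | rfl | h
  · rw [h₁ t h.le, h₁ (t + 1) h]; exact hf.2 t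
  · rw [h₁ t le_rfl, show t + 1 = t + 1 + 0 by omega, h₂, hg0]; exact hc
  · obtain ⟨i, rfl⟩ : ∃ i, t = j + 1 + i := ⟨t - (j + 1), by omega⟩
    rw [h₂, add_assoc, h₂]
    exact hg i

/-- The tapes needed for the simulation of a machine. -/
abbrev Machine.Tp (M : Machine) : Type :=
  RoundoffComplexity.Tp (M.extraTapes + 3) (M.extraNodes + 1)

variable {M : Machine}

/-- Execute a node of a machine, and raise the flag of the next one. -/
noncomputable def Node.cmd : Node (M.extraTapes + 3) (M.extraNodes + 1) → Cmd M.Tp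
  | .const r d next => .block [.basic (.const r (tg d)), .basic (.const (-1) (fl next))]
  | .arith op a b d next =>
      .block [.basic (.arith op (tg a) (tg b) (tg d)), .basic (.const (-1) (fl next))]
  | .copy a d next => .block [.basic (.copy (tg a) (tg d)), .basic (.const (-1) (fl next))]
  | .readUnit d next => .block [.basic (.copy (ax .us) (tg d)), .basic (.const (-1) (fl next))]
  | .shiftLeft d next => .block [.basic (.shl (tg d)), .basic (.const (-1) (fl next))]
  | .shiftRight d next => .block [.basic (.shr (tg d)), .basic (.const (-1) (fl next))]
  | .branch a yes no =>
      .block [.ite (tg a) (.basic (.const (-1) (fl yes))) (.basic (.const (-1) (fl no)))]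
  | .halt true => .block [.basic (.const (-1) (ax .yv))]
  | .halt false => .block [.basic (.const 0 (ax .yv))]

/-- Execute the node whose flag is raised. -/
noncomputable def Machine.dispatch (M : Machine) : List (Fin (M.extraNodes + 1)) → Cmd M.Tp
  | [] => .skip
  | i :: l => .ite (fl i) (M.dispatch l)
      (.seq (.basic (.const 0 (fl i))) (Node.cmd (M.prog i)))

/-- The tapes agree near the heads. -/
def Agrees (r : ℤ) (c : M.Config) (s : State M.Tp) : Prop :=
  ∀ d i, -r ≤ i → i ≤ r → s (tg d) i = c.tape d i

/-- No flag is raised, or exactly one. -/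
def Flags (o : Option (Fin (M.extraNodes + 1))) (s : State M.Tp) : Prop :=
  ∀ i, s (fl i) 0 < 0 ↔ o = some i

/-- The tapes that are changed by a simulation. -/
def Machine.simTapes (M : Machine) : List M.Tp :=
  ax .yv :: ((List.finRange _).map tg ++ (List.finRange _).map fl)

variable {u v : ℝ} {L : ℕ} {s : State M.Tp} {Q : State M.Tp → Prop} {r : ℤ} {c : M.Config}

theorem Agrees.put (h : Agrees r c s) (d : Fin (M.extraTapes + 3)) (w : ℝ)
    {n : Fin (M.extraNodes + 1)} : Agrees r ⟨n, writeTape c.tape d w⟩ (put s (tg d) w) := by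
  intro e i h₁ h₂
  by_cases he : e = d
  · subst he
    by_cases hi : i = 0
    · subst hi; simp [RoundoffComplexity.put, writeTape]
    · simp [RoundoffComplexity.put, writeTape, hi, h e i h₁ h₂]
  · simp [RoundoffComplexity.put, writeTape, he, h e i h₁ h₂]

theorem Agrees.mono {r' : ℤ} (h : Agrees r c s) (hr : r' ≤ r) : Agrees r' c s :=
  fun d i h₁ h₂ => h d i (by omega) (by omega)

theorem Agrees.shift (h : Agrees (r + 1) c s) (d : Fin (M.extraTapes + 3)) {j : ℤ} (hj : |j| ≤ 1)
    {n : Fin (M.extraNodes + 1)} : Agrees r ⟨n, Function.update c.tape d fun i => c.tape d (i + j)⟩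
      (Function.update s (tg d) (sl (s (tg d)) j)) := by
  rw [abs_le] at hj
  intro e i h₁ h₂
  by_cases he : e = d
  · subst he
    simp only [Function.update_self, sl_apply]
    exact h e _ (by omega) (by omega)
  · simp [he, h e i (by omega) (by omega)]

theorem Agrees.congr (h : Agrees r c s) {s' : State M.Tp} {n : Fin (M.extraNodes + 1)}
    (hs : ∀ d, s' (tg d) = s (tg d)) : Agrees r ⟨n, c.tape⟩ s' := fun d i h₁ h₂ => by
  rw [hs]; exact h d i h₁ h₂

theorem Ends.raise (hu1 : u < 1) {n : Fin (M.extraNodes + 1)} (hs : Flags none s)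
    (hQ : ∀ s', Flags (some n) s' → EqOff [fl n] s s' → Q s') :
    Ends u L (.basic (.const (-1) (fl n))) s Q := by
  refine .const fun w hw => hQ _ (fun i => ?_) ((EqOff.refl _ _).put (by simp) _)
  by_cases hi : i = n
  · subst hi; simpa using (hw.neg_iff hu1.le).2 (by norm_num)
  · rw [put_of_ne _ _ (by simp [hi])]
    have := hs i
    simp only [reduceCtorEq, iff_false] at this
    simp [this, Ne.symm hi]

/-- What one step of a simulation does. -/
def SimStep (v : ℝ) (r : ℤ) (c : M.Config) (s s' : State M.Tp) : Prop :=
  EqOff M.simTapes s s' ∧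
    ((∃ c', M.Step v c c' ∧ (∀ b, M.prog c.node ≠ .halt b) ∧ Agrees r c' s' ∧
      Flags (some c'.node) s' ∧ s' (ax .yv) = s (ax .yv)) ∨
    ∃ b, M.prog c.node = .halt b ∧ (s' (ax .yv) 0 < 0 ↔ b = true) ∧ Flags none s')

theorem tg_mem_simTapes (d : Fin (M.extraTapes + 3)) : tg d ∈ M.simTapes := by
  simp [Machine.simTapes]

theorem fl_mem_simTapes (i : Fin (M.extraNodes + 1)) : fl i ∈ M.simTapes := by
  simp [Machine.simTapes]

/-- The same instruction is executed on real data: a rounding with `u` is one with `v`, so no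
simulation error arises. The window of agreement shrinks by one because a shift may bring in an
unknown cell. -/
theorem Ends.node_cmd (hu1 : u < 1) (huv : u ≤ v) (hr : 0 ≤ r) (hc : Agrees (r + 1) c s)
    (hf : Flags none s) (hus : s (ax .us) 0 = v) :
    Ends u L (Node.cmd (M.prog c.node)) s (SimStep v r c s) := by
  have hfin : ∀ {s₁ : State M.Tp} {c' : M.Config}, EqOff M.simTapes s s₁ → M.Step v c c' →
      (∀ b, M.prog c.node ≠ .halt b) → Agrees r c' s₁ → Flags none s₁ →
      s₁ (ax .yv) = s (ax .yv) →
      Ends u L (.basic (.const (-1) (fl c'.node))) s₁ (SimStep v r c s) := by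
    intro s₁ c' h₁ h₂ h₃ h₄ h₅ h₆
    refine .raise hu1 h₅ fun s' h₇ h₈ => ⟨h₁.trans (h₈.mono ?_), Or.inl ⟨c', h₂, h₃,
      h₄.congr fun d => h₈ _ (by simp), h₇, ?_⟩⟩
    · simpa using fl_mem_simTapes c'.node
    · rw [h₈ _ (by simp), h₆]
  have hfin' : ∀ {s₁ : State M.Tp} {c' : M.Config}, EqOff M.simTapes s s₁ → M.Step v c c' →
      (∀ b, M.prog c.node ≠ .halt b) → Agrees r c' s₁ → Flags none s₁ →
      s₁ (ax .yv) = s (ax .yv) →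
      Ends u L (.block [.basic (.const (-1) (fl c'.node))]) s₁ (SimStep v r c s) :=
    fun h₁ h₂ h₃ h₄ h₅ h₆ => .cons ((hfin h₁ h₂ h₃ h₄ h₅ h₆).imp fun _ h => .nil h)
  have hflag : ∀ {d} {g : ℤ → ℝ}, Flags none (Function.update s (tg d) g) := by
    intro d g i
    rw [Function.update_of_ne (by simp)]
    exact hf i
  have hz : ∀ d, s (tg d) 0 = c.tape d 0 := fun d => hc d 0 (by omega) (by omega)
  have hc' : Agrees r c s := hc.mono (by omega)
  have hput : ∀ d w, EqOff M.simTapes s (put s (tg d) w) := fun d w =>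
    (EqOff.refl _ _).put (tg_mem_simTapes d) w
  have hupd : ∀ d w, EqOff M.simTapes s (Function.update s (tg d) w) := fun d w =>
    (EqOff.refl _ _).update (tg_mem_simTapes d) w
  have hyv : ∀ {w}, EqOff M.simTapes s (put s (ax .yv) w) := fun {w} =>
    (EqOff.refl _ _).put (by simp [Machine.simTapes]) w
  have hyf : ∀ {w}, Flags none (put s (ax .yv) w) := fun {w} i => by
    rw [put_of_ne _ _ (by simp)]; exact hf i
  cases hp : M.prog c.node with
  | const q d next =>
    refine .cons (.const fun w hw => hfin' (hput d w) (c' := ⟨next, writeTape c.tape d w⟩) ?_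
      (by simp [hp]) (hc'.put d w) hflag (by simp))
    simp only [Machine.Step, hp]
    exact ⟨w, hw.mono huv, rfl⟩
  | arith op a b d next =>
    refine .cons (.arith fun w hw => hfin' (hput d w) (c' := ⟨next, writeTape c.tape d w⟩) ?_
      (by simp [hp]) (hc'.put d w) hflag (by simp))
    rw [hz, hz] at hw
    simp only [Machine.Step, hp]
    exact ⟨w, hw.mono huv, rfl⟩
  | copy a d next =>
    refine .cons (.copy (hfin' (hput d _) (c' := ⟨next, writeTape c.tape d (s (tg a) 0)⟩) ?_
      (by simp [hp]) (hc'.put d _) hflag (by simp)))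
    simp only [Machine.Step, hp, hz]
  | readUnit d next =>
    refine .cons (.copy (hfin' (hput d _) (c' := ⟨next, writeTape c.tape d (s (ax .us) 0)⟩) ?_
      (by simp [hp]) (hc'.put d _) hflag (by simp)))
    simp only [Machine.Step, hp, hus]
  | shiftLeft d next =>
    refine .cons (.shl (hfin' (hupd d _) (c' := ⟨next, _⟩) ?_ (by simp [hp])
      (hc.shift d (by simp)) hflag (by simp)))
    simp only [Machine.Step, hp]
  | shiftRight d next =>
    refine .cons (.shr (hfin' (hupd d _) (c' := ⟨next, _⟩) ?_ (by simp [hp])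
      (hc.shift d (by simp)) hflag (by simp)))
    simp only [Machine.Step, hp, sub_eq_add_neg]
  | branch a yes no =>
    refine .cons (.ite (fun h => ?_) fun h => ?_) <;> rw [hz] at h
    · refine (hfin (.refl _ _) (c' := ⟨yes, c.tape⟩) ?_ (by simp [hp]) (hc'.congr fun _ => rfl) hf
        rfl).imp fun _ h => .nil h
      simp only [Machine.Step, hp]
      exact ⟨fun _ => trivial, fun h' => absurd h (not_le.2 h')⟩
    · refine (hfin (.refl _ _) (c' := ⟨no, c.tape⟩) ?_ (by simp [hp]) (hc'.congr fun _ => rfl) hf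
        rfl).imp fun _ h => .nil h
      simp only [Machine.Step, hp]
      exact ⟨fun h' => absurd h (not_lt.2 h'), fun _ => trivial⟩
  | halt b =>
    cases b
    · refine .cons (.const fun w hw => .nil ⟨hyv, Or.inr ⟨_, hp, ?_, hyf⟩⟩)
      simp [hw.zero]
    · refine .cons (.const fun w hw => .nil ⟨hyv, Or.inr ⟨_, hp, ?_, hyf⟩⟩)
      simpa using (hw.neg_iff hu1.le).2 (by norm_num)

theorem Ends.dispatch_none {l : List (Fin (M.extraNodes + 1))} (hf : Flags none s) (hQ : Q s) :
    Ends u L (M.dispatch l) s Q := by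
  induction l with
  | nil => exact .skip hQ
  | cons i l ih =>
    refine .ite (fun _ => ih) fun h => ?_
    have := (hf i).1 h
    simp at this

theorem Ends.dispatch (hu1 : u < 1) (huv : u ≤ v) (hr : 0 ≤ r) (hc : Agrees (r + 1) c s)
    (hf : Flags (some c.node) s) (hus : s (ax .us) 0 = v) {l : List (Fin (M.extraNodes + 1))}
    (hl : c.node ∈ l) : Ends u L (M.dispatch l) s (SimStep v r c s) := by
  induction l with
  | nil => simp at hl
  | cons i l ih =>
    refine .ite (fun h => ih ?_) fun h => ?_
    · refine (List.mem_cons.1 hl).resolve_left ?_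
      rintro rfl
      exact absurd ((hf _).2 rfl) (not_lt.2 h)
    · obtain rfl : c.node = i := by simpa using (hf i).1 h
      refine .seq (.const fun w hw => ?_)
      rw [hw.zero]
      have he : EqOff [fl c.node] s (put s (fl c.node) 0) := (EqOff.refl _ _).put (by simp) _
      refine (node_cmd hu1 huv hr (s := put s (fl c.node) 0) (c := c)
        (hc.congr fun d => he _ (by simp)) (fun i => ?_) (by rw [he _ (by simp), hus])).imp ?_
      · by_cases hi : i = c.node
        · subst hi; simp
        · rw [he _ (by simp [hi]), hf]
          simp [Ne.symm hi]
      · rintro s' ⟨h₁, h₂⟩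
        refine ⟨(he.mono (by simpa using fl_mem_simTapes _)).trans h₁, h₂.imp ?_ id⟩
        rintro ⟨c', g₁, g₂, g₃, g₄, g₅⟩
        exact ⟨c', g₁, g₂, g₃, g₄, by rw [g₅, he _ (by simp)]⟩

/-- Simulate a machine, for a number of steps given by a ruler. -/
noncomputable def Machine.run (M : Machine) : Cmd M.Tp :=
  .forR (ax .ra') (M.dispatch (List.finRange _))

theorem Machine.dispatch_avoids (l : List (Fin (M.extraNodes + 1))) :
    (M.dispatch l).Avoids (ax .ra') := by
  induction l with
  | nil => trivial
  | cons i l ih =>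
    refine ⟨by simp, ih, by simp [Cmd.Avoids, Basic.Avoids], ?_⟩
    rcases M.prog i with _ | _ | _ | _ | _ | _ | _ | (_ | _) <;>
      simp [Node.cmd, Cmd.block, Cmd.Avoids, Basic.Avoids]

/-- A window of radius `n` lasts for `n` steps. Once the machine has halted no flag is raised, and
the remaining rounds do nothing; a run that is cut off leaves `yv` as it was. -/
theorem Ends.run {n : ℕ} (hu : 0 < u) (hu1 : u < 1) (huv : u ≤ v) (hn : n ≤ L)
    (hR : Ruler n (s (ax .ra'))) (hc : Agrees n c s)
    (hf : Flags (some c.node) s) (hus : s (ax .us) 0 = v)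
    (hQ : ∀ s', EqOff M.simTapes s s' →
      (∃ f, M.IsRun v c f ∧
        (((∀ i < n, ∀ b, M.prog (f i).node ≠ .halt b) ∧ s' (ax .yv) = s (ax .yv)) ∨
          ∃ b, M.Outputs f b ∧ (s' (ax .yv) 0 < 0 ↔ b = true))) → Q s') :
    Ends u L M.run s Q := by
  refine .forR hn hR (Machine.dispatch_avoids _) (fun j s' => EqOff M.simTapes s s' ∧
    ∃ f, M.IsRun v c f ∧
      (((∀ i < j, ∀ b, M.prog (f i).node ≠ .halt b) ∧ s' (ax .yv) = s (ax .yv) ∧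
        Agrees (n - j) (f j) s' ∧ Flags (some (f j).node) s') ∨
      ∃ b, M.Outputs f b ∧ (s' (ax .yv) 0 < 0 ↔ b = true) ∧ Flags none s')) ?_ ?_ ?_
  · obtain ⟨f, rfl, h₁⟩ := M.exists_isRun (hu.trans_le huv) c
    exact ⟨.refl _ _, f, ⟨rfl, h₁⟩, Or.inl ⟨by simp, rfl, by simpa using hc, hf⟩⟩
  · rintro j hj s' ⟨he, f, h₁, ⟨h₂, h₃, h₄, h₅⟩ | ⟨b, h₂, h₃, h₄⟩⟩ _
    · refine (Ends.dispatch hu1 huv (r := n - (j + 1)) (by omega)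
        (h₄.mono (by omega)) h₅ ?_ (List.mem_finRange _)).imp ?_
      · rw [he _ (by simp [Machine.simTapes]), hus]
      · rintro s'' ⟨g₁, ⟨c', g₂, g₃, g₄, g₅, g₆⟩ | ⟨b, g₂, g₃, g₄⟩⟩
        · obtain ⟨f', k₁, k₂, rfl⟩ := h₁.exists_extend (hu.trans_le huv) j g₂
          refine ⟨he.trans g₁, f', k₁, Or.inl ⟨fun i hi => ?_, g₆.trans h₃, ?_, g₅⟩⟩
          · rw [k₂ i (by omega)]
            rcases Nat.lt_succ_iff_lt_or_eq.1 hi with h | rfl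
            exacts [h₂ i h, g₃]
          · push_cast; exact g₄
        · exact ⟨he.trans g₁, f, h₁, Or.inr ⟨b, ⟨j, g₂⟩, g₃, g₄⟩⟩
    · exact .dispatch_none h₄ ⟨he, f, h₁, Or.inr ⟨b, h₂, h₃, h₄⟩⟩
  · rintro s' ⟨he, f, h₁, ⟨h₂, h₃, -, -⟩ | ⟨b, h₂, h₃, -⟩⟩ _
    · exact hQ s' he ⟨f, h₁, Or.inl ⟨h₂, h₃⟩⟩
    · exact hQ s' he ⟨f, h₁, Or.inr ⟨b, h₂, h₃⟩⟩

/-- The tape from which a tape of the simulated machine is initialized. -/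
def Machine.source (M : Machine) (d : Fin (M.extraTapes + 3)) : M.Tp :=
  if d.val = 0 then bitsTape else if d.val = 1 then realsTape else
    if d.val = 2 then ax .kt else ax .blank

/-- Prepare the tapes for a simulation. -/
noncomputable def Machine.prepare (M : Machine) : Cmd M.Tp :=
  .block [.block ((List.finRange _).map fun d => .blit (ax .rb) (M.source d) (tg d)),
    .block ((List.finRange _).map fun i => .basic (.const 0 (fl i))),
    .basic (.const (-1) (fl 0))]

theorem Machine.source_ne (d e : Fin (M.extraTapes + 3)) : M.source d ≠ tg e := by
  simp only [Machine.source]; split_ifs <;> simp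

theorem Ends.blits {n : ℕ} (hn : n ≤ L) (hR : Ruler n (s (ax .rb)))
    (l : List (Fin (M.extraTapes + 3)))
    (hQ : ∀ s', (∀ d ∈ l, ∀ i : ℤ, -n ≤ i → i < n → s' (tg d) i = s (M.source d) i) →
      EqOff (l.map tg) s s' → Q s') :
    Ends u L (.block (l.map fun d => .blit (ax .rb) (M.source d) (tg d))) s Q := by
  induction l generalizing s with
  | nil => exact .nil (hQ s (by simp) (.refl _ _))
  | cons d l ih =>
    refine .cons (.blit hn hR ?_ (by simp) (Machine.source_ne _ _) ?_)
    · simp only [Machine.source]; split_ifs <;> simp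
    · refine ih (by simpa using hR) fun s' h₁ h₂ => hQ s' (fun e he i hi₁ hi₂ => ?_) ?_
      · by_cases hel : e ∈ l
        · rw [h₁ e hel i hi₁ hi₂, Function.update_of_ne (Machine.source_ne _ _)]
        · obtain rfl : e = d := (List.mem_cons.1 he).resolve_right hel
          rw [h₂ _ (by simpa using hel), Function.update_self, if_pos ⟨hi₁, hi₂⟩]
      · exact ((EqOff.refl _ _).update (by simp) _).trans (h₂.mono (by simp))

theorem Ends.clear (l : List (Fin (M.extraNodes + 1)))
    (hQ : ∀ s', (∀ i ∈ l, s' (fl i) 0 = 0) → EqOff (l.map fl) s s' → Q s') :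
    Ends u L (.block (l.map fun i => .basic (.const 0 (fl i)))) s Q := by
  induction l generalizing s with
  | nil => exact .nil (hQ s (by simp) (.refl _ _))
  | cons j l ih =>
    refine .cons (.const fun w hw => ih fun s' h₁ h₂ => hQ s' (fun i hi => ?_) ?_)
    · by_cases hil : i ∈ l
      · exact h₁ i hil
      · obtain rfl : i = j := (List.mem_cons.1 hi).resolve_right hil
        rw [h₂ _ (by simpa using hil), put_self, hw.zero]
    · exact ((EqOff.refl _ _).put (by simp) _).trans (h₂.mono (by simp))

/-- The initial configuration for the given contents of the reserved tapes. -/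
def Machine.start (M : Machine) (v x : List ℝ) (k : ℕ) : M.Config :=
  ⟨0, fun d => if d.val = 0 then tapeOfList v else if d.val = 1 then tapeOfList x
    else if d.val = 2 then tapeOfList (realBits k.bits) else fun _ => 0⟩

/-- Only cells `-n, …, n - 1` are overwritten, hence `m < n`. Remnants of earlier simulations
further out are never reached. -/
theorem Ends.prepare {n m k : ℕ} {w x : List ℝ} (hu1 : u < 1) (hn : n ≤ L) (hm : m < n)
    (hR : Ruler n (s (ax .rb))) (h0 : s bitsTape = tapeOfList w) (h1 : s realsTape = tapeOfList x)
    (h2 : s (ax .kt) = bitTape k) (hb : s (ax .blank) = fun _ => 0)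
    (hQ : ∀ s', Agrees m (M.start w x k) s' → Flags (some 0) s' → s' (ax .yv) = s (ax .yv) →
      EqOff M.simTapes s s' → Q s') : Ends u L M.prepare s Q := by
  refine .cons (.blits hn hR _ fun s₁ h₁ h₂ => .cons (.clear _ fun s₂ h₃ h₄ => .cons
    (.raise hu1 (fun i => by simp [h₃ i (List.mem_finRange i)]) fun s₃ h₅ h₆ =>
      .nil (hQ s₃ ?_ h₅ ?_ ?_))))
  · intro d i hi₁ hi₂
    rw [h₆ _ (by simp), h₄ _ (by simp), h₁ d (List.mem_finRange d) i (by omega) (by omega)]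
    simp only [Machine.source, Machine.start, tapeOfList_bits]
    split_ifs
    exacts [congrFun h0 i, congrFun h1 i, congrFun h2 i, congrFun hb i]
  · rw [h₆ _ (by simp), h₄ _ (by simp), h₂ _ (by simp)]
  · refine (h₂.mono ?_).trans ((h₄.mono ?_).trans (h₆.mono ?_)) <;>
      simp [Machine.simTapes]

/-! ### Testing one vector -/

variable {M : Machine}

/-- All runs of the machine with precision at least `K` and input `(w, x)` that halt answer `b`, and
those with precision `K` halt soon. -/
def Machine.DecidesFrom (M : Machine) (ρ : ℕ) (w x : List ℝ) (K : ℕ) (b : Bool) : Prop :=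
  ∀ v : ℝ, 0 < v → v < 1 → ((2 : ℝ) ^ ρ)⁻¹ ≤ v → K ≤ precision v →
    ∀ f, M.IsRun v (M.start w x (precision v)) f → (∀ b', M.Outputs f b' → b' = b) ∧
      (precision v = K → ∃ i < ρ, ∃ b', M.prog (f i).node = .halt b')

/-- The contents of the tapes that are prepared once. -/
structure Env (u γ : ℝ) (ρ l m : ℕ) (w x : List ℝ) (s : State M.Tp) : Prop where
  one : s (ax .one) 0 = 1
  blank : s (ax .blank) = fun _ => 0
  factor : s (ax .c) 0 = γ
  half : Rounds u (1 / 2) (s (ax .hf) 0)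
  ra : Ruler ρ (s (ax .ra))
  ra' : Ruler ρ (s (ax .ra'))
  rb : Ruler l (s (ax .rb))
  mm : Ruler m (s (ax .mm))
  p1 : Ruler x.length (s (ax .p1))
  bits : s bitsTape = tapeOfList w
  pt : OpenRuler 0 (s (ax .pt))
  kt : ∃ k ≤ ρ, s (ax .kt) = bitTape k

/-- The tapes that are changed in the loop over the precisions. -/
def Machine.loopTapes (M : Machine) : List M.Tp :=
  [ax .kt, ax .pt, ax .t0, ax .us] ++ M.simTapes

/-- The tapes that are changed while one vector is tested. -/
def Machine.testTapes (M : Machine) : List M.Tp :=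
  [ax .g, realsTape, ax .t0, ax .t1, ax .t2, ax .ans] ++ M.loopTapes

/-- Simulate the machine with the next precision. -/
noncomputable def Machine.next (M : Machine) : Cmd M.Tp :=
  .block [.incr (ax .kt) (ax .pt) (ax .one) (ax .blank) (ax .t0),
    .basic (.arith .mul (ax .us) (ax .hf) (ax .us)), M.prepare, M.run]

/-- Simulate the machine with the vector given by the counter, and all small precisions. -/
noncomputable def Machine.trial (M : Machine) : Cmd M.Tp :=
  .block [generate, .blit (ax .rb) (ax .blank) (ax .kt), .basic (.const (3 / 2) (ax .us)),
    .basic (.const 0 (ax .yv)), .forR (ax .ra) M.next,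
    .ite (ax .yv) .skip (.basic (.const (-1) (ax .ans)))]

variable {u γ : ℝ} {ρ l m L : ℕ} {w x : List ℝ} {s : State M.Tp} {Q : State M.Tp → Prop}

theorem Env.congr {s' : State M.Tp} (h : Env u γ ρ l m w x s) (he : EqOff M.testTapes s s')
    (hpt : OpenRuler 0 (s' (ax .pt))) (hkt : ∃ k ≤ ρ, s' (ax .kt) = bitTape k) :
    Env u γ ρ l m w x s' := by
  have key : ∀ d, d ∉ M.testTapes → s' d = s d := he
  refine ⟨?_, ?_, ?_, ?_, ?_, ?_, ?_, ?_, ?_, ?_, hpt, hkt⟩ <;>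
    rw [key _ (by simp [Machine.testTapes, Machine.loopTapes, Machine.simTapes])]
  exacts [h.one, h.blank, h.factor, h.half, h.ra, h.ra', h.rb, h.mm, h.p1, h.bits]

/-- Precision `k` means `2 ^ (-k) ≤ v < 2 ^ (1 - k)`. The factor `3/2` keeps `v` inside despite an
error factor of `7/8`: `3/2 * 7/8 > 1` and `3/2 * 8/7 < 2`. -/
theorem precision_near {k n : ℕ} {v : ℝ} (hu : 0 < u) (hu1 : u < 1) (hk : 1 ≤ k)
    (hn : n * u ≤ 1 / 8) (h : Near u n (3 / 2 * (1 / 2) ^ k) v) :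
    precision v = k ∧ v < 1 ∧ ((2 : ℝ) ^ k)⁻¹ ≤ v := by
  have h₁ : 7 / 8 ≤ (1 - u) ^ n := by
    have := one_add_mul_le_pow (a := -u) (by linarith) n
    rw [← sub_eq_add_neg] at this
    linarith
  obtain ⟨h₂, hv, h₃, h₄⟩ := h
  have h₅ := (mul_le_mul_of_nonneg_left h₁ h₂.le).trans h₃
  have h₆ := (mul_le_mul_of_nonneg_left h₁ hv.le).trans h₄
  obtain ⟨k, rfl⟩ : ∃ i, k = i + 1 := ⟨k - 1, by omega⟩
  have hp : (0 : ℝ) < (1 / 2) ^ k := by positivity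
  have hp1 : (1 / 2 : ℝ) ^ k ≤ 1 := pow_le_one₀ (by norm_num) (by norm_num)
  have e : (1 / 2 : ℝ) ^ (k + 1) = (1 / 2) ^ k * (1 / 2) := pow_succ _ _
  rw [e] at h₅ h₆
  refine ⟨le_antisymm ?_ ?_, by linarith, ?_⟩
  · refine not_lt.1 fun h => ?_
    have := (lt_precision_iff hv _).1 h
    rw [e] at this
    linarith
  · refine (lt_precision_iff hv k).2 ?_
    linarith
  · rw [← inv_pow, ← one_div, e]
    linarith

theorem bitTape_eq_zero {k : ℕ} {i : ℤ} (h : i < -k.size ∨ k.size ≤ i) : bitTape k i = 0 := by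
  rw [bitTape]
  split_ifs with h₁ h₂ h₃
  · exfalso
    rw [Nat.testBit_eq_false_of_lt] at h₂
    · simp at h₂
    · refine (Nat.lt_size_self k).trans_le (Nat.pow_le_pow_right (by norm_num) (by omega))
  · rfl
  · omega
  · rfl

theorem size_le_self (k : ℕ) : k.size ≤ k := Nat.size_le.2 Nat.lt_two_pow_self

/-- At precision `K` the simulation must halt and sets the right verdict; beyond `K` it either sets
the right verdict again or is cut off and leaves it alone. So after precision `K` the verdict stays
right, although `K` is unknown. -/
theorem Ends.next {j : ℕ} {y : List ℝ} (hu : 0 < u) (hu1 : u < 1)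
    (hs : Env u γ ρ l m w x s) (hx : s realsTape = tapeOfList y)
    (hk : s (ax .kt) = bitTape j) (hv : Near u (2 * j + 1) (3 / 2 * (1 / 2) ^ j) (s (ax .us) 0))
    (hj : j < ρ) (hρ : ((2 * ρ + 1 : ℕ) : ℝ) * u ≤ 1 / 8) (hρ' : u ≤ ((2 : ℝ) ^ ρ)⁻¹) (hl : ρ < l)
    (hρL : ρ + 2 ≤ L) (hlL : l ≤ L)
    (hQ : ∀ s', EqOff M.loopTapes s s' → OpenRuler 0 (s' (ax .pt)) →
      s' (ax .kt) = bitTape (j + 1) →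
      Near u (2 * (j + 1) + 1) (3 / 2 * (1 / 2) ^ (j + 1)) (s' (ax .us) 0) →
      (∀ K b, K ≤ j + 1 → M.DecidesFrom ρ w y K b → (K ≤ j → (s (ax .yv) 0 < 0 ↔ b = true)) →
        (s' (ax .yv) 0 < 0 ↔ b = true)) → Q s') : Ends u L M.next s Q := by
  refine .cons (.incr hu1.le (by have := size_le_self j; omega) (by simp) (by simp) (by simp)
    (by simp) (by simp) (by simp) (by simp) (by simp) (by simp) hk hs.one (by rw [hs.blank]) hs.pt
    fun s₁ h₁ h₂ h₃ => .cons (.arith fun v hw => ?_))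
  rw [h₃ _ (by simp), h₃ _ (by simp), ArithOp.eval] at hw
  have hv' : Near u (2 * (j + 1) + 1) (3 / 2 * (1 / 2) ^ (j + 1)) v := by
    rw [pow_succ, ← mul_assoc]
    have := (hv.mul hu1 (hs.half.near hu1 (by norm_num))).rounds hu1 hw
    exact this.mono hu hu1 (by omega)
  obtain ⟨e₁, e₂, e₃⟩ := precision_near hu hu1 (by omega)
    (le_trans (mul_le_mul_of_nonneg_right (by exact_mod_cast (by omega)) hu.le) hρ) hv'
  have e₄ : ((2 : ℝ) ^ ρ)⁻¹ ≤ v := le_trans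
    (inv_anti₀ (by positivity) (pow_le_pow_right₀ (by norm_num) (by omega))) e₃
  have h₄ : EqOff [ax .kt, ax .pt, ax .t0, ax .us] s (put s₁ (ax .us) v) :=
    (h₃.mono (by simp)).put (by simp) _
  refine .cons (.prepare hu1 hlL hl (w := w) (x := y) (k := j + 1)
    (by rw [h₄ _ (by simp)]; exact hs.rb)
    (by rw [h₄ _ (by simp)]; exact hs.bits) (by rw [h₄ _ (by simp)]; exact hx)
    (by rw [put_of_ne _ _ (by simp)]; exact h₁) (by rw [h₄ _ (by simp)]; exact hs.blank)
    fun s₂ g₁ g₂ g₃ g₄ => .cons (.run (n := ρ) (v := v) hu hu1 (hρ'.trans e₄) (by omega) ?_ g₁ g₂ ?_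
    fun s₃ k₁ k₂ => .nil (hQ s₃ ?_ ?_ ?_ ?_ ?_)))
  · rw [g₄ _ (by simp [Machine.simTapes]), h₄ _ (by simp)]; exact hs.ra'
  · rw [g₄ _ (by simp [Machine.simTapes])]; simp
  · exact (h₄.mono (by simp [Machine.loopTapes])).trans
      ((g₄.trans k₁).mono (List.subset_append_right _ _))
  · rw [k₁ _ (by simp [Machine.simTapes]), g₄ _ (by simp [Machine.simTapes])]
    simpa using h₂
  · rw [k₁ _ (by simp [Machine.simTapes]), g₄ _ (by simp [Machine.simTapes])]
    simpa using h₁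
  · rw [k₁ _ (by simp [Machine.simTapes]), g₄ _ (by simp [Machine.simTapes])]
    simpa using hv'
  · intro K b hK hd hb
    obtain ⟨f, hf, k₂⟩ := k₂
    obtain ⟨d₁, d₂⟩ := hd v hv'.2.1 e₂ e₄ (by omega) f (by rw [e₁]; exact hf)
    rcases k₂ with ⟨k₂, k₃⟩ | ⟨b', k₂, k₃⟩
    · rw [k₃, g₃, h₄ _ (by simp)]
      refine hb (Nat.lt_succ_iff.1 (lt_of_le_of_ne hK fun h => ?_))
      obtain ⟨i, hi, b', hb'⟩ := d₂ (by omega)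
      exact k₂ i hi b' hb'
    · rw [k₃, d₁ b' k₂]

theorem Ends.trial {n : ℕ} {y : List ℝ} (hu : 0 < u) (hu1 : u < 1)
    (hs : Env u γ ρ l y.length w x s) (hx : s realsTape = tapeOfList (x ++ y))
    (hn : s (ax .ch) = bitTape n)
    (hρ : ((2 * ρ + 1 : ℕ) : ℝ) * u ≤ 1 / 8) (hρ' : u ≤ ((2 : ℝ) ^ ρ)⁻¹) (hl : ρ < l)
    (hρL : ρ + 2 ≤ L) (hlL : l ≤ L) (hxL : x.length ≤ L) (hyL : y.length ≤ L)
    (hQ : ∀ s' D, GenRun u γ (genOps n l) ⟨1, y, 0⟩ D → D.vec.length = y.length →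
      Env u γ ρ l y.length w x s' → s' realsTape = tapeOfList (x ++ D.vec) →
      EqOff M.testTapes s s' → (s (ax .ans) 0 < 0 → s' (ax .ans) 0 < 0) →
      (∀ K b, 1 ≤ K → K ≤ ρ → M.DecidesFrom ρ w (x ++ D.vec) K b →
        (s' (ax .ans) 0 < 0 ↔ s (ax .ans) 0 < 0 ∨ b = true)) → Q s') :
    Ends u L M.trial s Q := by
  refine .cons (.generate hu1.le hs.one (by rw [hs.blank]) hs.factor hn hx hs.mm hs.p1 hs.rb hlL
    hxL hyL fun s₁ D hD hDl h₁ h₂ => .cons (.blit hlL (by rw [h₂ _ (by simp)]; exact hs.rb)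
      (by simp) (by simp) (by simp) (.cons (.const fun v hv => .cons (.const fun z hz => ?_)))))
  obtain rfl := hz.zero
  obtain ⟨k, hk, hkt⟩ := hs.kt
  -- Copying blanks resets the counter: its value is at most `ρ < l`, so its nonzero cells all lie
  -- in the overwritten range.
  have hkt' : (fun i => if -(l : ℤ) ≤ i ∧ i < l then s₁ (ax .blank) i else s₁ (ax .kt) i) =
      bitTape 0 := by
    ext i
    have h0 : bitTape 0 i = 0 := bitTape_eq_zero (by simp; omega)
    rw [h0, h₂ _ (by simp), h₂ _ (by simp), hs.blank, hkt]
    have := size_le_self k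
    split_ifs with h
    · rfl
    · exact bitTape_eq_zero (by omega)
  rw [hkt']
  set s₂ := put (put (Function.update s₁ (ax .kt) (bitTape 0)) (ax .us) v) (ax .yv) 0 with hs₂
  have h₃ : EqOff [ax .g, realsTape, ax .t0, ax .t1, ax .t2, ax .kt, ax .us, ax .yv] s s₂ :=
    (((h₂.mono (by simp)).update (by simp) _).put (by simp) _).put (by simp) _
  have h₃' : EqOff M.testTapes s s₂ := h₃.mono (by
    simp [Machine.testTapes, Machine.loopTapes, Machine.simTapes])
  have hE : Env u γ ρ l y.length w x s₂ := hs.congr h₃' (by rw [h₃ _ (by simp)]; exact hs.pt)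
    ⟨0, Nat.zero_le _, by simp [hs₂]⟩
  refine .cons (.forR (n := ρ) (by omega) hE.ra ?_ (fun j s' => EqOff M.loopTapes s₂ s' ∧
    Env u γ ρ l y.length w x s' ∧ s' (ax .kt) = bitTape j ∧
    Near u (2 * j + 1) (3 / 2 * (1 / 2) ^ j) (s' (ax .us) 0) ∧
    ∀ K b, 1 ≤ K → K ≤ j → M.DecidesFrom ρ w (x ++ D.vec) K b → (s' (ax .yv) 0 < 0 ↔ b = true))
    ?_ ?_ ?_)
  · have h₁ : ∀ l, (M.dispatch l).Avoids (ax .ra) := by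
      intro l
      induction l with
      | nil => trivial
      | cons i l ih =>
        refine ⟨by simp, ih, by simp [Cmd.Avoids, Basic.Avoids], ?_⟩
        rcases M.prog i with _ | _ | _ | _ | _ | _ | _ | (_ | _) <;>
          simp [Node.cmd, Cmd.block, Cmd.Avoids, Basic.Avoids]
    have h₂ : ∀ d, M.source d ≠ ax .ra := by
      intro d; simp only [Machine.source]; split_ifs <;> simp
    simp [Machine.next, Machine.run, Machine.prepare, Cmd.avoids_block, Cmd.Avoids, Basic.Avoids,
      Cmd.incr, Cmd.blit, h₁, fun d => (h₂ d).symm]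
  · refine ⟨.refl _ _, hE, by simp [hs₂], ?_, fun K b hK hK' => by omega⟩
    have : s₂ (ax .us) 0 = v := by simp [hs₂]
    rw [this]
    simpa using hv.near hu1 (by norm_num)
  · rintro j hj s' ⟨g₁, g₂, g₃, g₄, g₅⟩ _
    refine .next hu hu1 g₂ (y := x ++ D.vec) ?_ g₃ g₄ hj hρ hρ' hl hρL hlL
      fun s'' k₁ k₂ k₃ k₄ k₅ => ⟨g₁.trans k₁, g₂.congr (k₁.mono (List.subset_append_right _ _)) k₂
        ⟨j + 1, hj, k₃⟩, k₃, k₄, fun K b hK hK' hd => k₅ K b hK' hd fun hK'' => g₅ K b hK hK'' hd⟩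
    rw [g₁ _ (by simp [Machine.loopTapes, Machine.simTapes])]
    simpa [hs₂] using h₁
  · rintro s' ⟨g₁, g₂, g₃, g₄, g₅⟩ _
    have hr : s' realsTape = tapeOfList (x ++ D.vec) := by
      rw [g₁ _ (by simp [Machine.loopTapes, Machine.simTapes])]
      simpa [hs₂] using h₁
    have he : EqOff M.testTapes s s' := h₃'.trans (g₁.mono (List.subset_append_right _ _))
    have ha : s' (ax .ans) = s (ax .ans) := by
      rw [g₁ _ (by simp [Machine.loopTapes, Machine.simTapes]), h₃ _ (by simp)]
    refine .cons (.ite (fun h => .skip (.nil (hQ s' D hD hDl g₂ hr he (by simp [ha])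
      fun K b hK hK' hd => ?_)))
      fun h => .const fun q hq => .nil (hQ _ D hD hDl ?_ ?_ ?_ (fun _ => ?_)
        fun K b hK hK' hd => ?_))
    · have := (g₅ K b hK hK' hd).not.1 (not_lt.2 h)
      simp [ha, this]
    · refine g₂.congr ((EqOff.refl _ _).put (by simp [Machine.testTapes]) _) ?_ ?_
      · rw [put_of_ne _ _ (by simp)]; exact g₂.pt
      · rw [put_of_ne _ _ (by simp)]; exact g₂.kt
    · rw [put_of_ne _ _ (by simp), hr]
    · exact he.put (by simp [Machine.testTapes]) _
    · simpa using (hq.neg_iff hu1.le).2 (by norm_num)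
    · have h₄ := (g₅ K b hK hK' hd).1 h
      simpa [h₄] using (hq.neg_iff hu1.le).2 (by norm_num)

/-! ### Testing all vectors -/

section Search

variable {M : Machine} {u γ : ℝ} {ρ l m L : ℕ} {w x : List ℝ} {s : State M.Tp}
  {Q : State M.Tp → Prop}

/-- Test all vectors that can be generated. -/
noncomputable def Machine.search (M : Machine) : Cmd M.Tp :=
  .block [.basic (.const (-1) (ax .go)), .loop (ax .go) (.block [M.trial,
    .incr (ax .ch) (ax .pt) (ax .one) (ax .blank) (ax .t0),
    .forR (ax .rb) (.basic (.shl (ax .ch))),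
    .basic (.arith .sub (ax .ch) (ax .one) (ax .go)),
    .forR (ax .rb) (.basic (.shr (ax .ch)))])]

theorem Env.congr_list {s' : State M.Tp} (h : Env u γ ρ l m w x s) {V : List M.Tp}
    (he : EqOff V s s') (hV : ∀ a ∈ V, a = ax .ch ∨ a = ax .pt ∨ a = ax .t0 ∨ a = ax .go)
    (hpt : OpenRuler 0 (s' (ax .pt))) : Env u γ ρ l m w x s' := by
  have key : ∀ d, d ≠ ax .ch → d ≠ ax .pt → d ≠ ax .t0 → d ≠ ax .go → s' d = s d :=
    fun d h₁ h₂ h₃ h₄ => he d fun hd => by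
      rcases hV d hd with h | h | h | h
      exacts [h₁ h, h₂ h, h₃ h, h₄ h]
  refine ⟨?_, ?_, ?_, ?_, ?_, ?_, ?_, ?_, ?_, ?_, hpt, ?_⟩ <;>
    rw [key _ (by simp) (by simp) (by simp) (by simp)]
  exacts [h.one, h.blank, h.factor, h.half, h.ra, h.ra', h.rb, h.mm, h.p1, h.bits, h.kt]

/-- The counter runs through all `n < 2 ^ l`, until its bit `l` is set. A code may leave entries of
the previous vector in place; therefore the positive condition is required for every `y₀`, and the
negative one for every vector at all. -/
theorem Ends.search {y : List ℝ} (hu : 0 < u) (hu1 : u < 1)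
    (hs : Env u γ ρ l m w x s) (hy : y.length = m) (hx : s realsTape = tapeOfList (x ++ y))
    (hch : s (ax .ch) = bitTape 0) (hans : s (ax .ans) 0 = 0)
    (hρ : ((2 * ρ + 1 : ℕ) : ℝ) * u ≤ 1 / 8) (hρ' : u ≤ ((2 : ℝ) ^ ρ)⁻¹) (hl : ρ < l)
    (hlL : 2 ^ l + l + 2 ≤ L) (hxL : x.length ≤ L) (hyL : m ≤ L)
    (hQ : ∀ s', ((∀ y' : List ℝ, y'.length = m →
        ∃ K, 1 ≤ K ∧ K ≤ ρ ∧ M.DecidesFrom ρ w (x ++ y') K false) → ¬ s' (ax .ans) 0 < 0) →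
      ((∃ n < 2 ^ l, ∀ y₀ D, y₀.length = m → GenRun u γ (genOps n l) ⟨1, y₀, 0⟩ D →
        ∃ K, 1 ≤ K ∧ K ≤ ρ ∧ M.DecidesFrom ρ w (x ++ D.vec) K true) → s' (ax .ans) 0 < 0) →
      Q s') : Ends u L M.search s Q := by
  have hpos : 0 < 2 ^ l := by positivity
  refine .cons (.const fun v hv => .cons (.loop (fun k s' => k ≤ 2 ^ l ∧
    s' (ax .ch) = bitTape (2 ^ l - k) ∧ Env u γ ρ l m w x s' ∧
    (∃ y : List ℝ, y.length = m ∧ s' realsTape = tapeOfList (x ++ y)) ∧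
    (s' (ax .go) 0 < 0 ↔ 0 < k) ∧
    ((∀ y' : List ℝ, y'.length = m →
        ∃ K, 1 ≤ K ∧ K ≤ ρ ∧ M.DecidesFrom ρ w (x ++ y') K false) → ¬ s' (ax .ans) 0 < 0) ∧
    ((∃ n < 2 ^ l - k, ∀ y₀ D, y₀.length = m → GenRun u γ (genOps n l) ⟨1, y₀, 0⟩ D →
        ∃ K, 1 ≤ K ∧ K ≤ ρ ∧ M.DecidesFrom ρ w (x ++ D.vec) K true) → s' (ax .ans) 0 < 0))
    (2 ^ l) (by omega) ?_ ?_ ?_))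
  · refine ⟨le_rfl, ?_, ?_, ⟨y, hy, ?_⟩, ?_, ?_, ?_⟩
    · rw [put_of_ne _ _ (by simp), hch, Nat.sub_self]
    · refine hs.congr_list ((EqOff.refl [ax .go] _).put (by simp) _) (by simp) ?_
      rw [put_of_ne _ _ (by simp)]; exact hs.pt
    · rw [put_of_ne _ _ (by simp), hx]
    · simp [hv.neg_iff hu1.le]
    · intro _; simp [hans]
    · rintro ⟨n, hn, -⟩; omega
  · rintro k s₁ ⟨hk, h₁, h₂, ⟨y₁, hy₁, h₃⟩, h₄, h₅, h₆⟩ h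
    obtain ⟨k, rfl⟩ : ∃ i, k = i + 1 := ⟨k - 1, by have := h₄.1 h; omega⟩
    subst hy₁
    have hn : 2 ^ l - (k + 1) < 2 ^ l := by omega
    have hn' : 2 ^ l - k = 2 ^ l - (k + 1) + 1 := by omega
    refine ⟨k, rfl, .cons (.trial hu hu1 h₂ h₃ h₁ hρ hρ' hl (by omega) (by omega) hxL hyL
      fun s₂ D hD hDl g₁ g₂ g₃ g₄ g₅ => ?_)⟩
    have hch₂ : s₂ (ax .ch) = bitTape (2 ^ l - (k + 1)) := by
      rw [g₃ _ (by simp [Machine.testTapes, Machine.loopTapes, Machine.simTapes]), h₁]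
    refine .cons (.incr hu1.le (k := 2 ^ l - (k + 1))
      (by have := Nat.size_le.2 hn; omega) (by simp) (by simp) (by simp)
      (by simp) (by simp) (by simp) (by simp) (by simp) (by simp) hch₂ g₁.one (by rw [g₁.blank])
      g₁.pt fun s₃ k₁ k₂ k₃ => .cons (.forR_shl (n := l) (by omega)
      (by rw [k₃ _ (by simp)]; exact g₁.rb) (by simp) (.cons (.arith fun q hq => .cons (.forR_shr
      (n := l) (by omega) ?_ (by simp) (.nil ?_))))))
    · simpa using (by rw [k₃ _ (by simp)]; exact g₁.rb : Ruler l (s₃ (ax .rb)))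
    set s₄ := Function.update (put _ (ax .go) q) _ _ with hs₄
    have e₀ : s₄ (ax .ch) = bitTape (2 ^ l - k) := by simp [hs₄, k₁, hn']
    have e₁ : EqOff [ax .ch, ax .pt, ax .t0, ax .go] s₂ s₄ :=
      (((k₃.mono (by simp)).update (by simp) _).put (by simp) _).update (by simp) _
    have ea : s₄ (ax .ans) = s₂ (ax .ans) := e₁ _ (by simp)
    refine ⟨by omega, e₀, g₁.congr_list e₁ (by simp) ?_, ⟨D.vec, hDl, ?_⟩, ?_, ?_, ?_⟩
    · simpa [hs₄] using k₂
    · rw [e₁ _ (by simp), g₂]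
    · have e₂ : s₄ (ax .go) 0 = q := by simp [hs₄]
      have e₃ : (bitTape (2 ^ l - k)) l = if k = 0 then 1 else 0 := by
        rw [bitTape, if_pos (by omega), Int.toNat_natCast]
        by_cases hk0 : k = 0
        · subst hk0; simp
        · rw [Nat.testBit_eq_false_of_lt (by omega)]; simp [hk0]
      simp only [ArithOp.eval, Function.update_self, sl_apply, zero_add, k₁, ← hn', e₃, ne_eq,
        reduceCtorEq, not_false_eq_true, Function.update_of_ne, Sum.inr.injEq] at hq
      rw [k₃ _ (by simp), g₁.one] at hq
      rw [e₂, hq.neg_iff hu1.le]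
      split_ifs with hk0
      · simp [hk0]
      · simp; omega
    · intro hd
      obtain ⟨K, hK₁, hK₂, hK⟩ := hd D.vec hDl
      rw [ea, g₅ K false hK₁ hK₂ hK]
      simpa using h₅ hd
    · rintro ⟨n, hn₁, hn₂⟩
      rw [ea]
      rcases Nat.lt_succ_iff_lt_or_eq.1 (show n < (2 ^ l - (k + 1)).succ by omega) with h' | rfl
      · exact g₄ (h₆ ⟨n, h', hn₂⟩)
      · obtain ⟨K, hK₁, hK₂, hK⟩ := hn₂ y₁ D rfl hD
        exact (g₅ K true hK₁ hK₂ hK).2 (Or.inr rfl)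
  · rintro k s₁ ⟨hk, h₁, h₂, h₃, h₄, h₅, h₆⟩ h
    have hk0 : k = 0 := by
      by_contra h'
      exact absurd (h₄.2 (by omega)) (not_lt.2 h)
    subst hk0
    exact .nil (hQ s₁ h₅ h₆)

end Search

/-! ### Preparations -/

section Setup

variable {τ N : ℕ} {u : ℝ} {L : ℕ} {s : State (Tp τ N)} {Q : State (Tp τ N) → Prop}

/-- Rulers that measure the precision, and a factor slightly larger than `1`. -/
noncomputable def setupPrecision : Cmd (Tp τ N) :=
  .block [.basic (.shr (.inl 2)), .basic (.copy (.inl 2) (ax .one)),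
    .basic (.const (2 ^ 20) (ax .kb)), .basic (.const (1 / 4) (ax .qt)),
    .basic (.const (1 / 2) (ax .hf)), .basic (.copy (ax .one) (ax .eps)),
    .basic (.arith .sub (ax .r) (ax .one) (ax .t0)),
    .loop (ax .t0) (.block [.mark (ax .ra), .mark (ax .ra'),
      .basic (.arith .mul (ax .r) (ax .kb) (ax .r)),
      .basic (.arith .mul (ax .eps) (ax .qt) (ax .eps)),
      .basic (.arith .sub (ax .r) (ax .one) (ax .t0))]),
    .close (ax .ra), .close (ax .ra'), .forR (ax .ra) (.forR (ax .ra') (.mark (ax .rb))),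
    .close (ax .rb), .basic (.arith .add (ax .one) (ax .eps) (ax .c))]

/-- Two roundings, of the constant and of the product, cost a factor between `(7/8)^2 ≥ 1/2` and
`(9/8)^2 ≤ 4/3`. So multiplying by `2 ^ 20` gains between `2 ^ 19` and `2 ^ 21`, and by `1/4`
between `1/8` and `1/3`. -/
theorem rounds_scale {a b c r r' : ℝ} (hu : 0 < u) (hu1 : u ≤ 1 / 8) (ha : 0 < a) (hr : 0 < r)
    (hb : Rounds u a b) (h : Rounds u (r * b) r') (hc : c = a) :
    0 < r' ∧ r * (c / 2) ≤ r' ∧ r' ≤ r * (c * (4 / 3)) := by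
  subst hc
  have hb0 := (hb.pos_iff (by linarith)).2 ha
  have h₀ := (h.pos_iff (by linarith)).2 (mul_pos hr hb0)
  have h₁ := h.ge (mul_pos hr hb0).le
  have h₂ := h.le (mul_pos hr hb0).le
  have h₃ := mul_le_mul_of_nonneg_left (hb.ge ha.le) hr.le
  have h₄ := mul_le_mul_of_nonneg_left (hb.le ha.le) hr.le
  have hrc := mul_pos hr ha
  refine ⟨h₀, ?_, ?_⟩
  · have h₅ := mul_le_mul_of_nonneg_right h₃ (by linarith : (0 : ℝ) ≤ 1 - u)
    nlinarith [mul_le_mul_of_nonneg_left hu1 hrc.le]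
  · have h₅ := mul_le_mul_of_nonneg_right h₄ (by linarith : (0 : ℝ) ≤ 1 + u)
    nlinarith [mul_le_mul_of_nonneg_left hu1 hrc.le, mul_nonneg hrc.le (mul_nonneg hu.le hu.le),
      mul_nonneg hrc.le (mul_nonneg hu.le (sub_nonneg.2 hu1))]

/-- Starting from `u`, the number `r` is multiplied by about `2 ^ 20` until it reaches `1`; `ρ` is
the number of rounds, so `u` lies between `2 ^ (-21 ρ)` and `2 ^ (-19 (ρ - 1))`. In parallel `eps`
becomes about `4 ^ (-ρ)`: small enough for accuracy `2 ^ (-ρ)`, and large compared with `u`. -/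
theorem Ends.setupPrecision (hu : 0 < u) (hu1 : u < 1 / 2 ^ 19)
    (h2 : s (.inl 2) = bitTape (precision u)) (hr : s (ax .r) 0 = u)
    (hra : OpenRuler 0 (s (ax .ra))) (hra' : OpenRuler 0 (s (ax .ra')))
    (hrb : OpenRuler 0 (s (ax .rb))) (hL : (precision u + 1) * (precision u + 1) ≤ L)
    (hQ : ∀ s' ρ eps, 1 ≤ ρ → ρ ≤ precision u + 1 → precision u ≤ 21 * ρ →
      u * (2 ^ 19) ^ (ρ - 1) < 1 → (1 / 8) ^ ρ ≤ eps → eps ≤ (1 / 3) ^ ρ →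
      Rounds u (1 + eps) (s' (ax .c) 0) → s' (ax .one) 0 = 1 →
      Rounds u (1 / 2) (s' (ax .hf) 0) → Ruler ρ (s' (ax .ra)) → Ruler ρ (s' (ax .ra')) →
      Ruler (ρ * ρ) (s' (ax .rb)) → EqOff [.inl 2, ax .one, ax .kb, ax .qt, ax .hf, ax .eps, ax .t0,
        ax .ra, ax .ra', ax .rb, ax .c, ax .r] s s' → Q s') : Ends u L setupPrecision s Q := by
  have hu8 : u ≤ 1 / 8 := by norm_num at hu1 ⊢; linarith
  have hk : 1 ≤ precision u := one_le_precision hu (by linarith)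
  have hL' : precision u + 1 ≤ L := le_trans (Nat.le_mul_of_pos_left _ (by omega)) hL
  -- Built-in constants are rounded; an exact `1` is found in the unary length on the precision
  -- tape, which is not.
  have h1 : bitTape (precision u) (-1) = 1 := by
    rw [bitTape, if_neg (by omega), if_pos]
    have := Nat.size_pos.2 hk
    omega
  refine .cons (.shr (.cons (.copy (.cons (.const fun a ha => .cons (.const fun b hb => .cons
    (.const fun c hc => .cons (.copy (.cons (.arith fun d hd => .cons (.loop (fun k s' =>
    k ≤ precision u + 1 ∧ s' (ax .one) 0 = 1 ∧ s' (ax .kb) 0 = a ∧ s' (ax .qt) 0 = b ∧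
    s' (ax .hf) 0 = c ∧ 0 < s' (ax .r) 0 ∧ 0 < s' (ax .eps) 0 ∧
    (s' (ax .t0) 0 < 0 ↔ s' (ax .r) 0 < 1) ∧
    OpenRuler (precision u + 1 - k) (s' (ax .ra)) ∧ OpenRuler (precision u + 1 - k) (s' (ax .ra')) ∧
    u * (2 ^ 19) ^ (precision u + 1 - k) ≤ s' (ax .r) 0 ∧
    s' (ax .r) 0 ≤ u * (2 ^ 21) ^ (precision u + 1 - k) ∧
    (1 / 8) ^ (precision u + 1 - k) ≤ s' (ax .eps) 0 ∧
    s' (ax .eps) 0 ≤ (1 / 3) ^ (precision u + 1 - k) ∧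
    (0 < precision u + 1 - k → u * (2 ^ 19) ^ (precision u + 1 - k - 1) < 1) ∧
    (precision u + 1 - k = 0 → s' (ax .r) 0 < 1) ∧
    EqOff [.inl 2, ax .one, ax .kb, ax .qt, ax .hf, ax .eps, ax .t0,
        ax .ra, ax .ra', ax .r] s s') (precision u + 1) hL' ?_ ?_ ?_)))))))))))
  · refine ⟨le_rfl, ?_, ?_, ?_, ?_, ?_, ?_, ?_, ?_, ?_, ?_, ?_, ?_, ?_, ?_, ?_, ?_⟩
    case refine_16 =>
      refine (((((((EqOff.refl _ _).update ?_ _).put ?_ _).put ?_ _).put ?_ _).put ?_ _).put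
        ?_ _).put ?_ _ <;> simp
    case refine_7 =>
      simp only [ArithOp.eval, put, ne_eq, reduceCtorEq, not_false_eq_true, Function.update_of_ne,
        Function.update_self, Sum.inr.injEq, h2, hr, sl_apply, zero_add, h1] at hd
      simp only [put_self]
      rw [hd.neg_iff (by linarith)]
      simp [put, hr]
    all_goals simp [put, h2, hr, h1, hu, hra, hra']
    linarith
  · rintro k s' ⟨hkk, i₁, i₂, i₃, i₄, i₅, i₆, i₇, i₈, i₉, i₁₀, i₁₁, i₁₂, i₁₃, -, -, i₁₄⟩ h
    have hr1 := i₇.1 h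
    -- After `precision u + 1` rounds `r` would be at least `2 ^ (19 (precision u + 1)) * u ≥ 1`, so
    -- the loop has stopped before.
    have hk0 : k ≠ 0 := by
      rintro rfl
      have h₁ : u * (2 ^ 19) ^ (precision u + 1) < 1 := lt_of_le_of_lt i₁₀ hr1
      have h₂ : (1 / 2 : ℝ) ^ (precision u) ≤ u := not_lt.1 ((lt_precision_iff hu _).not.1 (by omega))
      have h₃ : (2 : ℝ) ^ precision u ≤ (2 ^ 19) ^ (precision u + 1) := by
        rw [← pow_mul]; exact pow_le_pow_right₀ (by norm_num) (by omega)
      have h₄ : (1 / 2 : ℝ) ^ precision u * 2 ^ precision u = 1 := by rw [← mul_pow]; norm_num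
      have h₅ := mul_le_mul h₂ h₃ (by positivity) hu.le
      rw [h₄] at h₅
      exact lt_irrefl _ (h₅.trans_lt h₁)
    obtain ⟨k, rfl⟩ : ∃ i, k = i + 1 := ⟨k - 1, by omega⟩
    have e : precision u + 1 - k = precision u + 1 - (k + 1) + 1 := by omega
    refine ⟨k, rfl, .cons (.mark (by linarith) i₈ fun g hg => .cons (.mark (by linarith)
      (by simpa using i₉) fun g' hg' => .cons (.arith fun r' hr' => .cons (.arith fun e' he' =>
      .cons (.arith fun t ht => .nil ?_)))))⟩
    simp only [ArithOp.eval, put, ne_eq, reduceCtorEq, not_false_eq_true, Function.update_of_ne,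
      Function.update_self, Sum.inr.injEq, i₁, i₂, i₃] at hr' he' ht
    obtain ⟨j₁, j₂, j₃⟩ := rounds_scale hu hu8 (by norm_num) i₅ ha hr' rfl
    obtain ⟨j₄, j₅, j₆⟩ := rounds_scale hu hu8 (by norm_num) i₆ hb he' rfl
    rw [e]
    refine ⟨by omega, ?_, ?_, ?_, ?_, ?_, ?_, ?_, ?_, ?_, ?_, ?_, ?_, ?_, ?_, ?_, ?_⟩
    case refine_16 =>
      refine (((((i₁₄.update ?_ _).update ?_ _).put ?_ _).put ?_ _).put ?_ _) <;> simp
    case refine_7 =>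
      simp only [put_self]
      rw [ht.neg_iff (by linarith)]
      simp [put]
    case refine_10 =>
      simp only [put, ne_eq, reduceCtorEq, not_false_eq_true, Function.update_of_ne,
        Function.update_self, Sum.inr.injEq]
      rw [pow_succ]
      linarith
    case refine_11 =>
      simp only [put, ne_eq, reduceCtorEq, not_false_eq_true, Function.update_of_ne,
        Function.update_self, Sum.inr.injEq]
      rw [pow_succ]
      linarith
    case refine_12 =>
      simp only [put, ne_eq, reduceCtorEq, not_false_eq_true, Function.update_of_ne,
        Function.update_self, Sum.inr.injEq]
      rw [pow_succ]
      linarith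
    case refine_13 =>
      simp only [put, ne_eq, reduceCtorEq, not_false_eq_true, Function.update_of_ne,
        Function.update_self, Sum.inr.injEq]
      rw [pow_succ]
      linarith
    case refine_14 =>
      intro _
      exact lt_of_le_of_lt i₁₀ hr1
    case refine_15 => intro h; omega
    all_goals simp [put, i₁, i₂, i₃, i₄, j₁, j₄]
    · simpa using hg
    · simpa using hg'
  · rintro k s' ⟨hkk, i₁, i₂, i₃, i₄, i₅, i₆, i₇, i₈, i₉, i₁₀, i₁₁, i₁₂, i₁₃, i₁₄, i₁₅, i₁₆⟩ h
    set ρ := precision u + 1 - k with hρ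
    have hr1 : 1 ≤ s' (ax .r) 0 := not_lt.1 fun h' => absurd (i₇.2 h') (not_lt.2 h)
    have hρ1 : 1 ≤ ρ := by
      by_contra h'
      exact absurd (i₁₅ (by omega)) (not_lt.2 hr1)
    have hρk : precision u ≤ 21 * ρ := by
      by_contra h'
      have h₁ := (lt_precision_iff hu _).1 (not_le.1 h')
      have h₂ : (1 / 2 : ℝ) ^ (21 * ρ) * (2 ^ 21) ^ ρ = 1 := by
        rw [← pow_mul, ← mul_pow]; norm_num
      have h₃ : u * (2 ^ 21) ^ ρ < (1 / 2 : ℝ) ^ (21 * ρ) * (2 ^ 21) ^ ρ :=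
        mul_lt_mul_of_pos_right h₁ (by positivity)
      exact lt_irrefl _ (((hr1.trans i₁₁).trans_lt h₃).trans_eq h₂)
    have hρL : ρ ≤ L := by omega
    have hρL' : ρ * ρ ≤ L := le_trans (Nat.mul_le_mul (by omega) (by omega)) hL
    refine .cons (.close hρL i₈ fun f hf => .cons (.close (n := ρ) hρL (by simpa using i₉)
      fun f' hf' => .cons (.forR_forR_mark (n := ρ) (n' := ρ) (j := 0) (by linarith) hρL hρL
      (by simpa using hf) (by simpa using hf') (by simp) (by simp) (by simp) ?_ fun g hg =>
      .cons (.close (n := ρ * ρ) hρL' (by simpa using hg) fun g' hg' => .cons (.arith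
      fun γ hγ => .nil ?_)))))
    · simpa [i₁₆ (ax .rb) (by simp)] using hrb
    · refine hQ _ ρ (s' (ax .eps) 0) hρ1 (by omega) hρk (i₁₄ (by omega)) i₁₂ i₁₃ ?_ ?_ ?_ ?_ ?_ ?_ ?_
      · simpa [ArithOp.eval, i₁] using hγ
      · simp [i₁]
      · simpa [i₄] using hc
      · simpa using hf
      · simpa using hf'
      · simpa using hg'
      · refine (((((i₁₆.mono ?_).update ?_ _).update ?_ _).update ?_ _).update ?_ _).put ?_ _ <;>
          simp

end Setup

/-! ### Measuring the input and making room for the vectors. -/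

section SetupInput

variable {τ N : ℕ} {u : ℝ} {L : ℕ} {s : State (Tp τ N)} {Q : State (Tp τ N) → Prop}

/-- Measure the input, compute the length of the vectors to be tested by `c`, and append zeros to
the input. -/
noncomputable def setupInput (c : Cmd (Tp τ N)) : Cmd (Tp τ N) :=
  .block [.measure bitsTape (ax .p0) (ax .blank) (ax .t0),
    .measure realsTape (ax .p1) (ax .blank) (ax .t0),
    .forR (ax .p0) (.mark (ax .nn)), .forR (ax .p1) (.mark (ax .nn)), .close (ax .nn), c,
    .close (ax .mm), .forR (ax .p1) (.basic (.shr realsTape)),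
    .forR (ax .mm) (.block [.basic (.shr realsTape), .basic (.copy (ax .one) realsTape)]),
    .forR (ax .mm) (.basic (.shl realsTape)), .forR (ax .p1) (.basic (.shl realsTape))]

/-- The program writes the value of the polynomial `p` in unary. -/
def ComputesEval (p : ℕ[X]) (c : Cmd (Tp τ N)) : Prop :=
  ∀ {u : ℝ} {L : ℕ} {s : State (Tp τ N)} {Q : State (Tp τ N) → Prop} (n : ℕ), u ≤ 1 →
    n ≤ L → p.eval (n + 1) ≤ L → Ruler n (s (ax .nn)) → OpenRuler 0 (s (ax .mm)) →
    OpenRuler 0 (s (ax .mm')) →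
    (∀ s', OpenRuler (p.eval n) (s' (ax .mm)) → OpenRuler 0 (s' (ax .mm')) →
      EqOff [ax .mm, ax .mm'] s s' → Q s') → Ends u L c s Q

theorem exists_computesEval (p : ℕ[X]) : ∃ c : Cmd (Tp τ N), ComputesEval p c :=
  exists_polynomial_cmd p (ax .nn) (ax .mm) (ax .mm') (by simp) (by simp) (by simp)

/-- Behind the list the cells are zero anyway, so appending zeros only extends the unary length on
the negative side. -/
theorem tapeOfList_append_zeros (x : List ℝ) (m : ℕ) :
    (fun j : ℤ => if -(x.length + m : ℤ) ≤ j ∧ j < -x.length then 1 else tapeOfList x j) =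
      tapeOfList (x ++ List.replicate m 0) := by
  ext j
  simp only [tapeOfList, List.length_append, List.length_replicate]
  by_cases hj : 0 ≤ j
  · rw [if_neg (by omega), if_pos hj, if_pos hj]
    simp only [List.getD_eq_getElem?_getD]
    rcases lt_or_ge j.toNat x.length with h | h
    · rw [List.getElem?_append_left h]
    · rw [List.getElem?_append_right h, List.getElem?_eq_none h, List.getElem?_replicate]
      split_ifs <;> rfl
  · rw [if_neg hj, if_neg hj]
    by_cases h : -j ≤ x.length
    · rw [if_neg (by omega), if_pos h, if_pos (by push_cast; omega)]
    · rw [if_neg h]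
      exact if_congr (by push_cast; omega) rfl rfl

theorem Ends.setupInput {p : ℕ[X]} {c : Cmd (Tp τ N)} (hc : ComputesEval p c) {w x : List ℝ}
    (hu : u ≤ 1) (hw : s bitsTape = tapeOfList w) (hx : s realsTape = tapeOfList x)
    (h1 : s (ax .one) 0 = 1) (hb : s (ax .blank) 0 = 0) (hp0 : OpenRuler 0 (s (ax .p0)))
    (hp1 : OpenRuler 0 (s (ax .p1))) (hnn : OpenRuler 0 (s (ax .nn)))
    (hmm : OpenRuler 0 (s (ax .mm))) (hmm' : OpenRuler 0 (s (ax .mm')))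
    (hL : w.length + x.length ≤ L) (hL' : p.eval (w.length + x.length + 1) ≤ L)
    (hQ : ∀ s', s' realsTape =
        tapeOfList (x ++ List.replicate (p.eval (w.length + x.length)) 0) →
      Ruler x.length (s' (ax .p1)) → Ruler (p.eval (w.length + x.length)) (s' (ax .mm)) →
      EqOff [realsTape, ax .p0, ax .p1, ax .t0, ax .nn, ax .mm, ax .mm'] s s' → Q s') :
    Ends u L (setupInput c) s Q := by
  have hxL : x.length ≤ L := by omega
  have hmL : p.eval (w.length + x.length) ≤ L := (eval_mono p (Nat.le_succ _)).trans hL'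
  refine .cons (.measure hu (by omega) (by simp) (by simp) (by simp) (by simp) (by simp) (by simp)
    hw hb hp0 fun s₁ a₁ a₂ => .cons (.measure (l := x) hu hxL (by simp) (by simp) (by simp) (by simp)
    (by simp) (by simp) (by rw [a₂ _ (by simp), hx]) (by rw [a₂ _ (by simp), hb])
    (by rw [a₂ _ (by simp)]; exact hp1) fun s₂ b₁ b₂ => .cons (.forR_mark (n := w.length) (j := 0)
    hu (by omega) (by rw [b₂ _ (by simp)]; exact a₁) (by simp)
    (by rw [b₂ _ (by simp), a₂ _ (by simp)]; exact hnn) fun g hg => .cons (.forR_mark hu hxL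
    (by simpa using b₁) (by simp) (by simpa using hg) fun g' hg' => .cons (.close
    (n := w.length + x.length) hL (by simpa using hg') fun f hf => ?_)))))
  rw [Function.update_idem, Function.update_idem]
  have e₁ : EqOff [ax .p0, ax .p1, ax .t0, ax .nn] s (Function.update s₂ (ax .nn) f) :=
    ((a₂.mono (by simp)).trans (b₂.mono (by simp))).update (by simp) _
  refine .cons (hc _ hu hL hL' (by simpa using hf) (by rw [e₁ _ (by simp)]; exact hmm)
    (by rw [e₁ _ (by simp)]; exact hmm') fun s₃ c₁ c₂ c₃ => .cons (.close hmL c₁ fun f' hf' =>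
    .cons (.forR_shr (n := x.length) hxL ?_ (by simp) (.cons (.forR
    (n := p.eval (w.length + x.length)) hmL ?_
    (by simp [Cmd.block, Cmd.Avoids, Basic.Avoids]) (fun i s' => s' realsTape =
      sl (fun j : ℤ => if -(x.length + i : ℤ) ≤ j ∧ j < -x.length then 1 else tapeOfList x j)
        (-(x.length + i)) ∧ s' (ax .p1) = s₂ (ax .p1) ∧ s' (ax .mm) = f' ∧
      EqOff [realsTape, ax .p0, ax .p1, ax .t0, ax .nn, ax .mm, ax .mm'] s s')
    ⟨?_, ?_, ?_, ?_⟩ ?_ ?_)))))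
  · simpa [c₃ (ax .p1) (by simp)] using b₁
  · simpa using hf'
  · have : ∀ j : ℤ, ¬ (-(x.length : ℤ) ≤ j ∧ j < -x.length) := by intro j; omega
    have hx₂ : s₂ realsTape = tapeOfList x := by rw [b₂ _ (by simp), a₂ _ (by simp), hx]
    simp only [Function.update_self, ne_eq, reduceCtorEq, not_false_eq_true, Function.update_of_ne,
      c₃ realsTape (by simp), hx₂, Nat.cast_zero, add_zero, this, if_false]
  · simp [c₃ (ax .p1) (by simp)]
  · simp
  · exact (((e₁.mono (by simp)).trans (c₃.mono (by simp))).update (by simp) _).update (by simp) _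
  · rintro i - s' ⟨d₁, d₂, d₃, d₄⟩ -
    refine .cons (.shr (.cons (.copy (.nil ⟨?_, ?_, ?_, ?_⟩))))
    · simp only [put, Function.update_self, ne_eq, reduceCtorEq, not_false_eq_true,
        Function.update_of_ne, d₄ (ax .one) (by simp), h1, d₁, sl_sl, update_sl]
      rw [show (-1 : ℤ) + -(x.length + i) = -(x.length + (i + 1 : ℕ)) by push_cast; ring]
      congr 1
      ext j
      simp only [Function.update_apply]
      by_cases hj : j = -(x.length + (i + 1 : ℕ))
      · rw [if_pos hj, if_pos (by push_cast at hj ⊢; omega)]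
      · rw [if_neg hj]
        push_cast at hj
        exact if_congr (by push_cast; omega) rfl rfl
    · simpa [put] using d₂
    · simpa [put] using d₃
    · exact (d₄.update (by simp) _).put (by simp) _
  · rintro s' ⟨d₁, d₂, d₃, d₄⟩ -
    refine .cons (.forR_shl hmL (by rw [d₃]; exact hf') (by simp) (.cons (.forR_shl hxL
      (by simpa [d₂] using b₁) (by simp) (.nil (hQ _ ?_ ?_ ?_ ?_)))))
    · rw [← tapeOfList_append_zeros]
      simp [d₁]
    · simpa [d₂] using b₁
    · simpa [d₃] using hf'
    · exact (d₄.update (by simp) _).update (by simp) _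

end SetupInput

/-! ### The whole program -/

section Main

variable {M : Machine}

/-- Search for a witness, if the precision is not too small. -/
noncomputable def Machine.decider (M : Machine) (c : Cmd M.Tp) : Cmd M.Tp :=
  .block [.basic (.unit (ax .r)), .basic (.const (1 / 2 ^ 24) (ax .kb)),
    .basic (.arith .sub (ax .r) (ax .kb) (ax .t0)),
    .ite (ax .t0) .skip (.block [setupPrecision, setupInput c, M.search])]

/-- Multiplying `u ≤ 2 ^ (-19 (ρ - 1))` and `u < 2 ^ (-19)` gives `u ^ 2 ≤ 2 ^ (-19 ρ) ≤ 2 ^ (-18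
ρ)`. -/
theorem le_half_pow {u : ℝ} {ρ : ℕ} (hu : 0 < u) (hu1 : u < 1 / 2 ^ 19) (hρ : 1 ≤ ρ)
    (h : u * (2 ^ 19) ^ (ρ - 1) < 1) : u ≤ ((1 / 2) ^ ρ) ^ 9 := by
  obtain ⟨j, rfl⟩ : ∃ j, ρ = j + 1 := ⟨ρ - 1, by omega⟩
  rw [Nat.add_sub_cancel] at h
  have h₁ : u ≤ (1 / 2 ^ 19) ^ j := by
    rw [one_div_pow, le_div_iff₀ (by positivity)]; exact h.le
  have h₂ : u ^ 2 ≤ (((1 / 2 : ℝ) ^ (j + 1)) ^ 9) ^ 2 := by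
    calc u ^ 2 = u * u := sq u
      _ ≤ (1 / 2 ^ 19) ^ j * (1 / 2 ^ 19) := mul_le_mul h₁ hu1.le hu.le (by positivity)
      _ = (1 / 2) ^ (19 * (j + 1)) := by rw [← pow_succ, pow_mul]; norm_num
      _ ≤ (1 / 2) ^ (18 * (j + 1)) :=
        pow_le_pow_of_le_one (by norm_num) (by norm_num) (by omega)
      _ = _ := by rw [← pow_mul, ← pow_mul]; congr 1; ring
  exact le_of_sq_le_sq h₂ (by positivity)

theorem unit_small {u : ℝ} {ρ : ℕ} (hu0 : 0 < u) (hu : u ≤ ((1 / 2) ^ ρ) ^ 9) (hρ : 1 ≤ ρ) :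
    ((2 * ρ + 1 : ℕ) : ℝ) * u ≤ 1 / 8 ∧ u ≤ ((2 : ℝ) ^ ρ)⁻¹ := by
  have ha : (0 : ℝ) < (1 / 2) ^ ρ := by positivity
  have ha1 : (1 / 2 : ℝ) ^ ρ ≤ 1 / 2 := pow_le_of_le_one (by norm_num) (by norm_num) (by omega)
  have e : ((2 : ℝ) ^ ρ)⁻¹ = (1 / 2) ^ ρ := by rw [one_div, inv_pow]
  rw [e]
  set a : ℝ := (1 / 2) ^ ρ with hadef
  have h₃ : a ^ 9 ≤ a := pow_le_of_le_one ha.le (by linarith) (by norm_num)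
  refine ⟨?_, hu.trans h₃⟩
  have h₁ : ((2 * ρ + 1 : ℕ) : ℝ) ≤ 2 ^ (2 * ρ) := by exact_mod_cast Nat.lt_two_pow_self
  have h₂ : (2 : ℝ) ^ (2 * ρ) * a ^ 2 = 1 := by
    rw [hadef, ← pow_mul, mul_comm ρ, ← mul_pow]; norm_num
  have h₄ : a ^ 7 ≤ (1 / 2) ^ 7 := pow_le_pow_left₀ ha.le ha1 7
  calc ((2 * ρ + 1 : ℕ) : ℝ) * u ≤ 2 ^ (2 * ρ) * a ^ 9 :=
        mul_le_mul h₁ hu hu0.le (by positivity)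
    _ = (2 ^ (2 * ρ) * a ^ 2) * a ^ 7 := by ring
    _ ≤ 1 / 8 := by rw [h₂]; norm_num at h₄ ⊢; linarith

end Main

section Main

variable {M : Machine}

/-- Data within `2 ^ (-ρ)` of `z` are admissible roundings for every `v ≥ 2 ^ (-ρ)`. So all
simulations may start from the same stored data and still count as computations with input `z`. -/
theorem Machine.SolvesWithCost.decidesFrom {B : DecisionProblem} {Arith : ℕ → ℕ → ℕ} {Prec : ℕ → ℕ}
    (h : M.SolvesWithCost B Arith Prec) {z : Input} (hz : B.WellPosed z) {ρ : ℕ} {w x : List ℝ}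
    (hw : List.Forall₂ (Rounds ((2 : ℝ) ^ ρ)⁻¹) (realBits z.1) w)
    (hx : List.Forall₂ (Rounds ((2 : ℝ) ^ ρ)⁻¹) z.2 x)
    (hA : Arith z.len (Prec (B.size z)) < ρ) {b : Bool} (hb : z ∈ B.carrier ↔ b = true) :
    M.DecidesFrom ρ w x (Prec (B.size z)) b := by
  intro v hv hv1 hρ hK f hf
  have hc : M.IsComputation v z f :=
    ⟨⟨w, x, hw.imp fun _ _ h => h.mono hρ, hx.imp fun _ _ h => h.mono hρ, hf.1⟩, hf.2⟩
  obtain ⟨h₁, h₂⟩ := h z hz v hv hv1 f hc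
  refine ⟨?_, ?_⟩
  · rintro b' ⟨i, hi⟩
    have h₃ : M.Outputs f b := by
      cases b
      · exact (h₂ hK).2 (by simp [hb])
      · exact (h₂ hK).1 (by simp [hb])
    obtain ⟨j, hj⟩ := h₃
    exact Machine.halt_unique hf.2 hi hj
  · intro e
    obtain ⟨i, hi, b', hb'⟩ := h₁
    exact ⟨i, by rw [e] at hi; omega, b', hb'⟩

/-- The program halts; unless the precision is very small, it searches for a witness. -/
theorem Ends.decider {p : ℕ[X]} {c : Cmd M.Tp} (hc : ComputesEval p c) {z : Input} {u : ℝ} {L : ℕ}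
    {s : State M.Tp} {Q : State M.Tp → Prop} (hu : 0 < u) (hu1 : u < 1) (hs : InitialState u z s)
    (hL : 2 ^ ((precision u + 1) * (precision u + 1)) + (precision u + 1) * (precision u + 1) + 2 +
      p.eval (z.len + 1) + z.len ≤ L)
    (hQ : ∀ s', (26 ≤ precision u → ∃ (ρ : ℕ) (eps γ : ℝ) (w x : List ℝ), 2 ≤ ρ ∧
        precision u ≤ 21 * ρ ∧ u ≤ ((1 / 2) ^ ρ) ^ 9 ∧ (1 / 8) ^ ρ ≤ eps ∧ eps ≤ (1 / 3) ^ ρ ∧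
        Rounds u (1 + eps) γ ∧ List.Forall₂ (Rounds u) (realBits z.1) w ∧
        List.Forall₂ (Rounds u) z.2 x ∧
        ((∀ y' : List ℝ, y'.length = p.eval z.len →
          ∃ K, 1 ≤ K ∧ K ≤ ρ ∧ M.DecidesFrom ρ w (x ++ y') K false) → ¬ s' (ax .ans) 0 < 0) ∧
        ((∃ n < 2 ^ (ρ * ρ), ∀ y₀ D, y₀.length = p.eval z.len →
          GenRun u γ (genOps n (ρ * ρ)) ⟨1, y₀, 0⟩ D →
          ∃ K, 1 ≤ K ∧ K ≤ ρ ∧ M.DecidesFrom ρ w (x ++ D.vec) K true) → s' (ax .ans) 0 < 0)) →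
      Q s') : Ends u L (M.decider c) s Q := by
  obtain ⟨w, x, hw, hx, h0, h1, h2, h3⟩ := hs
  rw [tapeOfList_bits] at h2
  have hlen : w.length + x.length = z.len := by
    rw [← hw.length_eq, ← hx.length_eq, Input.len, realBits, List.length_map]
  have hpow : 0 < 2 ^ ((precision u + 1) * (precision u + 1)) := by positivity
  have hz : ∀ (s' : State M.Tp) (a : Aux), s' (ax a) = s (ax a) → OpenRuler 0 (s' (ax a)) := by
    intro s' a h
    rw [h, h3]
    exact openRuler_zero.2 fun _ => le_rfl
  refine .cons (.unit (.cons (.const fun v hv => .cons (.arith fun t ht => .cons (.ite ?_ ?_)))))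
  · intro h
    -- The search is skipped only if `u` is at least about `2 ^ (-24)`, which precision `26`
    -- excludes.
    refine .skip (.nil (hQ _ fun hk => ?_))
    have h₁ := (lt_precision_iff hu 25).1 (by omega)
    have h₂ : 0 ≤ u - v := by simpa [ArithOp.eval] using (ht.nonneg_iff hu1.le).1 (by simpa using h)
    have h₃ := hv.ge (by positivity)
    norm_num at h₁ h₃
    linarith
  · intro h
    have h₂ : u - v < 0 := by simpa [ArithOp.eval] using (ht.neg_iff hu1.le).1 (by simpa using h)
    have h₃ := hv.le (by positivity)
    have hu23 : u < (1 / 2) ^ 23 := by norm_num at h₃ ⊢; linarith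
    have hu19 : u < 1 / 2 ^ 19 := by norm_num at hu23 ⊢; linarith
    -- With `precision u ≤ 21 * ρ` this yields `ρ ≥ 2`, and so `ρ < ρ * ρ`, as `Ends.search`
    -- requires.
    have hk := (lt_precision_iff hu 23).2 hu23
    set s₁ := put (put (put s (ax .r) u) (ax .kb) v) (ax .t0) t with hs₁
    have e₁ : EqOff [ax .r, ax .kb, ax .t0] s s₁ :=
      (((EqOff.refl _ _).put (by simp) _).put (by simp) _).put (by simp) _
    refine .cons (.setupPrecision hu hu19 (by rw [e₁ _ (by simp), h2]) (by simp [hs₁])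
      (hz _ _ (e₁ _ (by simp))) (hz _ _ (e₁ _ (by simp))) (hz _ _ (e₁ _ (by simp))) (by omega) ?_)
    intro s₂ ρ eps b₁ b₂ b₃ b₄ b₅ b₆ b₇ b₈ b₉ b₁₀ b₁₁ b₁₂ b₁₃
    have e₂ : EqOff [.inl 2, ax .one, ax .kb, ax .qt, ax .hf, ax .eps, ax .t0,
        ax .ra, ax .ra', ax .rb, ax .c, ax .r] s s₂ := (e₁.mono (by simp)).trans b₁₃
    have hρ : ρ * ρ ≤ (precision u + 1) * (precision u + 1) := Nat.mul_le_mul b₂ b₂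
    have hρ' : 2 ^ (ρ * ρ) ≤ 2 ^ ((precision u + 1) * (precision u + 1)) :=
      Nat.pow_le_pow_right (by norm_num) hρ
    have hmL : p.eval (w.length + x.length) ≤ p.eval (z.len + 1) := eval_mono p (by omega)
    refine .cons (.setupInput hc hu1.le (w := w) (x := x) (by rw [e₂ _ (by simp), h0])
      (by rw [e₂ _ (by simp), h1]) b₈ (by rw [e₂ _ (by simp), h3]) (hz _ _ (e₂ _ (by simp)))
      (hz _ _ (e₂ _ (by simp))) (hz _ _ (e₂ _ (by simp))) (hz _ _ (e₂ _ (by simp)))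
      (hz _ _ (e₂ _ (by simp))) (by omega) (by rw [hlen]; omega) ?_)
    intro s₃ c₁ c₂ c₃ c₄
    have e₃ : ∀ d : M.Tp, d ∉ [.inl 2, ax .one, ax .kb, ax .qt, ax .hf, ax .eps, ax .t0,
        ax .ra, ax .ra', ax .rb, ax .c, ax .r, realsTape, ax .p0, ax .p1, ax .nn, ax .mm, ax .mm'] →
        s₃ d = s d := by
      intro d hd
      simp only [List.mem_cons, List.not_mem_nil, or_false, not_or] at hd
      rw [c₄ d (by simp [hd]), e₂ d (by simp [hd])]
    have h9 := le_half_pow hu hu19 b₁ b₄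
    obtain ⟨g₁, g₂⟩ := unit_small hu h9 b₁
    have hbit : ∀ a : Aux, s (ax a) = bitTape 0 := by
      intro a; rw [h3]; ext i; simp [bitTape]
    refine .cons (.search (y := List.replicate (p.eval (w.length + x.length)) 0)
      (m := p.eval (w.length + x.length)) (γ := s₂ (ax .c) 0) (w := w) (x := x)
      hu hu1 ⟨?_, ?_, ?_, ?_, ?_, ?_, ?_, c₃, c₂, ?_, ?_, 0, by omega, ?_⟩ (by simp) c₁ ?_ ?_ g₁ g₂
      (l := ρ * ρ) (by nlinarith) (by omega) (by omega) (by omega) fun s₄ d₁ d₂ => .nil (.nil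
      (hQ s₄ fun _ => ⟨ρ, eps, _, w, x, by omega, b₃, h9, b₅, b₆, b₇, hw, hx, ?_, ?_⟩)))
    · rw [c₄ _ (by simp), b₈]
    · rw [e₃ _ (by simp), h3]
    · rw [c₄ _ (by simp)]
    · rw [c₄ _ (by simp)]; exact b₉
    · rw [c₄ _ (by simp)]; exact b₁₀
    · rw [c₄ _ (by simp)]; exact b₁₁
    · rw [c₄ _ (by simp)]; exact b₁₂
    · rw [e₃ _ (by simp), h0]
    · exact hz _ _ (e₃ _ (by simp))
    · rw [e₃ _ (by simp), hbit]
    · rw [e₃ _ (by simp), hbit]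
    · rw [e₃ _ (by simp), h3]
    · rw [← hlen]; exact d₁
    · rw [← hlen]; exact d₂

/-- All vectors of small magnitude are generated, up to rounding. -/
theorem exists_code_of_mgt_le {u eps γ : ℝ} {ρ q : ℕ} {y : List ℝ} (hu : 0 < u) (hu1 : u < 1)
    (hρ : 4 ≤ ρ) (hq : q + 7 ≤ ρ) (hy : 30 * y.length ≤ ρ) (hmgt : ∀ a ∈ y, mgt a ≤ q)
    (h9 : u ≤ ((1 / 2) ^ ρ) ^ 9) (h8 : (1 / 8) ^ ρ ≤ eps) (h3 : eps ≤ (1 / 3) ^ ρ)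
    (hγ : Rounds u (1 + eps) γ) :
    ∃ n < 2 ^ (ρ * ρ), ∀ (y₀ : List ℝ) (D : GenState), y₀.length = y.length →
      GenRun u γ (genOps n (ρ * ρ)) ⟨1, y₀, 0⟩ D →
      List.Forall₂ (Rounds ((2 : ℝ) ^ ρ)⁻¹) y D.vec := by
  have e : ((2 : ℝ) ^ ρ)⁻¹ = (1 / 2) ^ ρ := by rw [one_div, inv_pow]
  have e8 : (1 / 8 : ℝ) ^ ρ = ((1 / 2) ^ ρ) ^ 3 := by rw [← pow_mul, mul_comm, pow_mul]; norm_num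
  have e3 : (1 / 3 : ℝ) ^ ρ ≤ (1 / 2) ^ ρ / 4 := by
    have : (2 / 3 : ℝ) ^ ρ ≤ (2 / 3) ^ 4 :=
      pow_le_pow_of_le_one (by norm_num) (by norm_num) hρ
    calc (1 / 3 : ℝ) ^ ρ = (1 / 2) ^ ρ * (2 / 3) ^ ρ := by rw [← mul_pow]; norm_num
      _ ≤ (1 / 2) ^ ρ * (1 / 4) :=
        mul_le_mul_of_nonneg_left (this.trans (by norm_num)) (by positivity)
      _ = _ := by ring
  have ha : (0 : ℝ) < (1 / 2) ^ ρ := by positivity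
  have ha1 : (1 / 2 : ℝ) ^ ρ ≤ 1 / 16 :=
    (pow_le_pow_of_le_one (by norm_num) (by norm_num) hρ).trans (by norm_num)
  have ek : ∀ i j : ℕ, (1 / 2 : ℝ) ^ (i * ρ + j) = ((1 / 2) ^ ρ) ^ i * (1 / 2) ^ j := by
    intro i j; rw [pow_add, mul_comm i, pow_mul]
  have hK' : (2 : ℝ) ^ (4 * ρ) * ((1 / 2) ^ ρ) ^ 4 = 1 := by
    rw [← pow_mul, mul_comm ρ, ← mul_pow]; norm_num
  have hbu : ((2 * 2 ^ (4 * ρ + q + 2) + 2 : ℕ) : ℝ) * u ≤ (1 / 2) ^ ρ / 8 := by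
    have h₁ : ((2 * 2 ^ (4 * ρ + q + 2) + 2 : ℕ) : ℝ) ≤ 2 ^ (8 * ρ - 3) := by
      have h₀ : 2 ≤ 2 ^ (4 * ρ + q + 3) := by
        calc 2 = 2 ^ 1 := rfl
          _ ≤ _ := Nat.pow_le_pow_right (by norm_num) (by omega)
      have h₂ : 2 * 2 ^ (4 * ρ + q + 2) + 2 ≤ 2 ^ (4 * ρ + q + 4) := by
        have e₁ : 2 ^ (4 * ρ + q + 3) = 2 ^ (4 * ρ + q + 2) * 2 := pow_succ _ _
        have e₂ : 2 ^ (4 * ρ + q + 4) = 2 ^ (4 * ρ + q + 3) * 2 := pow_succ _ _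
        omega
      exact_mod_cast h₂.trans (Nat.pow_le_pow_right (by norm_num) (by omega))
    calc _ ≤ (2 : ℝ) ^ (8 * ρ - 3) * ((1 / 2) ^ ρ) ^ 9 :=
          mul_le_mul h₁ h9 hu.le (by positivity)
      _ = (1 / 2) ^ ρ / 8 := by
        obtain ⟨j, hj⟩ : ∃ j, 8 * ρ = j + 3 := ⟨8 * ρ - 3, by omega⟩
        have h₂ : (2 : ℝ) ^ (8 * ρ) * ((1 / 2) ^ ρ) ^ 8 = 1 := by
          rw [← pow_mul, mul_comm ρ, ← mul_pow]; norm_num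
        rw [hj, pow_add] at h₂
        rw [show 8 * ρ - 3 = j by omega]
        linear_combination (1 / 8) * (1 / 2) ^ ρ * h₂
  rw [e8] at h8
  rw [e]
  set a : ℝ := (1 / 2) ^ ρ
  have hua : u ≤ a ^ 4 := h9.trans (pow_le_pow_of_le_one ha.le (by linarith) (by norm_num))
  have ha4 : a ^ 4 ≤ a ^ 3 / 16 := by
    have := mul_le_mul_of_nonneg_left ha1 (pow_pos ha 3).le
    rw [pow_succ]; linarith
  have ha3 : a ^ 3 ≤ a / 16 := by
    have : a ^ 2 ≤ (1 / 16) ^ 2 := pow_le_pow_left₀ ha.le ha1 2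
    rw [pow_succ, mul_comm]
    have := mul_le_mul_of_nonneg_left this ha.le
    linarith
  have heps : 0 < eps := (pow_pos ha 3).trans_le h8
  have hγ₁ := hγ.ge (by linarith)
  have hγ₂ := hγ.le (by linarith)
  have heu : eps * u ≤ u := by
    have : eps ≤ 1 := by linarith
    nlinarith
  have hγ1 : 1 + a ^ 4 ≤ γ := by nlinarith
  have hγ2 : γ ≤ 1 + a / 2 := by nlinarith
  -- With `a = 2 ^ (-ρ)`, the factor `γ` lies between `1 + a ^ 4` and `1 + a / 2`. Hence `γ ^ 2 ^ (4
  -- ρ) ≥ 2`, exponents below `2 ^ b` suffice, and one entry takes `2 * b + 3 ≤ 10 * ρ` operations.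
  -- The bound `u ≤ a ^ 9` keeps the roundings in about `2 ^ (b + 1)` operations below `a / 8`.
  refine exists_code (K := 2 ^ (4 * ρ)) (M := 2 ^ (q + 1)) (b := 4 * ρ + q + 2) hu hu1 ha
    (by linarith) (by have := pow_pos ha 4; linarith) hγ2 ?_ ?_ hbu y
    (fun z hz => abs_le_of_mgt_le (hmgt z hz)) ?_
  · have h₁ := one_add_mul_le_pow (a := a ^ 4) (by have := pow_pos ha 4; linarith) (2 ^ (4 * ρ))
    push_cast at h₁
    rw [hK'] at h₁
    calc (2 : ℝ) = 1 + 1 := by norm_num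
      _ ≤ _ := h₁
      _ ≤ _ := pow_le_pow_left₀ (by positivity) hγ1 _
  · calc 2 ^ (4 * ρ) * (2 ^ (q + 1) + 1) ≤ 2 ^ (4 * ρ) * 2 ^ (q + 2) := by
          refine Nat.mul_le_mul_left _ ?_
          have := Nat.one_le_two_pow (n := q + 1)
          rw [pow_succ 2 (q + 1)]; omega
      _ = _ := by rw [← pow_add, add_assoc]
  · calc 3 * (y.length * (2 * (4 * ρ + q + 2) + 3)) ≤ 3 * (y.length * (10 * ρ)) := by gcongr; omega
      _ = 30 * y.length * ρ := by ring
      _ ≤ ρ * ρ := Nat.mul_le_mul_right _ hy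

end Main

/-! ### The inclusion -/

/-- On the nonnegative reals, a real polynomial is dominated by one with natural coefficients. -/
theorem exists_natPolynomial_ge (Q : ℝ[X]) :
    ∃ P : ℕ[X], ∀ (t : ℝ) (n : ℕ), 0 ≤ t → t ≤ n → Q.eval t ≤ P.eval n := by
  induction Q using Polynomial.induction_on' with
  | add Q₁ Q₂ h₁ h₂ =>
    obtain ⟨P₁, h₁⟩ := h₁
    obtain ⟨P₂, h₂⟩ := h₂
    refine ⟨P₁ + P₂, fun t n ht htn => ?_⟩
    rw [Polynomial.eval_add, Polynomial.eval_add]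
    push_cast
    exact add_le_add (h₁ t n ht htn) (h₂ t n ht htn)
  | monomial k a =>
    refine ⟨Polynomial.monomial k ⌈a⌉₊, fun t n ht htn => ?_⟩
    rw [Polynomial.eval_monomial, Polynomial.eval_monomial]
    push_cast
    exact mul_le_mul (Nat.le_ceil a) (pow_le_pow_left₀ ht htn k) (by positivity) (by positivity)

theorem DecisionProblem.WellPosed.logCond_nonneg {S : DecisionProblem} {z : Input}
    (hz : S.WellPosed z) : 0 ≤ S.logCond z := by
  refine Real.logb_nonneg (by norm_num) ?_
  have := ENNReal.toReal_mono hz (S.one_le_μ z)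
  simpa using this

theorem DecisionProblem.logCond_le_size (S : DecisionProblem) (z : Input) :
    S.logCond z ≤ S.size z := by
  rw [size]
  push_cast
  exact (Nat.le_ceil _).trans (by simp)

/-- The running time of a program, if its loops are bounded as for the search for a witness. -/
theorem exists_cost_le {T : Type} [DecidableEq T] (c : Cmd T) (p : ℕ[X]) : ∃ A D : ℕ, ∀ n k : ℕ,
    c.cost (2 ^ ((k + 1) * (k + 1)) + (k + 1) * (k + 1) + 2 + p.eval (n + 1) + n) ≤
      2 ^ (A * ((n + 1) * (k + 1)) ^ D) := by
  obtain ⟨K, hK⟩ := c.cost_le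
  obtain ⟨e, d, hp⟩ := exists_eval_le_pow p
  refine ⟨(5 + 2 ^ e * 3 ^ d) * K, d + 2, fun n k => (hK _ ?_).trans ?_⟩
  · have : 0 < 2 ^ ((k + 1) * (k + 1)) := by positivity
    omega
  have h₁ : p.eval (n + 1) ≤ 2 ^ e * 3 ^ d * (n + 1) ^ d := by
    refine (hp (n + 1)).trans ?_
    rw [pow_add, mul_comm d, pow_mul, mul_assoc, ← mul_pow]
    exact Nat.mul_le_mul_left _ (Nat.pow_le_pow_left ((two_pow_size_le _).trans (by omega)) d)
  have hs : ∀ i j : ℕ, i ≤ d + 2 → j ≤ d + 2 →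
      (n + 1) ^ i * (k + 1) ^ j ≤ ((n + 1) * (k + 1)) ^ (d + 2) := by
    intro i j hi hj
    rw [mul_pow]
    exact Nat.mul_le_mul (Nat.pow_le_pow_right (by omega) hi) (Nat.pow_le_pow_right (by omega) hj)
  have h₂ := hs 0 2 (by omega) (by omega)
  have h₃ := hs 0 0 (by omega) (by omega)
  have h₄ := hs d 0 (by omega) (by omega)
  have h₅ := hs 1 0 (by omega) (by omega)
  rw [pow_zero, one_mul, sq] at h₂
  rw [pow_zero, pow_zero, one_mul] at h₃
  rw [pow_zero, mul_one] at h₄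
  rw [pow_zero, mul_one, pow_one] at h₅
  set G := ((n + 1) * (k + 1)) ^ (d + 2)
  have h₆ := Nat.mul_le_mul_left (2 ^ e * 3 ^ d) h₄
  set E := (k + 1) * (k + 1) + ((k + 1) * (k + 1) + 2 + p.eval (n + 1) + n) with hE
  have h₇ : 2 ^ ((k + 1) * (k + 1)) + (k + 1) * (k + 1) + 2 + p.eval (n + 1) + n ≤ 2 ^ E := by
    rw [hE, pow_add]
    rw [add_assoc, add_assoc, add_assoc, ← add_assoc _ 2, ← add_assoc _ (p.eval _)]
    generalize (k + 1) * (k + 1) + 2 + p.eval (n + 1) + n = y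
    have h₁ : y + 1 ≤ 2 ^ y := Nat.lt_two_pow_self
    have h₂ : 1 ≤ 2 ^ ((k + 1) * (k + 1)) := Nat.one_le_two_pow
    nlinarith
  calc _ ≤ (2 ^ E) ^ K := Nat.pow_le_pow_left h₇ K
    _ = 2 ^ (E * K) := by rw [pow_mul]
    _ ≤ _ := by
      refine Nat.pow_le_pow_right (by norm_num) ?_
      rw [mul_right_comm]
      refine Nat.mul_le_mul_right _ ?_
      rw [add_mul]
      omega

/-- For members, some code generates a rounding of the witness and the verdict on it is Yes. For
nonmembers, each vector that the program meets is itself an exact input of `B`, well conditioned and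
rejected by condition (ii). -/
theorem NPBro_subset : NPBro ⊆ EXProPolyPrec := by
  rintro W ⟨B, ⟨Arith, Prec, ⟨-, -, hPrec1, M, hM⟩, ⟨P₁, hP₁⟩, P₂, hP₂⟩, p, q, Q, hW⟩
  obtain ⟨c, hc⟩ := exists_computesEval (τ := M.extraTapes + 3) (N := M.extraNodes + 1) p
  obtain ⟨Q', hQ'⟩ := exists_natPolynomial_ge Q
  obtain ⟨A, D, hAD⟩ := exists_cost_le (M.decider c) p
  let S : ℕ[X] := Polynomial.X + p + Q'
  -- All that `ρ` has to exceed: the precision and the time that `M` needs on instances of size at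
  -- most `S`, and the length and magnitude of the witness. Since `precision u ≤ 21 * ρ`, a
  -- precision of at least `21 * F + 26` is enough.
  let F : ℕ[X] := P₁.comp S + P₂.comp S + 30 * p + q + 16
  obtain ⟨e, d, hF⟩ := exists_eval_le_pow (21 * F + 26)
  have hsize : ∀ (w : List Bool) (x y : List ℝ), y.length = p.eval (Input.len (w, x)) →
      W.WellPosed (w, x) → B.logCond (w, x ++ y) ≤ Q.eval (W.logCond (w, x)) →
      B.size (w, x ++ y) ≤ S.eval (W.size (w, x)) := by
    intro w x y hy hz h
    have h₁ : ⌈B.logCond (w, x ++ y)⌉₊ ≤ Q'.eval (W.size (w, x)) :=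
      Nat.ceil_le.2 (h.trans (hQ' _ _ hz.logCond_nonneg (W.logCond_le_size _)))
    have h₂ := eval_mono p (W.len_le_size (w, x))
    have h₃ := W.len_le_size (w, x)
    have h₄ : Input.len (w, x ++ y) = Input.len (w, x) + y.length := by
      simp [Input.len, add_assoc]
    rw [DecisionProblem.size, h₄, hy]
    simp only [S, Polynomial.eval_add, Polynomial.eval_X]
    omega
  refine mem_EXProPolyPrec (M.decider c) (ax .ans) A D e (d + 1) (by omega) ?_
  rintro ⟨w, x⟩ hz u hu hu1 s hs
  refine (Ends.decider hc hu hu1 hs le_rfl fun s' h hk => ?_).le (hAD _ _)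
  have hk' : (21 * F + 26).eval (W.size (w, x)) ≤ precision u :=
    (hF _).trans ((Nat.pow_le_pow_right (by norm_num) (by gcongr; omega)).trans hk)
  simp only [Polynomial.eval_add, Polynomial.eval_mul, Polynomial.eval_ofNat] at hk'
  obtain ⟨ρ, eps, γ, v, x', h2, hkρ, h9, h8, h3, hγ, hv, hx, hno, hyes⟩ := h (by omega)
  have hFρ : F.eval (W.size (w, x)) < ρ := by omega
  simp only [F, Polynomial.eval_add, Polynomial.eval_mul, Polynomial.eval_ofNat,
    Polynomial.eval_comp] at hFρ
  obtain ⟨-, huρ⟩ := unit_small hu h9 (by omega)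
  have hpn := eval_mono p (W.len_le_size (w, x))
  have key : ∀ (y y' : List ℝ) (b : Bool), y.length = p.eval (Input.len (w, x)) →
      B.WellPosed (w, x ++ y) → B.logCond (w, x ++ y) ≤ Q.eval (W.logCond (w, x)) →
      List.Forall₂ (Rounds ((2 : ℝ) ^ ρ)⁻¹) y y' → ((w, x ++ y) ∈ B.carrier ↔ b = true) →
      ∃ K, 1 ≤ K ∧ K ≤ ρ ∧ M.DecidesFrom ρ v (x' ++ y') K b := by
    intro y y' b hy hB hlog hyy hb
    have h₁ := hsize w x y hy hz hlog
    have h₂ := eval_mono P₁ h₁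
    have h₃ := eval_mono P₂ h₁
    refine ⟨_, hPrec1 _, (hP₁ _).trans (by omega), hM.decidesFrom hB
      (hv.imp fun _ _ h => h.mono huρ) (List.rel_append (hx.imp fun _ _ h => h.mono huρ) hyy)
      ((hP₂ _ hB).trans_lt (by omega)) hb⟩
  refine ⟨fun hmem => hyes ?_, fun hans => by_contra fun hmem => hno (fun y' hy' => ?_) hans⟩
  · obtain ⟨y, hy, hyB, hy'⟩ := (hW w x).1 hmem
    obtain ⟨hB, hlog, hmgt⟩ := hy' hz
    obtain ⟨i, hi, hcode⟩ := exists_code_of_mgt_le (q := q.eval (W.size (w, x))) hu hu1 (by omega) (by omega)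
      (by omega) hmgt h9 h8 h3 hγ
    exact ⟨i, hi, fun y₀ G hy₀ hG => key y G.vec true hy hB hlog
      (hcode y₀ G (hy₀.trans hy.symm) hG) (by simpa using hyB)⟩
  · obtain ⟨hyB, hy''⟩ := (hW w x).2 hmem y' hy'
    obtain ⟨hB, hlog⟩ := hy'' hz
    exact key y' y' false hy' hB hlog
      (List.forall₂_same.2 fun a _ => Rounds.refl (by positivity) a) (by simpa using hyB)

end RoundoffComplexity

theorem mainTheorem4 : RoundoffComplexity.NPBro ⊂ RoundoffComplexity.EXProPolyPrec :=
  ⟨RoundoffComplexity.NPBro_subset, fun h =>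
    RoundoffComplexity.towerParity_notMem (h RoundoffComplexity.towerParity_mem)⟩
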